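/- **Setting.** An element is a nondegenerate triangle or a nondegenerate strictly convex quadrilateral in $\mathbb R^2$ (closed, vertices listed counterclockwise). A triangulation $\mathcal T$ of $\overline\Omega$ is a finite set of elements, all triangles or all quadrilaterals, with union $\overline\Omega$ and pairwise disjoint interiors; its nodes are numbered, and a node is *older* than another one if its number is smaller. A node is *hanging* if it lies on the boundary of an element without being one of its vertices; an edge of an element is *irregular* if a hanging node lies in its relative interior. $\mathcal T$ is *conforming* if it has no hanging node, and *1-irregular* if every edge of every element has at most one hanging node in its relative interior. *Red refinement* of a triangle (quadrilateral) splits it into four by joining the midpoints of its edges (of opposite edges); "$\mathcal T$ is obtained from $\mathcal T_0$ by red refinement" means by finitely many steps, each of which red-refines some of the elements and appends the new nodes, in any order, to the numbering. Two different elements are (direct) neighbors if they have a common edge. $\mathcal T$ satisfies the *$d$-Neighbor Rule* if no element of $\mathcal T$ has $d$ or more neighbors, among the elements that arise from $\mathcal T_0$ by iterated red refinement, that have been red-refined in $\mathcal T$. **Algorithm** CoarsenR$(\mathcal T,\mathcal T_{\rm mark})$; $\mathcal N_0$ is the set of nodes of $\mathcal T_0$. *Admissible.* For quadrilaterals, let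 the vertices of each element be cyclically ordered with the oldest first. Whenever exactly four elements have the same third vertex $v$ and $v\notin\mathcal N_0$, the set of elements containing $v$ is a quartet. For triangles, assign to each edge the oldest one among the oldest vertices of the elements having this edge. An element without nodes in $\mathcal N_0$ is a *middle element* if its three edges do not all have the same node assigned. Each middle element with three direct neighbors forms a quartet with them. Let $\mathcal A$ be the set of these quartets. *Mark.* Keep in $\mathcal A$ only the quartets containing an element of $\mathcal T_{\rm mark}$. *Closure.* Remove all quartets having an element with an irregular edge. Then, always for quadrilaterals, and for triangles if the 2-Neighbor Rule is switched on, repeat the following until $\mathcal A$ no longer changes: give weights to the nodes of the stencil of each $Q\in\mathcal A$ and remove, simultaneously, all $Q$ whose weights sum to at most $5$ (quadrilaterals) or at most $4$ (triangles). The stencil of $Q$ consists of all nodes of $Q$ except the oldest nodes of its four elements (quadrilaterals), or of the three vertices of its middle element (triangles). A node has weight $0$ if it is the common third vertex of the four quadrilaterals; otherwise weight $2$ if it is a hanging node, lies on $\partial\overline\Omega$, or lies in the stencil of another quartet of $\mathcal A$; otherwise weight $1$. *Update.* Replace the four elements of each $Q\in\mathcal A$ by one element, whose vertices are the oldest nodes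 of the four quadrilaterals, respectively of the three non-middle triangles; delete the nodes that no longer occur, and keep the order of the others. **Theorem.** Let $\mathcal T_0$ be a conforming triangulation of $\overline\Omega$ into triangles or into convex quadrilaterals, let $\mathcal T$ be a 1-irregular triangulation obtained from $\mathcal T_0$ by red refinement, and let $\mathcal T_{\rm mark}\subseteq\mathcal T$. For triangles assume also that the numbering respects generations: for each triangle that has been red-refined, its three vertices are older than the midpoints of its three edges. Let $\hat{\mathcal T}=$ CoarsenR$(\mathcal T,\mathcal T_{\rm mark})$. Then: 1. $\hat{\mathcal T}$ is a 1-irregular triangulation of $\overline\Omega$. 2. The family of all $\hat{\mathcal T}$ that arise in this way from a fixed $\mathcal T_0$ is shape regular. For triangles: there is $c\ge 1$, depending only on $\mathcal T_0$, such that $h_T\le c\,\rho_T$ for all $T\in\hat{\mathcal T}$, where $h_T$ is the diameter of $T$ and $\rho_T$ is the diameter of the largest ball inscribed in $T$. For quadrilaterals: there are $c_1\ge1$ and $0<c_2<1$, depending only on $\mathcal T_0$, such that for all $T\in\hat{\mathcal T}$ the longest edge of $T$ is at most $c_1$ times its shortest edge and $|\cos\varphi|\le c_2$ for all inner angles $\varphi$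 of $T$. 3. For quadrilaterals: if $\mathcal T$ satisfies the 3-Neighbor Rule, then so does $\hat{\mathcal T}$. For triangles with the 2-Neighbor Rule switched on: if $\mathcal T$ satisfies the 2-Neighbor Rule, then so does $\hat{\mathcal T}$. -/

import Mathlib

namespace RedMesh

/-- The Euclidean plane. -/
abbrev Plane : Type := EuclideanSpace ℝ (Fin 2)

/-- An element with `n` vertices, given by its list of vertices in cyclic order
(triangles: `n = 3`, quadrilaterals: `n = 4`; indices are taken modulo `n`). -/
abbrev Elem (n : ℕ) : Type := Fin n → Plane

/-- Twice the signed area of the triangle `a b c`. -/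
def cross (a b c : Plane) : ℝ :=
  (b 0 - a 0) * (c 1 - a 1) - (b 1 - a 1) * (c 0 - a 0)

/-- The element as a closed subset of the plane: the convex hull of its vertices. -/
def hull {n : ℕ} (T : Elem n) : Set Plane := convexHull ℝ (Set.range T)

/-- The `i`-th edge of an element, as the unordered pair of its endpoints. -/
def edge {n : ℕ} [NeZero n] (T : Elem n) (i : Fin n) : Sym2 Plane := s(T i, T (i + 1))

/-- The vertices are in convex position and in mathematically positive order: there is a strict
left turn at each of them. For `n = 3, 4` this says exactly that `T` is a nondegenerate triangle,
resp. a nondegenerate (strictly) convex quadrilateral, listed counterclockwise. -/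
def IsConvexCCW {n : ℕ} [NeZero n] (T : Elem n) : Prop :=
  ∀ i : Fin n, 0 < cross (T i) (T (i + 1)) (T (i + 2))

/-- Mesh data: the array of nodes in the order of their creation (the smaller the index, the
older the node), and the finite set of elements. -/
structure Mesh (n : ℕ) where
  nodes : List Plane
  elements : Finset (Elem n)

/-! ### Triangulations, hanging nodes, irregularity -/

/-- `M` is a triangulation of the closed region `R` (the closure of the polygonal domain): finitely
many nondegenerate elements with pairwise disjoint interiors which cover `R`; the array of nodes
lists each vertex of an element exactly once, and nothing else. -/
structure IsTriangulation {n : ℕ} [NeZero n] (R : Set Plane) (M : Mesh n) : Prop where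
  convexCCW : ∀ T ∈ M.elements, IsConvexCCW T
  disjoint : ∀ T ∈ M.elements, ∀ K ∈ M.elements, T ≠ K →
    Disjoint (interior (hull T)) (interior (hull K))
  cover : ⋃ T ∈ M.elements, hull T = R
  nodup : M.nodes.Nodup
  mem_nodes : ∀ v, v ∈ M.nodes ↔ ∃ T ∈ M.elements, v ∈ Set.range T

/-- `v` is a hanging node of `M`: a node in the boundary of an element that is not
one of the vertices of this element. -/
def IsHanging {n : ℕ} (M : Mesh n) (v : Plane) : Prop :=
  v ∈ M.nodes ∧ ∃ T ∈ M.elements, v ∈ frontier (hull T) \ Set.range T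

/-- A triangulation without hanging nodes. -/
def IsConforming {n : ℕ} (M : Mesh n) : Prop := ∀ v, ¬ IsHanging M v

/-- The hanging nodes that lie on the `i`-th edge of the element `T`: the nodes of `M` in the
relative interior of this edge. -/
def hangingOn {n : ℕ} [NeZero n] (M : Mesh n) (T : Elem n) (i : Fin n) : Set Plane :=
  {v | v ∈ M.nodes ∧ v ∈ openSegment ℝ (T i) (T (i + 1))}

/-- At most one hanging node per edge. -/
def IsOneIrregular {n : ℕ} [NeZero n] (M : Mesh n) : Prop :=
  ∀ T ∈ M.elements, ∀ i, (hangingOn M T i).Subsingleton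

/-- `T` has an irregular edge, i.e. an edge on which a hanging node lies. -/
def HasIrregularEdge {n : ℕ} [NeZero n] (M : Mesh n) (T : Elem n) : Prop :=
  ∃ i, (hangingOn M T i).Nonempty

/-- Boundary nodes: nodes on the boundary of the meshed region. -/
def IsBoundary {n : ℕ} (M : Mesh n) (v : Plane) : Prop :=
  v ∈ M.nodes ∧ v ∈ frontier (⋃ T ∈ M.elements, hull T)

/-- Two different elements with a common edge. -/
def IsNeighbor {n : ℕ} [NeZero n] (T K : Elem n) : Prop :=
  hull K ≠ hull T ∧ ∃ i j, edge T i = edge K j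

/-! ### Red refinement -/

/-- Red refinement of a triangle: join the midpoints of the edges. -/
noncomputable def triKids (T : Elem 3) : Finset (Elem 3) :=
  open scoped Classical in
  {![midpoint ℝ (T 0) (T 1), midpoint ℝ (T 1) (T 2), midpoint ℝ (T 2) (T 0)]} ∪
    Finset.univ.image fun k : Fin 3 =>
      ![T k, midpoint ℝ (T k) (T (k + 1)), midpoint ℝ (T (k + 2)) (T k)]

/-- The intersection of the two segments that join the midpoints of opposite edges of a
quadrilateral; it is the midpoint of both of them. -/
noncomputable def quadCenter (T : Elem 4) : Plane :=
  midpoint ℝ (midpoint ℝ (T 0) (T 1)) (midpoint ℝ (T 2) (T 3))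

/-- Red refinement of a quadrilateral: join the midpoints of opposite edges. -/
noncomputable def quadKids (T : Elem 4) : Finset (Elem 4) :=
  open scoped Classical in
  Finset.univ.image fun k : Fin 4 =>
    ![T k, midpoint ℝ (T k) (T (k + 1)), quadCenter T, midpoint ℝ (T (k + 3)) (T k)]

/-- One refinement step: all elements of some set `S` are red-refined, and the nodes that arise
and are not yet present are appended, in any order, to the array of nodes. -/
def RedStep {n : ℕ} (kids : Elem n → Finset (Elem n)) (M M' : Mesh n) : Prop :=
  open scoped Classical in
  ∃ S ⊆ M.elements, M'.elements = (M.elements \ S) ∪ S.biUnion kids ∧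
    ∃ l : List Plane, l.Nodup ∧
      (∀ v, v ∈ l ↔ v ∉ M.nodes ∧ ∃ T ∈ S, ∃ K ∈ kids T, v ∈ Set.range K) ∧
      M'.nodes = M.nodes ++ l

/-- `M` is obtained from `M₀` by (finitely many steps of adaptive) red refinement. -/
def IsRedRefinement {n : ℕ} (kids : Elem n → Finset (Elem n)) (M₀ M : Mesh n) : Prop :=
  Relation.ReflTransGen (RedStep kids) M₀ M

/-- The refinement forest over `M₀`: all elements that arise from elements of `M₀` by iterated
red refinement. -/
def forest {n : ℕ} (kids : Elem n → Finset (Elem n)) (M₀ : Mesh n) : Set (Elem n) :=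
  {K | ∃ T ∈ M₀.elements, Relation.ReflTransGen (fun A B => B ∈ kids A) T K}

/-- `K`, an element of the forest over `M₀`, has been red-refined in `M`: it is strictly larger
than some element of `M`. -/
def HasBeenRefined {n : ℕ} (kids : Elem n → Finset (Elem n)) (M₀ M : Mesh n) (K : Elem n) :
    Prop :=
  K ∈ forest kids M₀ ∧ ∃ S ∈ M.elements, hull S ⊂ hull K

/-- The `d`-Neighbor Rule: no (unrefined) element of the mesh has `d` or more neighbors that have
been red-refined. -/
def NeighborRule {n : ℕ} [NeZero n] (kids : Elem n → Finset (Elem n)) (M₀ : Mesh n) (d : ℕ)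
    (M : Mesh n) : Prop :=
  ∀ T ∈ M.elements, {K | IsNeighbor T K ∧ HasBeenRefined kids M₀ M K}.encard < d

/-! ### Ages of nodes -/

/-- The index of a node in the array of nodes. -/
noncomputable def age {n : ℕ} (M : Mesh n) (v : Plane) : ℕ :=
  open scoped Classical in M.nodes.idxOf v

/-- The numbering of the nodes respects the generations: whenever an element has been red-refined,
its vertices are older than the new nodes of this refinement. -/
def RespectsGenerations {n : ℕ} (kids : Elem n → Finset (Elem n)) (M₀ M : Mesh n) : Prop :=
  ∀ X, HasBeenRefined kids M₀ M X → ∀ i, ∀ K ∈ kids X, ∀ j, K j ∉ Set.range X →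
    age M (X i) < age M (K j)

/-- The position of the oldest vertex of an element. -/
noncomputable def oldestPos {n : ℕ} [NeZero n] (M : Mesh n) (T : Elem n) : Fin n :=
  Function.argmin fun i => age M (T i)

/-- The `j`-th vertex (`j = 0, …, n - 1`) of an element after the cyclic permutation of its
vertices that puts the oldest one first. -/
noncomputable def vert {n : ℕ} [NeZero n] (M : Mesh n) (T : Elem n) (j : Fin n) : Plane :=
  T (oldestPos M T + j)

/-! ### The steps that do not depend on the shape -/

/-- A quartet of elements. -/
abbrev Quartet (n : ℕ) : Type := Finset (Elem n)

/-- The nodes of the elements of a quartet. -/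
noncomputable def quartetNodes {n : ℕ} (Q : Quartet n) : Finset Plane :=
  open scoped Classical in Q.biUnion fun T => Finset.univ.image T

/-- Step Mark: keep the quartets with at least one marked element. -/
noncomputable def mark {n : ℕ} (A : Finset (Quartet n)) (Tmark : Finset (Elem n)) :
    Finset (Quartet n) :=
  open scoped Classical in A.filter fun Q => ∃ T ∈ Tmark, T ∈ Q

/-- First part of step Closure: block the quartets that have an element with an irregular edge. -/
noncomputable def blockIrregular {n : ℕ} [NeZero n] (M : Mesh n) (A : Finset (Quartet n)) :
    Finset (Quartet n) :=
  open scoped Classical in A.filter fun Q => ∀ T ∈ Q, ¬ HasIrregularEdge M T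

open scoped Classical in
/-- The while loop: remove simultaneously all `Q ∈ A` for which `keep A Q` fails, and repeat this
until `A` does not change any more. -/
noncomputable def pruneLoop {n : ℕ} (keep : Finset (Quartet n) → Quartet n → Prop)
    (A : Finset (Quartet n)) : Finset (Quartet n) :=
  if A.filter (keep A) = A then A else pruneLoop keep (A.filter (keep A))
termination_by A.card
decreasing_by
  exact Finset.card_lt_card (Finset.ssubset_iff_subset_ne.mpr
    ⟨Finset.filter_subset _ _, by assumption⟩)

/-- The elements with the given set `V` of vertices, counterclockwise and with the oldest vertex
first (if `V` consists of `n` points in convex position there is exactly one). -/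
noncomputable def joined {n : ℕ} [NeZero n] (M : Mesh n) (V : Finset Plane) : Finset (Elem n) :=
  open scoped Classical in
  (Fintype.piFinset fun _ : Fin n => V).filter fun P =>
    IsConvexCCW P ∧ Finset.univ.image P = V ∧ ∀ i, age M (P 0) ≤ age M (P i)

/-- Step Update: the four elements of each quartet `Q ∈ A` are replaced by their parent element,
which has the vertices `parentVerts Q`; nodes that do not occur any more are deleted. -/
noncomputable def update {n : ℕ} [NeZero n] (M : Mesh n) (parentVerts : Quartet n → Finset Plane)
    (A : Finset (Quartet n)) : Mesh n :=
  open scoped Classical in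
  let E : Finset (Elem n) :=
    (M.elements \ A.biUnion id) ∪ A.biUnion fun Q => joined M (parentVerts Q)
  { nodes := M.nodes.filter fun v => ∃ T ∈ E, v ∈ Set.range T
    elements := E }

/-! ### Quadrilaterals -/

/-- Step Admissible for quadrilaterals; `N₀` is the list of nodes of the initial mesh. If exactly
four elements have the same third vertex `v`, and `v` is not a node of the initial mesh, then the
elements that contain `v` form an admissible quartet. -/
noncomputable def quadAdmissible (N₀ : List Plane) (M : Mesh 4) : Finset (Quartet 4) :=
  open scoped Classical in
  (M.elements.filter fun T =>
      (M.elements.filter fun K => vert M K 2 = vert M T 2).card = 4 ∧ vert M T 2 ∉ N₀).image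
    fun T => M.elements.filter fun K => vert M T 2 ∈ hull K

/-- The vertices of the parent element: the oldest nodes of the elements of the quartet. -/
noncomputable def quadParentVerts (M : Mesh 4) (Q : Quartet 4) : Finset Plane :=
  open scoped Classical in Q.image fun T => vert M T 0

/-- The five-point stencil of a quartet: its nodes other than the vertices of the parent. -/
noncomputable def stencil (M : Mesh 4) (Q : Quartet 4) : Finset Plane :=
  open scoped Classical in quartetNodes Q \ quadParentVerts M Q

/-- The weight of a node `v` of the stencil of `Q ∈ A`. -/
noncomputable def quadWeight (M : Mesh 4) (A : Finset (Quartet 4)) (Q : Quartet 4) (v : Plane) :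
    ℕ :=
  open scoped Classical in
  if ∃ T ∈ Q, v = vert M T 2 then 0
  else if IsHanging M v ∨ IsBoundary M v ∨ ∃ Q' ∈ A, Q' ≠ Q ∧ v ∈ stencil M Q' then 2
  else 1

/-- Step Closure for quadrilaterals. -/
noncomputable def quadClosure (M : Mesh 4) (A : Finset (Quartet 4)) : Finset (Quartet 4) :=
  pruneLoop (fun A Q => ¬ ∑ v ∈ stencil M Q, quadWeight M A Q v ≤ 5) (blockIrregular M A)

/-- The coarsening algorithm for quadrilateral meshes. -/
noncomputable def quadCoarsenR (N₀ : List Plane) (M : Mesh 4) (Tmark : Finset (Elem 4)) : Mesh 4 :=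
  update M (quadParentVerts M) (quadClosure M (mark (quadAdmissible N₀ M) Tmark))

/-! ### Triangles -/

/-- The (index of the) node assigned to the edge `e`: the oldest one among the oldest nodes of the
elements that have the edge `e`. -/
noncomputable def edgeAge (M : Mesh 3) (e : Sym2 Plane) : ℕ :=
  sInf {a | ∃ K ∈ M.elements, (∃ i, edge K i = e) ∧ a = age M (vert M K 0)}

/-- Middle elements: not all three edges have the same oldest node assigned. Elements that have
a node of the initial mesh (the nodes in `N₀`) are not middle elements. -/
def IsMiddle (N₀ : List Plane) (M : Mesh 3) (T : Elem 3) : Prop :=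
  T ∈ M.elements ∧ vert M T 0 ∉ N₀ ∧ ¬ ∀ i j, edgeAge M (edge T i) = edgeAge M (edge T j)

/-- The direct neighbors of `T` in the mesh `M`. -/
noncomputable def directNeighbors {n : ℕ} [NeZero n] (M : Mesh n) (T : Elem n) :
    Finset (Elem n) :=
  open scoped Classical in M.elements.filter fun K => IsNeighbor T K

/-- Step Admissible for triangles: a middle element with three direct neighbors forms an
admissible quartet with them. -/
noncomputable def triAdmissible (N₀ : List Plane) (M : Mesh 3) : Finset (Quartet 3) :=
  open scoped Classical in
  (M.elements.filter fun T => IsMiddle N₀ M T ∧ (directNeighbors M T).card = 3).image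
    fun T => {T} ∪ directNeighbors M T

/-- The nodes of the middle element of a quartet. -/
noncomputable def middleNodes (N₀ : List Plane) (M : Mesh 3) (Q : Quartet 3) : Finset Plane :=
  open scoped Classical in quartetNodes (Q.filter fun T => IsMiddle N₀ M T)

/-- The vertices of the parent element: the oldest nodes of the elements of the quartet other than
the middle one. -/
noncomputable def triParentVerts (N₀ : List Plane) (M : Mesh 3) (Q : Quartet 3) : Finset Plane :=
  open scoped Classical in (Q.filter fun T => ¬ IsMiddle N₀ M T).image fun T => vert M T 0

/-- The weight of a node `v` of the middle element of `Q ∈ A`. -/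
noncomputable def triWeight (N₀ : List Plane) (M : Mesh 3) (A : Finset (Quartet 3))
    (Q : Quartet 3) (v : Plane) : ℕ :=
  open scoped Classical in
  if IsHanging M v ∨ IsBoundary M v ∨ ∃ Q' ∈ A, Q' ≠ Q ∧ v ∈ middleNodes N₀ M Q' then 2 else 1

/-- Step Closure for triangles; `use2` tells whether the 2-Neighbor Rule is in use. -/
noncomputable def triClosure (use2 : Bool) (N₀ : List Plane) (M : Mesh 3)
    (A : Finset (Quartet 3)) : Finset (Quartet 3) :=
  if use2 then
    pruneLoop (fun A Q => ¬ ∑ v ∈ middleNodes N₀ M Q, triWeight N₀ M A Q v ≤ 4)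
      (blockIrregular M A)
  else blockIrregular M A

/-- The coarsening algorithm for triangular meshes. -/
noncomputable def triCoarsenR (use2 : Bool) (N₀ : List Plane) (M : Mesh 3)
    (Tmark : Finset (Elem 3)) : Mesh 3 :=
  update M (triParentVerts N₀ M) (triClosure use2 N₀ M (mark (triAdmissible N₀ M) Tmark))

/-! ### Shape regularity -/

/-- The diameter of the largest ball inscribed in `X`. -/
noncomputable def inDiam (X : Set Plane) : ℝ :=
  sSup {δ | ∃ (x : Plane) (r : ℝ), 0 ≤ r ∧ Metric.closedBall x r ⊆ X ∧ δ = 2 * r}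

/-- Shape regularity of a family of triangular meshes. -/
def TriShapeRegular (F : Set (Mesh 3)) : Prop :=
  ∃ c : ℝ, 1 ≤ c ∧ ∀ M ∈ F, ∀ T ∈ M.elements, Metric.diam (hull T) ≤ c * inDiam (hull T)

/-- Shape regularity of a family of quadrilateral meshes: the ratio of the longest and the shortest
edge is bounded, and the cosines of the inner angles are bounded away from `±1`. -/
def QuadShapeRegular (F : Set (Mesh 4)) : Prop :=
  (∃ c₁ : ℝ, 1 ≤ c₁ ∧ ∀ M ∈ F, ∀ T ∈ M.elements, ∀ i j : Fin 4,
    dist (T i) (T (i + 1)) ≤ c₁ * dist (T j) (T (j + 1))) ∧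
  ∃ c₂ : ℝ, 0 < c₂ ∧ c₂ < 1 ∧ ∀ M ∈ F, ∀ T ∈ M.elements, ∀ i : Fin 4,
    |Real.cos (EuclideanGeometry.angle (T (i + 3)) (T i) (T (i + 1)))| ≤ c₂

end RedMesh

/-!
# Coarsening of red-refined meshes

Each triangle or convex quadrilateral has its red refinement, so the elements that can arise from
the initial mesh form a forest, and the theorem holds because the algorithm, which knows only the
current elements and the ages of the nodes, recognizes sets of four siblings in this forest and
replaces them by their parent.

**Geometry of the forest.** Both shapes are treated at once: `Polygon` says that an element is cut
out by the half-planes of its edges, and `RedSystem` collects the properties of a red refinement.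
Two elements of the forest are nested or do not overlap (`RedSystem.forest_comparable`). Since the
initial mesh is conforming, two overlapping edges of elements of the forest arise from each other
by bisection (`RedSystem.forest_laminar`). So the midpoint of an edge can only become a node when an
element with exactly this edge is refined (`RedSystem.exists_refined_of_midpoint`), and for every
numbering the endpoints of an edge are older than its midpoint, and the vertices of a refined
element older than its inner new nodes (`RedSystem.respectAges`).

**Quartets.** For quadrilaterals it follows that the oldest node of a child is its common vertex
with the parent, and the third one the center of the parent. Hence four elements with the same third
vertex, which is not an initial node, are the children of one element (`quadAdmissible_sound`). For
triangles, whose middle child has no vertex in common with the parent, the numbering has to respect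
generations. A child at a vertex `v` of its parent that is not an initial node has `v` assigned to
all three edges, because no element with one of these edges has a vertex older than `v`
(`age_le_of_common_edge`). So middle elements are middle children (`IsMiddle.exists_parent`), and
their three neighbors are their siblings (`triAdmissible_sound`), none of which is a middle element
(`triCorner_not_isMiddle`).

**The coarsened mesh.** Replacing the children of some elements by these elements yields a
triangulation (`AreQuartets.isTriangulation`). A node which hangs on an edge of a parent is the
midpoint of this edge, since it would otherwise hang on an edge of a child, which the closure step
excludes (`AreQuartets.isOneIrregular`). An edge of a parent with a midpoint of weight `2` has no
refined neighbor behind it: there is no neighbor, it has not been refined, or its children are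
replaced, too (`AreQuartets.not_refined_of_heavy`). The closure step leaves only quartets with at
most two (quadrilaterals), respectively one (triangles), midpoints of smaller weight; this gives the
Neighbor Rules (`AreQuartets.neighborRule`). The neighbors of the remaining elements are no more
refined than before.

**Shape regularity.** An upper bound for the edge lengths and a lower bound for the areas of the
triangles spanned at the vertices, relative to a common scale, are inherited by the children
(`IsShaped`); for quadrilaterals, since the areas at the vertices of a child are averages of those
of the parent (`quadKid_corner`). So bounds for the finitely many initial elements hold in the
whole forest, which contains all elements of the coarsened meshes up to the choice of the first
vertex.
-/

namespace RedMesh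

open Set Filter Topology
open scoped Fin.CommRing

/-! ### Oriented areas and segments in the plane -/

lemma plane_ext {x y : Plane} (h0 : x 0 = y 0) (h1 : x 1 = y 1) : x = y := by
  ext i; fin_cases i <;> assumption

lemma lineMap_coord (a b : Plane) (t : ℝ) (i : Fin 2) :
    (AffineMap.lineMap a b t : Plane) i = (1 - t) * a i + t * b i := by
  simp [AffineMap.lineMap_apply]; ring

lemma midpoint_coord (a b : Plane) (i : Fin 2) :
    (midpoint ℝ a b : Plane) i = (a i + b i) / 2 := by
  rw [midpoint, lineMap_coord]; norm_num; ring

lemma cross_rotate (a b c : Plane) : cross b c a = cross a b c := by unfold cross; ring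

lemma cross_swap (a b c : Plane) : cross b a c = -cross a b c := by unfold cross; ring

@[simp] lemma cross_left (a b : Plane) : cross a b a = 0 := by unfold cross; ring

@[simp] lemma cross_right (a b : Plane) : cross a b b = 0 := by unfold cross; ring

@[simp] lemma cross_same (a c : Plane) : cross a a c = 0 := by unfold cross; ring

lemma cross_lineMap (a b c d : Plane) (t : ℝ) :
    cross a b (AffineMap.lineMap c d t) = (1 - t) * cross a b c + t * cross a b d := by
  unfold cross; simp only [lineMap_coord]; ring

lemma cross_midpoint (a b c d : Plane) :
    cross a b (midpoint ℝ c d) = (cross a b c + cross a b d) / 2 := by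
  unfold cross; simp only [midpoint_coord]; ring

lemma continuous_cross (a b : Plane) : Continuous (cross a b) := by
  unfold cross; fun_prop

lemma exists_lineMap_of_cross_eq_zero {a b x : Plane} (hab : a ≠ b) (h : cross a b x = 0) :
    ∃ t : ℝ, x = AffineMap.lineMap a b t := by
  have hpos : (b 0 - a 0) ^ 2 + (b 1 - a 1) ^ 2 ≠ 0 := by
    intro h0
    apply hab
    apply plane_ext <;> nlinarith [sq_nonneg (b 0 - a 0), sq_nonneg (b 1 - a 1)]
  unfold cross at h
  refine ⟨((x 0 - a 0) * (b 0 - a 0) + (x 1 - a 1) * (b 1 - a 1)) /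
    ((b 0 - a 0) ^ 2 + (b 1 - a 1) ^ 2), ?_⟩
  apply plane_ext
  · rw [lineMap_coord]; field_simp; linear_combination (-(b 1 - a 1)) * h
  · rw [lineMap_coord]; field_simp; linear_combination (b 0 - a 0) * h

lemma lineMap_inj {a b : Plane} (hab : a ≠ b) {s t : ℝ}
    (h : (AffineMap.lineMap a b s : Plane) = AffineMap.lineMap a b t) : s = t :=
  AffineMap.lineMap_injective ℝ hab h

lemma mem_segment_iff {a b x : Plane} :
    x ∈ segment ℝ a b ↔ ∃ t : ℝ, 0 ≤ t ∧ t ≤ 1 ∧ x = AffineMap.lineMap a b t := by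
  rw [segment_eq_image_lineMap]
  constructor
  · rintro ⟨t, ⟨h0, h1⟩, rfl⟩; exact ⟨t, h0, h1, rfl⟩
  · rintro ⟨t, h0, h1, rfl⟩; exact ⟨t, ⟨h0, h1⟩, rfl⟩

lemma mem_openSegment_iff {a b x : Plane} :
    x ∈ openSegment ℝ a b ↔ ∃ t : ℝ, 0 < t ∧ t < 1 ∧ x = AffineMap.lineMap a b t := by
  rw [openSegment_eq_image_lineMap]
  constructor
  · rintro ⟨t, ⟨h0, h1⟩, rfl⟩; exact ⟨t, h0, h1, rfl⟩
  · rintro ⟨t, h0, h1, rfl⟩; exact ⟨t, ⟨h0, h1⟩, rfl⟩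

lemma lineMap_mem_segment {a b : Plane} {t : ℝ} (h0 : 0 ≤ t) (h1 : t ≤ 1) :
    (AffineMap.lineMap a b t : Plane) ∈ segment ℝ a b :=
  mem_segment_iff.mpr ⟨t, h0, h1, rfl⟩

lemma midpoint_mem_openSegment (a b : Plane) : midpoint ℝ a b ∈ openSegment ℝ a b :=
  mem_openSegment_iff.mpr ⟨2⁻¹, by norm_num, by norm_num, by simp [midpoint]⟩

/-- A point of a segment which is not beyond its midpoint lies in the first half. -/
lemma lineMap_mem_segment_midpoint {a b : Plane} {t : ℝ} (h0 : 0 ≤ t) (h1 : t ≤ 1 / 2) :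
    (AffineMap.lineMap a b t : Plane) ∈ segment ℝ a (midpoint ℝ a b) := by
  refine mem_segment_iff.mpr ⟨2 * t, by linarith, by linarith, ?_⟩
  apply plane_ext <;> simp only [lineMap_coord, midpoint_coord] <;> ring

lemma lineMap_mem_segment_midpoint' {a b : Plane} {t : ℝ} (h0 : 1 / 2 ≤ t) (h1 : t ≤ 1) :
    (AffineMap.lineMap a b t : Plane) ∈ segment ℝ (midpoint ℝ a b) b := by
  refine mem_segment_iff.mpr ⟨2 * t - 1, by linarith, by linarith, ?_⟩
  apply plane_ext <;> simp only [lineMap_coord, midpoint_coord] <;> ring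

/-- Two segments with two common points, none of which contains an endpoint of the other one in
its relative interior, coincide. -/
lemma segment_eq_of_overlap {a b c d p q : Plane} (hpq : p ≠ q)
    (hp : p ∈ segment ℝ a b) (hq : q ∈ segment ℝ a b)
    (hp' : p ∈ segment ℝ c d) (hq' : q ∈ segment ℝ c d)
    (ha : a ∈ segment ℝ c d → a = c ∨ a = d) (hb : b ∈ segment ℝ c d → b = c ∨ b = d)
    (hc : c ∈ segment ℝ a b → c = a ∨ c = b) (hd : d ∈ segment ℝ a b → d = a ∨ d = b) :
    s(a, b) = s(c, d) := by
  wlog hor : ∃ s u : ℝ, s < u ∧ c = AffineMap.lineMap a b s ∧ d = AffineMap.lineMap a b u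
    generalizing c d
  · rw [Sym2.eq_swap (a := c)]
    rw [segment_symm] at hp' hq' ha hb
    refine this hp' hq' (fun h => (ha h).symm) (fun h => (hb h).symm) hd hc ?_
    obtain ⟨x, -, -, rfl⟩ := mem_segment_iff.mp hp
    obtain ⟨y, -, -, rfl⟩ := mem_segment_iff.mp hq
    obtain ⟨x', -, -, hx⟩ := mem_segment_iff.mp hp'
    obtain ⟨y', -, -, hy⟩ := mem_segment_iff.mp hq'
    have hxy : x' - y' ≠ 0 := by
      rintro h; rw [sub_eq_zero] at h; subst h; exact hpq (hx.trans hy.symm)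
    have hx0 := congrArg (fun z : Plane => z 0) hx
    have hx1 := congrArg (fun z : Plane => z 1) hx
    have hy0 := congrArg (fun z : Plane => z 0) hy
    have hy1 := congrArg (fun z : Plane => z 1) hy
    simp only [lineMap_coord] at hx0 hx1 hy0 hy1
    -- `k` is the (signed) ratio of the lengths of the two segments
    set k := (x - y) / (x' - y') with hk
    have hk' : k * (x' - y') = x - y := by rw [hk]; field_simp
    have hcd : ∀ i : Fin 2, c i - d i = k * (b i - a i) := by
      have e : ∀ i : Fin 2, (x' - y') * (c i - d i) = (x - y) * (b i - a i) := by
        intro i; fin_cases i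
        · simp only [Fin.zero_eta]; linear_combination hy0 - hx0
        · simp only [Fin.mk_one]; linear_combination hy1 - hx1
      intro i
      apply mul_left_cancel₀ hxy
      rw [e i, ← hk']; ring
    have hd : d = AffineMap.lineMap a b (x - x' * k) := by
      apply plane_ext <;> simp only [lineMap_coord]
      · linear_combination -hx0 - x' * hcd 0
      · linear_combination -hx1 - x' * hcd 1
    have hc : c = AffineMap.lineMap a b (x + (1 - x') * k) := by
      apply plane_ext <;> simp only [lineMap_coord]
      · linear_combination -hx0 + (1 - x') * hcd 0
      · linear_combination -hx1 + (1 - x') * hcd 1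
    have hk0 : k ≠ 0 := by
      intro h0
      rw [h0, zero_mul, eq_comm, sub_eq_zero] at hk'
      subst hk'
      exact hpq rfl
    rcases lt_or_gt_of_ne hk0 with h | h
    · exact absurd ⟨_, _, by nlinarith, hc, hd⟩ hor
    · exact ⟨_, _, by nlinarith, hd, hc⟩
  obtain ⟨s, u, hsu, rfl, rfl⟩ := hor
  obtain ⟨x, hx0, hx1, rfl⟩ := mem_segment_iff.mp hp
  obtain ⟨y, hy0, hy1, rfl⟩ := mem_segment_iff.mp hq
  have hab : a ≠ b := by rintro rfl; simp at hpq
  have hxy : x ≠ y := by rintro rfl; exact hpq rfl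
  have key : ∀ z : ℝ, (AffineMap.lineMap a b z : Plane) ∈
      segment ℝ (AffineMap.lineMap a b s : Plane) (AffineMap.lineMap a b u) ↔ s ≤ z ∧ z ≤ u := by
    intro z
    have comp : ∀ r : ℝ, (AffineMap.lineMap (AffineMap.lineMap a b s : Plane)
        (AffineMap.lineMap a b u : Plane) r : Plane) =
          AffineMap.lineMap a b ((1 - r) * s + r * u) := by
      intro r; apply plane_ext <;> simp only [lineMap_coord] <;> ring
    rw [mem_segment_iff]
    constructor
    · rintro ⟨r, h0, h1, h⟩
      rw [comp] at h
      have := lineMap_inj hab h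
      constructor <;> nlinarith
    · rintro ⟨h0, h1⟩
      have hus : 0 < u - s := by linarith
      refine ⟨(z - s) / (u - s), div_nonneg (by linarith) hus.le, ?_, ?_⟩
      · rw [div_le_one hus]; linarith
      · rw [comp]; congr 1; field_simp; ring
  rw [key] at hp' hq'
  have ea : (AffineMap.lineMap a b (0:ℝ) : Plane) = a := by simp
  have eb : (AffineMap.lineMap a b (1:ℝ) : Plane) = b := by simp
  have keya := key 0
  have keyb := key 1
  rw [ea] at keya
  rw [eb] at keyb
  rw [keya] at ha
  rw [keyb] at hb
  have ja : ∀ {z : ℝ}, a = AffineMap.lineMap a b z → z = 0 := fun h =>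
    (lineMap_inj hab (ea.trans h)).symm
  have jb : ∀ {z : ℝ}, b = AffineMap.lineMap a b z → z = 1 := fun h =>
    (lineMap_inj hab (eb.trans h)).symm
  have hlo : ∃ z, z < u ∧ z < 1 ∧ s ≤ z ∧ 0 ≤ z := by
    rcases lt_or_gt_of_ne hxy with h | h
    · exact ⟨x, by linarith, by linarith, hp'.1, hx0⟩
    · exact ⟨y, by linarith, by linarith, hq'.1, hy0⟩
  have hhi : ∃ z, s < z ∧ 0 < z ∧ z ≤ u ∧ z ≤ 1 := by
    rcases lt_or_gt_of_ne hxy with h | h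
    · exact ⟨y, by linarith, by linarith, hq'.2, hy1⟩
    · exact ⟨x, by linarith, by linarith, hp'.2, hx1⟩
  obtain ⟨z, z1, z2, z3, z4⟩ := hlo
  obtain ⟨w, w1, w2, w3, w4⟩ := hhi
  have hs : s = 0 := by
    by_cases h : s ≤ 0
    · rcases ha ⟨h, by linarith⟩ with h | h
      · exact ja h
      · have := ja h; linarith
    · rcases hc (lineMap_mem_segment (by linarith) (by linarith)) with h | h
      · exact ja h.symm
      · have := jb h.symm; linarith
  have hu : u = 1 := by
    by_cases h : 1 ≤ u
    · rcases hb ⟨by linarith, h⟩ with h | h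
      · have := jb h; linarith
      · exact jb h
    · rcases hd (lineMap_mem_segment (by linarith) (by linarith)) with h | h
      · have := ja h.symm; linarith
      · exact jb h.symm
  rw [hs, hu, ea, eb]

/-! ### Convex polygons -/

/-- The two facts on convex `n`-gons from which everything else about them is derived: the hull is
cut out by the half-planes to the left of the edges, and the vertices that do not belong to an edge
are strictly to the left of it. They hold for `n = 3, 4`; for `n ≥ 5` the left turn condition
`IsConvexCCW` admits star polygons. -/
class Polygon (n : ℕ) [NeZero n] : Prop where
  mem_hull_iff : ∀ {T : Elem n}, IsConvexCCW T → ∀ x,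
    x ∈ hull T ↔ ∀ i, 0 ≤ cross (T i) (T (i + 1)) x
  cross_pos : ∀ {T : Elem n}, IsConvexCCW T → ∀ i j, j ≠ i → j ≠ i + 1 →
    0 < cross (T i) (T (i + 1)) (T j)

section Polygon

variable {n : ℕ} [NeZero n]

omit [NeZero n] in
lemma vertex_mem_hull (T : Elem n) (i : Fin n) : T i ∈ hull T :=
  subset_convexHull ℝ _ (mem_range_self i)

omit [NeZero n] in
lemma convex_hull (T : Elem n) : Convex ℝ (hull T) := convex_convexHull ℝ _

omit [NeZero n] in
lemma isCompact_hull (T : Elem n) : IsCompact (hull T) :=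
  (finite_range T).isCompact_convexHull (𝕜 := ℝ)

omit [NeZero n] in
lemma isClosed_hull (T : Elem n) : IsClosed (hull T) := (isCompact_hull T).isClosed

lemma edge_subset_hull (T : Elem n) (i : Fin n) : segment ℝ (T i) (T (i + 1)) ⊆ hull T :=
  (convex_hull T).segment_subset (vertex_mem_hull T i) (vertex_mem_hull T _)

lemma midpoint_mem_hull (T : Elem n) (i : Fin n) : midpoint ℝ (T i) (T (i + 1)) ∈ hull T :=
  edge_subset_hull T i (openSegment_subset_segment ℝ _ _ (midpoint_mem_openSegment _ _))

omit [NeZero n] in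
lemma hull_subset_hull {T K : Elem n} (h : ∀ i, K i ∈ hull T) : hull K ⊆ hull T :=
  convexHull_min (range_subset_iff.mpr h) (convex_hull T)

variable [Polygon n] {T K : Elem n}

omit [Polygon n] in
lemma add_two_ne (hT : IsConvexCCW T) (i : Fin n) : i + 2 ≠ i := by
  intro h
  have := hT i
  rw [h, cross_left] at this
  exact lt_irrefl _ this

omit [Polygon n] in
lemma edge_ne (hT : IsConvexCCW T) (i : Fin n) : T i ≠ T (i + 1) := by
  intro h
  have := hT i
  rw [h, cross_same] at this
  exact lt_irrefl _ this

omit [Polygon n] in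
lemma add_one_ne (hT : IsConvexCCW T) (i : Fin n) : i + 1 ≠ i := fun h =>
  edge_ne hT i (by rw [h])

lemma vertex_injective (hT : IsConvexCCW T) : Function.Injective T := by
  intro i j h
  by_contra hne
  by_cases hj : j = i + 1
  · exact edge_ne hT i (by rw [h, hj])
  · have := Polygon.cross_pos hT i j (Ne.symm hne) hj
    rw [← h, cross_left] at this
    exact lt_irrefl _ this

lemma cross_vertex_nonneg (hT : IsConvexCCW T) (i j : Fin n) :
    0 ≤ cross (T i) (T (i + 1)) (T j) :=
  (Polygon.mem_hull_iff hT _).mp (vertex_mem_hull T j) i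

omit [Polygon n] in
lemma cross_edge_eq_zero {i : Fin n} {x : Plane} (hx : x ∈ segment ℝ (T i) (T (i + 1))) :
    cross (T i) (T (i + 1)) x = 0 := by
  obtain ⟨t, -, -, rfl⟩ := mem_segment_iff.mp hx
  rw [cross_lineMap]; simp

lemma mem_edge_of_cross_eq_zero (hT : IsConvexCCW T) {i : Fin n} {x : Plane} (hx : x ∈ hull T)
    (h : cross (T i) (T (i + 1)) x = 0) : x ∈ segment ℝ (T i) (T (i + 1)) := by
  obtain ⟨t, rfl⟩ := exists_lineMap_of_cross_eq_zero (edge_ne hT i) h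
  rw [Polygon.mem_hull_iff hT] at hx
  apply lineMap_mem_segment
  · have h1 := hx (i - 1)
    have h2 := hT (i - 1)
    have e : i - 1 + 2 = i + 1 := by ring
    rw [cross_lineMap] at h1
    rw [e] at h2
    simp only [sub_add_cancel] at h1 h2
    rw [cross_right] at h1
    by_contra hlt
    nlinarith
  · have h1 := hx (i + 1)
    have h2 : 0 < cross (T (i + 1)) (T (i + 1 + 1)) (T i) := by
      apply Polygon.cross_pos hT
      · exact (add_one_ne hT i).symm
      · have := add_two_ne hT i
        rw [add_assoc, one_add_one_eq_two]
        exact this.symm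
    rw [cross_lineMap, cross_left] at h1
    by_contra hlt
    nlinarith

lemma vertex_mem_edge (hT : IsConvexCCW T) {i j : Fin n}
    (h : T j ∈ segment ℝ (T i) (T (i + 1))) : T j = T i ∨ T j = T (i + 1) := by
  by_contra hne
  rw [not_or] at hne
  have := Polygon.cross_pos hT i j (fun e => hne.1 (by rw [e])) (fun e => hne.2 (by rw [e]))
  rw [cross_edge_eq_zero h] at this
  exact lt_irrefl _ this

/-- Near a point in the relative interior of an edge, only the half-plane of this edge matters. -/
lemma eventually_cross_pos (hT : IsConvexCCW T) {i : Fin n} {m : Plane}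
    (hm : m ∈ openSegment ℝ (T i) (T (i + 1))) :
    ∀ᶠ x in 𝓝 m, ∀ j, j ≠ i → 0 < cross (T j) (T (j + 1)) x := by
  rw [eventually_all]
  intro j
  by_cases hj : j = i
  · simp [hj]
  obtain ⟨t, h0, h1, rfl⟩ := mem_openSegment_iff.mp hm
  have hpos : 0 < cross (T j) (T (j + 1)) (AffineMap.lineMap (T i) (T (i + 1)) t) := by
    rw [cross_lineMap]
    have a1 := cross_vertex_nonneg hT j i
    have a2 := cross_vertex_nonneg hT j (i + 1)
    have : 0 < cross (T j) (T (j + 1)) (T i) ∨ 0 < cross (T j) (T (j + 1)) (T (i + 1)) := by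
      by_cases h : i = j + 1
      · right
        apply Polygon.cross_pos hT
        · subst h
          have := add_two_ne hT j
          rwa [add_assoc, one_add_one_eq_two]
        · exact fun e => hj (add_right_cancel e).symm
      · exact Or.inl (Polygon.cross_pos hT _ _ (Ne.symm hj) h)
    rcases this with h | h
    · have := mul_pos (sub_pos.mpr h1) h
      have := mul_nonneg h0.le a2
      linarith
    · have := mul_pos h0 h
      have := mul_nonneg (sub_pos.mpr h1).le a1
      linarith
  filter_upwards [((continuous_cross _ _).tendsto _).eventually_const_lt hpos] with x hx _
  exact hx

lemma mem_interior_hull_iff (hT : IsConvexCCW T) (x : Plane) :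
    x ∈ interior (hull T) ↔ ∀ i, 0 < cross (T i) (T (i + 1)) x := by
  constructor
  · intro hx i
    by_contra hle
    rw [not_lt] at hle
    have hpos := hT i
    have hc : Tendsto (fun t : ℝ => (AffineMap.lineMap (T (i + 2)) x t : Plane)) (𝓝[>] 1)
        (𝓝 x) := by
      have : Continuous (fun t : ℝ => (AffineMap.lineMap (T (i + 2)) x t : Plane)) := by
        fun_prop
      have h := (this.tendsto 1).mono_left (nhdsWithin_le_nhds (s := Ioi 1))
      simpa using h
    obtain ⟨t, ht, ht1⟩ := ((hc.eventually (mem_interior_iff_mem_nhds.mp hx)).and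
      self_mem_nhdsWithin).exists
    have := (Polygon.mem_hull_iff hT _).mp ht i
    rw [cross_lineMap] at this
    nlinarith
  · intro hx
    have hopen : IsOpen {y : Plane | ∀ i, 0 < cross (T i) (T (i + 1)) y} := by
      have he : {y : Plane | ∀ i, 0 < cross (T i) (T (i + 1)) y} =
          ⋂ i, {y : Plane | 0 < cross (T i) (T (i + 1)) y} := by ext; simp
      rw [he]
      exact isOpen_iInter_of_finite fun i => isOpen_lt continuous_const (continuous_cross _ _)
    exact interior_maximal (fun y hy => (Polygon.mem_hull_iff hT y).mpr fun i => (hy i).le)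
      hopen hx

lemma tendsto_add_smul (m w : Plane) : Tendsto (fun t : ℝ => m + t • w) (𝓝[>] 0) (𝓝 m) := by
  have : Continuous (fun t : ℝ => m + t • w) := by fun_prop
  have h := (this.tendsto 0).mono_left (nhdsWithin_le_nhds (s := Ioi 0))
  simpa using h

lemma cross_add_smul (a b m w : Plane) (t : ℝ) : cross a b (m + t • w) =
    cross a b m + t * ((b 0 - a 0) * w 1 - (b 1 - a 1) * w 0) := by
  unfold cross; simp; ring

lemma exists_mem_interior_near (hT : IsConvexCCW T) {i : Fin n} {m : Plane}
    (hm : m ∈ openSegment ℝ (T i) (T (i + 1))) {U : Set Plane} (hU : U ∈ 𝓝 m) :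
    ∃ x ∈ U, x ∈ interior (hull T) := by
  have h1 := cross_edge_eq_zero (openSegment_subset_segment ℝ _ _ hm)
  have hU' : ∀ᶠ x in 𝓝 m, x ∈ U := hU
  obtain ⟨t, ⟨hxU, hx⟩, ht⟩ := (((tendsto_add_smul m (T (i + 2) - T i)).eventually
    (hU'.and (eventually_cross_pos hT hm))).and self_mem_nhdsWithin).exists
  refine ⟨_, hxU, (mem_interior_hull_iff hT _).mpr fun j => ?_⟩
  by_cases hj : j = i
  · subst hj
    have h2 := hT j
    rw [cross_add_smul, h1]
    unfold cross at h2
    simpa using mul_pos ht h2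
  · exact hx j hj

lemma interior_hull_nonempty (hT : IsConvexCCW T) : (interior (hull T)).Nonempty := by
  obtain ⟨x, -, hx⟩ := exists_mem_interior_near hT (midpoint_mem_openSegment (T 0) (T (0 + 1)))
    univ_mem
  exact ⟨x, hx⟩

lemma closure_interior_hull (hT : IsConvexCCW T) : closure (interior (hull T)) = hull T := by
  rw [(convex_hull T).closure_interior_eq_closure_of_nonempty_interior (interior_hull_nonempty hT),
    (isClosed_hull T).closure_eq]

/-- An open set which meets an element meets its interior. -/
lemma inter_interior_nonempty (hT : IsConvexCCW T) {U : Set Plane} (hU : IsOpen U)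
    {x : Plane} (hx : x ∈ U) (hxT : x ∈ hull T) : (U ∩ interior (hull T)).Nonempty := by
  rw [← closure_interior_hull hT] at hxT
  exact mem_closure_iff.mp hxT U hU hx

lemma notMem_interior_of_disjoint (hK : IsConvexCCW K)
    (h : Disjoint (interior (hull T)) (interior (hull K))) {x : Plane} (hx : x ∈ hull K) :
    x ∉ interior (hull T) := fun hxT => by
  obtain ⟨y, hy⟩ := inter_interior_nonempty hK isOpen_interior hxT hx
  exact disjoint_left.mp h hy.1 hy.2

lemma not_disjoint_of_subset (hK : IsConvexCCW K) (h : hull K ⊆ hull T) :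
    ¬ Disjoint (interior (hull T)) (interior (hull K)) := fun hd => by
  obtain ⟨x, hx⟩ := interior_hull_nonempty hK
  exact disjoint_left.mp hd (interior_mono h hx) hx

lemma vertex_notMem_interior (hT : IsConvexCCW T) (i : Fin n) : T i ∉ interior (hull T) := by
  intro h
  have := (mem_interior_hull_iff hT _).mp h i
  simp at this

lemma openEdge_notMem_range (hT : IsConvexCCW T) {i : Fin n} {x : Plane}
    (hx : x ∈ openSegment ℝ (T i) (T (i + 1))) : x ∉ range T := by
  rintro ⟨j, rfl⟩
  have hne := edge_ne hT i
  rcases vertex_mem_edge hT (openSegment_subset_segment ℝ _ _ hx) with h | h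
  · rw [h, left_mem_openSegment_iff] at hx
    exact hne hx
  · rw [h, right_mem_openSegment_iff] at hx
    exact hne hx

lemma midpoint_notMem_range (hT : IsConvexCCW T) (i : Fin n) :
    midpoint ℝ (T i) (T (i + 1)) ∉ range T :=
  openEdge_notMem_range hT (midpoint_mem_openSegment _ _)

lemma exists_edge_of_mem_midpoint (hT : IsConvexCCW T) {p q : Plane} (hp : p ∈ hull T)
    (hq : q ∈ hull T) (h : midpoint ℝ p q ∉ interior (hull T)) :
    ∃ i, p ∈ segment ℝ (T i) (T (i + 1)) ∧ q ∈ segment ℝ (T i) (T (i + 1)) := by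
  rw [mem_interior_hull_iff hT, not_forall] at h
  obtain ⟨i, hi⟩ := h
  rw [cross_midpoint] at hi
  have h1 := (Polygon.mem_hull_iff hT p).mp hp i
  have h2 := (Polygon.mem_hull_iff hT q).mp hq i
  exact ⟨i, mem_edge_of_cross_eq_zero hT hp (by linarith),
    mem_edge_of_cross_eq_zero hT hq (by linarith)⟩

/-- Two elements without common interior points, such that each vertex of one of them that lies in
the other one is a vertex of both, have a common edge as soon as they share two points. -/
lemma exists_common_edge (hT : IsConvexCCW T) (hK : IsConvexCCW K)
    (hd : Disjoint (interior (hull T)) (interior (hull K)))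
    (h1 : ∀ i, T i ∈ hull K → T i ∈ range K) (h2 : ∀ i, K i ∈ hull T → K i ∈ range T)
    {p q : Plane} (hpq : p ≠ q) (hp : p ∈ hull T) (hq : q ∈ hull T) (hp' : p ∈ hull K)
    (hq' : q ∈ hull K) : ∃ i j, edge T i = edge K j ∧
      p ∈ segment ℝ (T i) (T (i + 1)) ∧ q ∈ segment ℝ (T i) (T (i + 1)) := by
  have hm : midpoint ℝ p q ∈ segment ℝ p q :=
    openSegment_subset_segment ℝ _ _ (midpoint_mem_openSegment p q)
  have hmT := (convex_hull T).segment_subset hp hq hm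
  have hmK := (convex_hull K).segment_subset hp' hq' hm
  obtain ⟨i, hi, hi'⟩ := exists_edge_of_mem_midpoint hT hp hq (notMem_interior_of_disjoint hK hd hmK)
  obtain ⟨j, hj, hj'⟩ := exists_edge_of_mem_midpoint hK hp' hq'
    (notMem_interior_of_disjoint hT hd.symm hmT)
  refine ⟨i, j, ?_, hi, hi'⟩
  have hTK : ∀ k, T k ∈ segment ℝ (K j) (K (j + 1)) → T k = K j ∨ T k = K (j + 1) := by
    intro k hk
    obtain ⟨l, hl⟩ := h1 k (edge_subset_hull K j hk)
    rw [← hl] at hk ⊢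
    exact vertex_mem_edge hK hk
  have hKT : ∀ k, K k ∈ segment ℝ (T i) (T (i + 1)) → K k = T i ∨ K k = T (i + 1) := by
    intro k hk
    obtain ⟨l, hl⟩ := h2 k (edge_subset_hull T i hk)
    rw [← hl] at hk ⊢
    exact vertex_mem_edge hT hk
  exact segment_eq_of_overlap hpq hi hi' hj hj' (hTK _) (hTK _) (hKT _) (hKT _)

/-- Two different edges of an element have at most one common point. -/
lemma edge_eq_of_overlap (hT : IsConvexCCW T) {i j : Fin n} {p q : Plane} (hpq : p ≠ q)
    (hp : p ∈ segment ℝ (T i) (T (i + 1))) (hq : q ∈ segment ℝ (T i) (T (i + 1)))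
    (hp' : p ∈ segment ℝ (T j) (T (j + 1))) (hq' : q ∈ segment ℝ (T j) (T (j + 1))) :
    edge T i = edge T j :=
  segment_eq_of_overlap hpq hp hq hp' hq' (vertex_mem_edge hT) (vertex_mem_edge hT)
    (vertex_mem_edge hT) (vertex_mem_edge hT)

lemma not_disjoint_of_same_edge (hT : IsConvexCCW T) (hK : IsConvexCCW K) {i j : Fin n}
    (h0 : T i = K j) (h1 : T (i + 1) = K (j + 1)) :
    ¬ Disjoint (interior (hull T)) (interior (hull K)) := by
  intro hd
  have hm := midpoint_mem_openSegment (T i) (T (i + 1))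
  have hm' := hm
  rw [h0, h1] at hm'
  rw [h0, h1] at hm
  obtain ⟨x, hx, hxT⟩ := exists_mem_interior_near hT (by rwa [h0, h1])
    (eventually_cross_pos hK hm')
  refine disjoint_left.mp hd hxT ((mem_interior_hull_iff hK _).mpr fun k => ?_)
  by_cases hk : k = j
  · subst hk
    rw [← h0, ← h1]
    exact (mem_interior_hull_iff hT _).mp hxT i
  · exact hx k hk

lemma edge_orientation (hT : IsConvexCCW T) (hK : IsConvexCCW K)
    (hd : Disjoint (interior (hull T)) (interior (hull K))) {i j : Fin n}
    (h : edge T i = edge K j) : T i = K (j + 1) ∧ T (i + 1) = K j := by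
  rcases Sym2.eq_iff.mp h with ⟨h0, h1⟩ | ⟨h0, h1⟩
  · exact absurd hd (not_disjoint_of_same_edge hT hK h0 h1)
  · exact ⟨h0, h1⟩

/-- The two elements on the sides of an edge form a neighborhood of the points in the relative
interior of this edge. -/
lemma hull_union_mem_nhds (hT : IsConvexCCW T) (hK : IsConvexCCW K)
    (hd : Disjoint (interior (hull T)) (interior (hull K))) {i j : Fin n}
    (h : edge T i = edge K j) {m : Plane} (hm : m ∈ openSegment ℝ (T i) (T (i + 1))) :
    hull T ∪ hull K ∈ 𝓝 m := by
  obtain ⟨h0, h1⟩ := edge_orientation hT hK hd h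
  have hm' : m ∈ openSegment ℝ (K j) (K (j + 1)) := by rwa [← h0, ← h1, openSegment_symm]
  filter_upwards [eventually_cross_pos hT hm, eventually_cross_pos hK hm'] with x hx hx'
  rcases le_total 0 (cross (T i) (T (i + 1)) x) with hs | hs
  · left
    refine (Polygon.mem_hull_iff hT _).mpr fun k => ?_
    by_cases hk : k = i
    · rwa [hk]
    · exact (hx k hk).le
  · right
    refine (Polygon.mem_hull_iff hK _).mpr fun k => ?_
    by_cases hk : k = j
    · rw [hk, ← h0, ← h1, cross_swap]
      linarith
    · exact (hx' k hk).le

/-- Two edges of elements without common interior points overlap if they have the same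
midpoint. -/
lemma overlap_of_midpoint_eq (hT : IsConvexCCW T) (hK : IsConvexCCW K)
    (hd : Disjoint (interior (hull T)) (interior (hull K))) {i j : Fin n}
    (h : midpoint ℝ (T i) (T (i + 1)) = midpoint ℝ (K j) (K (j + 1))) :
    ∃ p q, p ≠ q ∧ p ∈ segment ℝ (T i) (T (i + 1)) ∧ q ∈ segment ℝ (T i) (T (i + 1)) ∧
      p ∈ segment ℝ (K j) (K (j + 1)) ∧ q ∈ segment ℝ (K j) (K (j + 1)) := by
  have hab := edge_ne hT i
  have hcd := edge_ne hK j
  have hm := midpoint_mem_openSegment (T i) (T (i + 1))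
  have hm' := midpoint_mem_openSegment (K j) (K (j + 1))
  rw [← h] at hm'
  have z1 := cross_edge_eq_zero (openSegment_subset_segment ℝ _ _ hm)
  have z2 := cross_edge_eq_zero (openSegment_subset_segment ℝ _ _ hm')
  -- the edges are parallel: otherwise some direction from `m` points into both elements
  have hD : (T (i + 1) 0 - T i 0) * (K (j + 1) 1 - K j 1) -
      (T (i + 1) 1 - T i 1) * (K (j + 1) 0 - K j 0) = 0 := by
    by_contra hne
    set D := (T (i + 1) 0 - T i 0) * (K (j + 1) 1 - K j 1) -
      (T (i + 1) 1 - T i 1) * (K (j + 1) 0 - K j 0) with hDdef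
    have hDD : 0 < D * D := mul_self_pos.mpr hne
    set w := D • ((K (j + 1) - K j) - (T (i + 1) - T i)) with hw
    obtain ⟨t, ⟨hx, hx'⟩, ht⟩ := (((tendsto_add_smul (midpoint ℝ (T i) (T (i + 1)))
      w).eventually ((eventually_cross_pos hT hm).and (eventually_cross_pos hK hm'))).and
        self_mem_nhdsWithin).exists
    have hd' := disjoint_left.mp hd
    refine @hd' (midpoint ℝ (T i) (T (i + 1)) + t • w)
      ((mem_interior_hull_iff hT _).mpr fun k => ?_)
      ((mem_interior_hull_iff hK _).mpr fun k => ?_)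
    · by_cases hk : k = i
      · subst hk
        rw [cross_add_smul, z1]
        have : (0:ℝ) < t * (D * D) := mul_pos ht hDD
        calc (0:ℝ) < t * (D * D) := this
          _ = _ := by
            rw [hw]; simp only [PiLp.smul_apply, PiLp.sub_apply, smul_eq_mul]; rw [hDdef]; ring
      · exact hx k hk
    · by_cases hk : k = j
      · subst hk
        rw [cross_add_smul, z2]
        have : (0:ℝ) < t * (D * D) := mul_pos ht hDD
        calc (0:ℝ) < t * (D * D) := this
          _ = _ := by
            rw [hw]; simp only [PiLp.smul_apply, PiLp.sub_apply, smul_eq_mul]; rw [hDdef]; ring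
      · exact hx' k hk
  generalize T i = a at *
  generalize T (i + 1) = b at *
  generalize K j = c at *
  generalize K (j + 1) = d at *
  clear hm hm' z1 z2 hd
  wlog hle : (d 0 - c 0) ^ 2 + (d 1 - c 1) ^ 2 ≤ (b 0 - a 0) ^ 2 + (b 1 - a 1) ^ 2
    generalizing a b c d
  · have hle' := (not_le.mp hle).le
    obtain ⟨p, q, h1, h2, h3, h4, h5⟩ :=
      this c d hcd a b hab h.symm (by linear_combination -hD) hle'
    exact ⟨p, q, h1, h4, h5, h2, h3⟩
  obtain ⟨t, ht⟩ := exists_lineMap_of_cross_eq_zero hab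
    (x := a + (d - c)) (by unfold cross; simp; linear_combination hD)
  have e0 := congrArg (fun z : Plane => z 0) ht
  have e1 := congrArg (fun z : Plane => z 1) ht
  have m0 := congrArg (fun z : Plane => z 0) h
  have m1 := congrArg (fun z : Plane => z 1) h
  simp only [lineMap_coord, midpoint_coord, PiLp.add_apply, PiLp.sub_apply] at e0 e1 m0 m1
  have hpos : 0 < (b 0 - a 0) ^ 2 + (b 1 - a 1) ^ 2 := by
    by_contra hn
    apply hab
    apply plane_ext <;> nlinarith [sq_nonneg (b 0 - a 0), sq_nonneg (b 1 - a 1)]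
  have f0 : d 0 - c 0 = t * (b 0 - a 0) := by linarith
  have f1 : d 1 - c 1 = t * (b 1 - a 1) := by linarith
  have ht1 : t ^ 2 ≤ 1 := by
    rw [f0, f1] at hle
    by_contra hn
    nlinarith
  have ht2 := abs_le.mp ((sq_le_one_iff_abs_le_one t).mp ht1)
  refine ⟨c, d, hcd, mem_segment_iff.mpr ⟨(1 - t) / 2, by linarith, by linarith, ?_⟩,
    mem_segment_iff.mpr ⟨(1 + t) / 2, by linarith, by linarith, ?_⟩,
    left_mem_segment ℝ _ _, right_mem_segment ℝ _ _⟩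
  · apply plane_ext <;> rw [lineMap_coord] <;> linarith
  · apply plane_ext <;> rw [lineMap_coord] <;> linarith

/-! ### Cyclic permutations of the vertices -/

/-- `K` arises from `T` by a cyclic permutation of the list of vertices. -/
def IsRotation (K T : Elem n) : Prop := ∃ r : Fin n, ∀ i, K i = T (i + r)

omit [Polygon n] in
lemma IsRotation.range_eq (h : IsRotation K T) : range K = range T := by
  obtain ⟨r, hr⟩ := h
  ext x
  constructor
  · rintro ⟨i, rfl⟩; exact ⟨i + r, (hr i).symm⟩
  · rintro ⟨i, rfl⟩; exact ⟨i - r, by rw [hr, sub_add_cancel]⟩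

omit [Polygon n] in
lemma IsRotation.hull_eq (h : IsRotation K T) : hull K = hull T := by
  unfold hull; rw [h.range_eq]

omit [Polygon n] in
lemma IsRotation.edge_eq (h : IsRotation K T) (i : Fin n) : ∃ j, K i = T j ∧ K (i + 1) = T (j + 1) := by
  obtain ⟨r, hr⟩ := h
  exact ⟨i + r, hr i, by rw [hr]; congr 1; ring⟩

/-- A convex polygon is determined by its set of vertices, up to rotation. -/
lemma isRotation_of_range_eq (hT : IsConvexCCW T) (hK : IsConvexCCW K) (h : range K = range T) :
    IsRotation K T := by
  have hs : ∀ i, ∃ j, T j = K i := fun i => by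
    have : K i ∈ range T := h ▸ mem_range_self i
    exact this
  choose s hs using hs
  have hstep : ∀ i, s (i + 1) = s i + 1 := by
    intro i
    by_contra hne
    have h1 : s (i + 1) ≠ s i := fun e => edge_ne hK i (by rw [← hs, ← hs, e])
    have h2 := Polygon.cross_pos hT (s i) (s (i + 1)) h1 hne
    obtain ⟨l, hl⟩ : T (s i + 1) ∈ range K := h ▸ mem_range_self _
    have h3 := cross_vertex_nonneg hK i l
    rw [hs, hs, ← hl] at h2
    have : cross (K i) (K l) (K (i + 1)) = -cross (K i) (K (i + 1)) (K l) := by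
      unfold cross; ring
    linarith
  have hall : ∀ k : ℕ, s (k : Fin n) = (k : Fin n) + s 0 := by
    intro k
    induction k with
    | zero => simp
    | succ k ih => rw [Nat.cast_succ, hstep, ih]; ring
  refine ⟨s 0, fun i => ?_⟩
  have := hall i.val
  rw [Fin.cast_val_eq_self] at this
  rw [← this, hs]

end Polygon

/-! ### Bisection of edges -/

/-- The closed segment between the points of an unordered pair. -/
def seg (e : Sym2 Plane) : Set Plane :=
  Sym2.lift ⟨fun a b => segment ℝ a b, fun a b => segment_symm ℝ a b⟩ e

/-- `h` is one of the two halves of the edge `e`. -/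
def HalfOf (e h : Sym2 Plane) : Prop := ∃ a b, e = s(a, b) ∧ h = s(a, midpoint ℝ a b)

lemma halfOf_left (a b : Plane) : HalfOf s(a, b) s(a, midpoint ℝ a b) := ⟨a, b, rfl, rfl⟩

lemma halfOf_right (a b : Plane) : HalfOf s(a, b) s(midpoint ℝ a b, b) :=
  ⟨b, a, Sym2.eq_swap, by rw [midpoint_comm, Sym2.eq_swap]⟩

lemma HalfOf.seg_subset {e h : Sym2 Plane} (H : HalfOf e h) : seg h ⊆ seg e := by
  obtain ⟨a, b, rfl, rfl⟩ := H
  exact (convex_segment a b).segment_subset (left_mem_segment ℝ a b)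
    (openSegment_subset_segment ℝ _ _ (midpoint_mem_openSegment a b))

/-- `h` arises from `e` by repeated bisection. -/
abbrev Bisects (e h : Sym2 Plane) : Prop := Relation.ReflTransGen HalfOf e h

lemma Bisects.seg_subset {e h : Sym2 Plane} (H : Bisects e h) : seg h ⊆ seg e := by
  induction H with
  | refl => exact Subset.rfl
  | tail _ h ih => exact h.seg_subset.trans ih

lemma midpoint_inter {a b x : Plane} (h1 : x ∈ segment ℝ a (midpoint ℝ a b))
    (h2 : x ∈ segment ℝ b (midpoint ℝ a b)) : x = midpoint ℝ a b := by
  by_cases hab : a = b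
  · subst hab; simpa using h1
  obtain ⟨s, s0, s1, hs⟩ := mem_segment_iff.mp h1
  obtain ⟨t, t0, t1, ht⟩ := mem_segment_iff.mp h2
  have e1 : x = AffineMap.lineMap a b (s / 2) := by
    rw [hs]; apply plane_ext <;> simp only [lineMap_coord, midpoint_coord] <;> ring
  have e2 : x = AffineMap.lineMap a b (1 - t / 2) := by
    rw [ht]; apply plane_ext <;> simp only [lineMap_coord, midpoint_coord] <;> ring
  have := lineMap_inj hab (e1.symm.trans e2)
  have hs1 : s = 1 := by linarith
  rw [hs, hs1]; simp

lemma HalfOf.eq_of_overlap {e h h' : Sym2 Plane} (H : HalfOf e h) (H' : HalfOf e h') {p q : Plane}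
    (hpq : p ≠ q) (hp : p ∈ seg h) (hq : q ∈ seg h) (hp' : p ∈ seg h') (hq' : q ∈ seg h') :
    h = h' := by
  obtain ⟨a, b, rfl, rfl⟩ := H
  obtain ⟨c, d, hcd, rfl⟩ := H'
  rcases Sym2.eq_iff.mp hcd with ⟨rfl, rfl⟩ | ⟨rfl, rfl⟩
  · rfl
  · rw [midpoint_comm b a] at hp' hq'
    exact absurd ((midpoint_inter hp hp').trans (midpoint_inter hq hq').symm) hpq

/-- The edges that arise by bisection of a given edge form a tree: two of them are nested as soon
as they overlap. -/
lemma Bisects.comparable {e h h' : Sym2 Plane} (H : Bisects e h) (H' : Bisects e h') {p q : Plane}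
    (hpq : p ≠ q) (hp : p ∈ seg h) (hq : q ∈ seg h) (hp' : p ∈ seg h') (hq' : q ∈ seg h') :
    Bisects h h' ∨ Bisects h' h := by
  induction H using Relation.ReflTransGen.head_induction_on with
  | refl => exact Or.inl H'
  | head h1 h2 ih =>
    rcases Relation.ReflTransGen.cases_head H' with rfl | ⟨c, hc, hc'⟩
    · exact Or.inr (Relation.ReflTransGen.head h1 h2)
    · have := h1.eq_of_overlap hc hpq (Bisects.seg_subset h2 hp) (Bisects.seg_subset h2 hq)
        (Bisects.seg_subset hc' hp') (Bisects.seg_subset hc' hq')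
      subst this
      exact ih hc'

/-- The length of an edge. -/
noncomputable def len (e : Sym2 Plane) : ℝ :=
  Sym2.lift ⟨fun a b => dist a b, fun a b => dist_comm a b⟩ e

lemma HalfOf.len_eq {e h : Sym2 Plane} (H : HalfOf e h) : len e = 2 * len h := by
  obtain ⟨a, b, rfl, rfl⟩ := H
  change dist a b = 2 * dist a (midpoint ℝ a b)
  rw [dist_left_midpoint]; simp

lemma len_nonneg (e : Sym2 Plane) : 0 ≤ len e := by
  induction e with | _ a b => exact (dist_nonneg : 0 ≤ dist a b)

lemma Bisects.len_le {e h : Sym2 Plane} (H : Bisects e h) : len h ≤ len e := by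
  induction H with
  | refl => exact le_rfl
  | @tail f g _ h ih =>
    have := h.len_eq
    have := len_nonneg g
    linarith

/-- The midpoint of an edge is not the midpoint of any edge which arises from it by proper
bisection. -/
lemma Bisects.eq_of_midpoint {a b c d : Plane} (hcd : c ≠ d) (H : Bisects s(a, b) s(c, d))
    (hm : midpoint ℝ a b = midpoint ℝ c d) : s(a, b) = s(c, d) := by
  rcases Relation.ReflTransGen.cases_head H with h | ⟨h, ⟨a', b', hab, rfl⟩, h2⟩
  · exact h
  exfalso
  have hm' : midpoint ℝ a' b' = midpoint ℝ c d := by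
    rw [← hm]
    rcases Sym2.eq_iff.mp hab with ⟨rfl, rfl⟩ | ⟨rfl, rfl⟩
    · rfl
    · exact midpoint_comm _ _
  have hsub := Bisects.seg_subset h2
  obtain ⟨s, s0, s1, hs⟩ := mem_segment_iff.mp (hsub (left_mem_segment ℝ c d))
  obtain ⟨t, t0, t1, ht⟩ := mem_segment_iff.mp (hsub (right_mem_segment ℝ c d))
  have hne : a' ≠ midpoint ℝ a' b' := by
    intro h
    rw [← h] at hs ht
    apply hcd
    rw [hs, ht]; simp
  have e1 : (AffineMap.lineMap a' (midpoint ℝ a' b') (1:ℝ) : Plane) =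
      AffineMap.lineMap a' (midpoint ℝ a' b') ((s + t) / 2) := by
    rw [AffineMap.lineMap_apply_one]
    nth_rewrite 1 [hm']
    rw [hs, ht]
    apply plane_ext <;> simp only [lineMap_coord, midpoint_coord] <;> ring
  have := lineMap_inj hne e1
  have e2 : s = 1 := by linarith
  have e3 : t = 1 := by linarith
  exact hcd (by rw [hs, ht, e2, e3])

lemma Bisects.eq_of_half {e f h : Sym2 Plane} (H : Bisects e f) (he : HalfOf e h) (hf : HalfOf f h)
    (h0 : 0 < len h) : e = f := by
  rcases Relation.ReflTransGen.cases_head H with h1 | ⟨k, h1, h2⟩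
  · exact h1
  · have := Bisects.len_le h2
    have := h1.len_eq
    have := he.len_eq
    have := hf.len_eq
    linarith

/-! ### Refinement rules and the refinement forest -/

/-- The properties shared by the red refinements of triangles and of convex quadrilaterals: the
children of `X` are convex, cover `X` without overlap, have no hanging nodes among each other, and
their edges are halves of the edges of `X` or edges of two children. -/
structure RedSystem {n : ℕ} [NeZero n] (kids : Elem n → Finset (Elem n)) : Prop where
  convex : ∀ {X K : Elem n}, IsConvexCCW X → K ∈ kids X → IsConvexCCW K
  cover : ∀ {X : Elem n}, IsConvexCCW X → hull X = ⋃ K ∈ kids X, hull K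
  disj : ∀ {X K K' : Elem n}, IsConvexCCW X → K ∈ kids X → K' ∈ kids X → K ≠ K' →
    Disjoint (interior (hull K)) (interior (hull K'))
  vertex_of_parent : ∀ {X K : Elem n} {v : Plane}, IsConvexCCW X → K ∈ kids X → v ∈ range X →
    v ∈ hull K → v ∈ range K
  vertex_of_sibling : ∀ {X K K' : Elem n} {v : Plane}, IsConvexCCW X → K ∈ kids X →
    K' ∈ kids X → v ∈ range K → v ∈ hull K' → v ∈ range K'
  half_edge : ∀ {X K : Elem n} {i : Fin n} {p q : Plane}, IsConvexCCW X → K ∈ kids X → p ≠ q →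
    p ∈ segment ℝ (X i) (X (i + 1)) → q ∈ segment ℝ (X i) (X (i + 1)) → p ∈ hull K → q ∈ hull K →
    ∃ j, HalfOf (edge X i) (edge K j) ∧ p ∈ seg (edge K j) ∧ q ∈ seg (edge K j)
  kid_vertex : ∀ {X K : Elem n} {v : Plane}, IsConvexCCW X → K ∈ kids X → v ∈ range K →
    v ∈ range X ∨ (∃ i, v = midpoint ℝ (X i) (X (i + 1))) ∨ v ∈ interior (hull X)
  kid_edge : ∀ {X K : Elem n}, IsConvexCCW X → K ∈ kids X → ∀ j,
    (∃ i, HalfOf (edge X i) (edge K j)) ∨ ∃ K' ∈ kids X, ∃ j', K' j' = K (j + 1) ∧ K' (j' + 1) = K j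
  vertex_unique : ∀ {X K : Elem n} {i j : Fin n}, IsConvexCCW X → K ∈ kids X → X i ∈ hull K →
    X j ∈ hull K → i = j
  exists_half : ∀ (X : Elem n) (i : Fin n), (∃ K ∈ kids X, ∃ j,
      K j = X i ∧ K (j + 1) = midpoint ℝ (X i) (X (i + 1))) ∧
    ∃ K ∈ kids X, ∃ j, K j = midpoint ℝ (X i) (X (i + 1)) ∧ K (j + 1) = X (i + 1)

/-- `P` arises from `X` by iterated refinement. -/
abbrev Desc {n : ℕ} (kids : Elem n → Finset (Elem n)) (X P : Elem n) : Prop :=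
  Relation.ReflTransGen (fun A B => B ∈ kids A) X P

section Forest

variable {n : ℕ} [NeZero n] [Polygon n] {kids : Elem n → Finset (Elem n)} {X P K : Elem n}

omit [Polygon n] in
lemma RedSystem.exists_kid_vertex (hk : RedSystem kids) (X : Elem n) (i : Fin n) :
    ∃ K ∈ kids X, X i ∈ range K := by
  obtain ⟨⟨K, hK, j, h, -⟩, -⟩ := hk.exists_half X i
  exact ⟨K, hK, j, h⟩

omit [Polygon n] in
lemma RedSystem.exists_kid_midpoint (hk : RedSystem kids) (X : Elem n) (i : Fin n) :
    ∃ K ∈ kids X, midpoint ℝ (X i) (X (i + 1)) ∈ range K := by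
  obtain ⟨⟨K, hK, j, -, h⟩, -⟩ := hk.exists_half X i
  exact ⟨K, hK, j + 1, h⟩

omit [Polygon n] in
lemma RedSystem.kid_subset (hk : RedSystem kids) (hX : IsConvexCCW X) (hK : K ∈ kids X) :
    hull K ⊆ hull X := by
  rw [hk.cover hX]
  exact subset_biUnion_of_mem (u := fun K => hull K) (Finset.mem_coe.mpr hK)

omit [Polygon n] in
lemma RedSystem.kid_ssubset (hk : RedSystem kids) (hX : IsConvexCCW X) (hK : K ∈ kids X) :
    hull K ⊂ hull X := by
  refine ⟨hk.kid_subset hX hK, fun h => ?_⟩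
  exact add_one_ne hX 0 (hk.vertex_unique hX hK (h (vertex_mem_hull X _)) (h (vertex_mem_hull X _)))

omit [Polygon n] in
lemma RedSystem.desc_convex (hk : RedSystem kids) (hX : IsConvexCCW X) (h : Desc kids X P) :
    IsConvexCCW P := by
  induction h with
  | refl => exact hX
  | tail _ h ih => exact hk.convex ih h

omit [Polygon n] in
lemma RedSystem.desc_subset (hk : RedSystem kids) (hX : IsConvexCCW X) (h : Desc kids X P) :
    hull P ⊆ hull X := by
  induction h with
  | refl => exact Subset.rfl
  | tail h1 h ih => exact (hk.kid_subset (hk.desc_convex hX h1) h).trans ih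

omit [Polygon n] in
lemma RedSystem.desc_interior_subset (hk : RedSystem kids) (hX : IsConvexCCW X)
    (h : Desc kids X P) : interior (hull P) ⊆ interior (hull X) :=
  interior_mono (hk.desc_subset hX h)

omit [Polygon n] in
lemma RedSystem.desc_cases (hk : RedSystem kids) (hX : IsConvexCCW X) (h : Desc kids X P) :
    P = X ∨ ∃ K ∈ kids X, Desc kids K P ∧ hull P ⊆ hull K ∧ IsConvexCCW K := by
  rcases Relation.ReflTransGen.cases_head h with h | ⟨K, h1, h2⟩
  · exact Or.inl h.symm
  · exact Or.inr ⟨K, h1, h2, hk.desc_subset (hk.convex hX h1) h2, hk.convex hX h1⟩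

omit [Polygon n] in
lemma RedSystem.desc_vertex (hk : RedSystem kids) (hX : IsConvexCCW X) (h : Desc kids X P)
    {v : Plane} (hv : v ∈ range X) (hvP : v ∈ hull P) : v ∈ range P := by
  induction h with
  | refl => exact hv
  | tail h1 h ih =>
    have hc := hk.desc_convex hX h1
    exact hk.vertex_of_parent hc h (ih (hk.kid_subset hc h hvP)) hvP

omit [Polygon n] in
/-- A new node of the refinement of `X` is a vertex of every proper descendant that contains it. -/
lemma RedSystem.desc_new_vertex (hk : RedSystem kids) (hX : IsConvexCCW X) (h : Desc kids X P)
    (hne : P ≠ X) (hK : K ∈ kids X) {v : Plane} (hv : v ∈ range K) (hvP : v ∈ hull P) :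
    v ∈ range P := by
  rcases hk.desc_cases hX h with h | ⟨K', hK', h', hs, hc⟩
  · exact absurd h hne
  · exact hk.desc_vertex hc h' (hk.vertex_of_sibling hX hK hK' hv (hs hvP)) hvP

lemma RedSystem.desc_not_disjoint (hk : RedSystem kids) (hX : IsConvexCCW X)
    (h : Desc kids X P) : ¬ Disjoint (interior (hull X)) (interior (hull P)) :=
  not_disjoint_of_subset (hk.desc_convex hX h) (hk.desc_subset hX h)

omit [Polygon n] in
lemma RedSystem.eq_of_desc (hk : RedSystem kids) (hX : IsConvexCCW X) (h : Desc kids X P)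
    (hs : hull X ⊆ hull P) : P = X := by
  rcases hk.desc_cases hX h with h | ⟨K', hK', h', hs', hc⟩
  · exact h
  · exact absurd (hs.trans hs') (hk.kid_ssubset hX hK').2

omit [Polygon n] in
lemma RedSystem.kid_ne (hk : RedSystem kids) (hX : IsConvexCCW X) (hK : K ∈ kids X)
    (h : Desc kids K P) : P ≠ X := by
  rintro rfl
  exact (hk.kid_ssubset hX hK).2 (hk.desc_subset (hk.convex hX hK) h)

omit [Polygon n] in
/-- Two descendants of the same element are nested or do not overlap. -/
lemma RedSystem.desc_comparable (hk : RedSystem kids) (hX : IsConvexCCW X) (hP : Desc kids X P)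
    (hK : Desc kids X K) :
    Desc kids P K ∨ Desc kids K P ∨ Disjoint (interior (hull P)) (interior (hull K)) := by
  induction hP using Relation.ReflTransGen.head_induction_on with
  | refl => exact Or.inl hK
  | @head X A h1 h2 ih =>
    rcases Relation.ReflTransGen.cases_head hK with rfl | ⟨c, hc, hc'⟩
    · exact Or.inr (Or.inl (Relation.ReflTransGen.head h1 h2))
    · by_cases hac : A = c
      · subst hac
        exact ih (hk.convex hX h1) hc'
      · exact Or.inr (Or.inr ((hk.disj hX h1 hc hac).mono
          (hk.desc_interior_subset (hk.convex hX h1) h2)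
          (hk.desc_interior_subset (hk.convex hX hc) hc')))

lemma RedSystem.desc_edge (hk : RedSystem kids) (hX : IsConvexCCW X) (hP : Desc kids X P)
    {i j : Fin n} {p q : Plane} (hpq : p ≠ q) (hp : p ∈ seg (edge P i)) (hq : q ∈ seg (edge P i))
    (hp' : p ∈ seg (edge X j)) (hq' : q ∈ seg (edge X j)) : Bisects (edge X j) (edge P i) := by
  induction hP using Relation.ReflTransGen.head_induction_on generalizing j with
  | refl => rw [edge_eq_of_overlap hX hpq hp' hq' hp hq]
  | @head X A h1 h2 ih =>
    have hA := hk.convex hX h1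
    have hs := (edge_subset_hull P i).trans (hk.desc_subset hA h2)
    obtain ⟨l, hl, h3, h4⟩ := hk.half_edge hX h1 hpq hp' hq' (hs hp) (hs hq)
    exact Relation.ReflTransGen.head hl (ih hA h3 h4)

/-- Edges of descendants of two non-overlapping elements without hanging nodes among each other
are nested if they overlap, since they arise by bisection of a common edge. -/
lemma RedSystem.laminar_of_pair (hk : RedSystem kids) {A B P Q : Elem n} (hA : IsConvexCCW A)
    (hB : IsConvexCCW B) (hd : Disjoint (interior (hull A)) (interior (hull B)))
    (h1 : ∀ i, A i ∈ hull B → A i ∈ range B) (h2 : ∀ i, B i ∈ hull A → B i ∈ range A)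
    (hP : Desc kids A P) (hQ : Desc kids B Q) {i j : Fin n} {p q : Plane} (hpq : p ≠ q)
    (hp : p ∈ seg (edge P i)) (hq : q ∈ seg (edge P i))
    (hp' : p ∈ seg (edge Q j)) (hq' : q ∈ seg (edge Q j)) :
    Bisects (edge P i) (edge Q j) ∨ Bisects (edge Q j) (edge P i) := by
  have hs := (edge_subset_hull P i).trans (hk.desc_subset hA hP)
  have hs' := (edge_subset_hull Q j).trans (hk.desc_subset hB hQ)
  obtain ⟨k, l, hkl, e1, e2⟩ := exists_common_edge hA hB hd h1 h2 hpq (hs hp) (hs hq) (hs' hp')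
    (hs' hq')
  have b1 := hk.desc_edge hA hP (j := k) hpq hp hq e1 e2
  have b2 := hk.desc_edge hB hQ (j := l) hpq hp' hq' (by rw [← hkl]; exact e1)
    (by rw [← hkl]; exact e2)
  rw [← hkl] at b2
  exact b1.comparable b2 hpq hp hq hp' hq'

lemma RedSystem.desc_laminar (hk : RedSystem kids) (hX : IsConvexCCW X) {Q : Elem n}
    (hP : Desc kids X P) (hQ : Desc kids X Q) {i j : Fin n} {p q : Plane} (hpq : p ≠ q)
    (hp : p ∈ seg (edge P i)) (hq : q ∈ seg (edge P i))
    (hp' : p ∈ seg (edge Q j)) (hq' : q ∈ seg (edge Q j)) :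
    Bisects (edge P i) (edge Q j) ∨ Bisects (edge Q j) (edge P i) := by
  induction hP using Relation.ReflTransGen.head_induction_on with
  | refl => exact Or.inl (hk.desc_edge hX hQ hpq hp' hq' hp hq)
  | @head X A h1 h2 ih =>
    rcases Relation.ReflTransGen.cases_head hQ with rfl | ⟨c, hc, hc'⟩
    · exact Or.inr (hk.desc_edge hX (Relation.ReflTransGen.head h1 h2) hpq hp hq hp' hq')
    · by_cases hac : A = c
      · subst hac
        exact ih (hk.convex hX h1) hc'
      · exact hk.laminar_of_pair (hk.convex hX h1) (hk.convex hX hc) (hk.disj hX h1 hc hac)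
          (fun i hi => hk.vertex_of_sibling hX h1 hc (mem_range_self i) hi)
          (fun i hi => hk.vertex_of_sibling hX hc h1 (mem_range_self i) hi) h2 hc' hpq hp hq hp' hq'

variable {R : Set Plane} {M₀ : Mesh n}

omit [Polygon n] in
lemma RedSystem.forest_convex (hk : RedSystem kids) (hT : IsTriangulation R M₀)
    (hX : X ∈ forest kids M₀) : IsConvexCCW X := by
  obtain ⟨T, hTM, h⟩ := hX
  exact hk.desc_convex (hT.convexCCW T hTM) h

omit [Polygon n] [NeZero n] in
lemma forest_desc (hX : X ∈ forest kids M₀) (h : Desc kids X P) : P ∈ forest kids M₀ := by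
  obtain ⟨T, hTM, h'⟩ := hX
  exact ⟨T, hTM, h'.trans h⟩

omit [Polygon n] in
/-- Two elements of the refinement forest are nested or do not overlap. -/
lemma RedSystem.forest_comparable (hk : RedSystem kids) (hT : IsTriangulation R M₀)
    (hP : P ∈ forest kids M₀) (hK : K ∈ forest kids M₀) :
    Desc kids P K ∨ Desc kids K P ∨ Disjoint (interior (hull P)) (interior (hull K)) := by
  obtain ⟨T, hTM, h⟩ := hP
  obtain ⟨T', hTM', h'⟩ := hK
  by_cases hTT : T = T'
  · subst hTT
    exact hk.desc_comparable (hT.convexCCW T hTM) h h'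
  · exact Or.inr (Or.inr ((hT.disjoint T hTM T' hTM' hTT).mono
      (hk.desc_interior_subset (hT.convexCCW T hTM) h)
      (hk.desc_interior_subset (hT.convexCCW T' hTM') h')))

lemma IsConforming.vertex (hC : IsConforming M₀) (hT : IsTriangulation R M₀) {A B : Elem n}
    (hA : A ∈ M₀.elements) (hB : B ∈ M₀.elements) {v : Plane} (hv : v ∈ range A)
    (hvB : v ∈ hull B) : v ∈ range B := by
  by_contra hn
  by_cases hAB : A = B
  · exact hn (hAB ▸ hv)
  refine hC v ⟨(hT.mem_nodes v).mpr ⟨A, hA, hv⟩, B, hB, ⟨subset_closure hvB, fun hi => ?_⟩, hn⟩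
  obtain ⟨i, rfl⟩ := hv
  exact notMem_interior_of_disjoint (hT.convexCCW A hA) (hT.disjoint B hB A hA (Ne.symm hAB))
    (vertex_mem_hull A i) hi

/-- Overlapping edges of elements of the refinement forest are nested. -/
lemma RedSystem.forest_laminar (hk : RedSystem kids) (hT : IsTriangulation R M₀)
    (hC : IsConforming M₀) (hP : P ∈ forest kids M₀) (hK : K ∈ forest kids M₀)
    {i j : Fin n} {p q : Plane} (hpq : p ≠ q)
    (hp : p ∈ seg (edge P i)) (hq : q ∈ seg (edge P i))
    (hp' : p ∈ seg (edge K j)) (hq' : q ∈ seg (edge K j)) :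
    Bisects (edge P i) (edge K j) ∨ Bisects (edge K j) (edge P i) := by
  obtain ⟨T, hTM, h⟩ := hP
  obtain ⟨T', hTM', h'⟩ := hK
  by_cases hTT : T = T'
  · subst hTT
    exact hk.desc_laminar (hT.convexCCW T hTM) h h' hpq hp hq hp' hq'
  · exact hk.laminar_of_pair (hT.convexCCW T hTM) (hT.convexCCW T' hTM')
      (hT.disjoint T hTM T' hTM' hTT)
      (fun i hi => hC.vertex hT hTM hTM' (mem_range_self i) hi)
      (fun i hi => hC.vertex hT hTM' hTM (mem_range_self i) hi) h h' hpq hp hq hp' hq'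

omit [Polygon n] in
lemma RedSystem.eq_of_desc_of_edge (hk : RedSystem kids) (hX : IsConvexCCW X)
    (h : Desc kids X P) {i j : Fin n} (he : edge X i = edge P j) : P = X := by
  rcases hk.desc_cases hX h with h | ⟨K, hK, -, hs, -⟩
  · exact h
  exfalso
  have hp : X i ∈ seg (edge P j) := he ▸ left_mem_segment ℝ _ _
  have hq : X (i + 1) ∈ seg (edge P j) := he ▸ right_mem_segment ℝ _ _
  exact add_one_ne hX i (hk.vertex_unique hX hK (hs (edge_subset_hull P j hq))
    (hs (edge_subset_hull P j hp)))

omit [Polygon n] in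
/-- Different elements of the refinement forest with a common edge do not overlap. -/
lemma RedSystem.disjoint_of_edge (hk : RedSystem kids) (hT : IsTriangulation R M₀)
    (hP : P ∈ forest kids M₀) (hK : K ∈ forest kids M₀) (hne : P ≠ K) {i j : Fin n}
    (he : edge P i = edge K j) : Disjoint (interior (hull P)) (interior (hull K)) := by
  rcases hk.forest_comparable hT hP hK with h | h | h
  · exact absurd (hk.eq_of_desc_of_edge (hk.forest_convex hT hP) h he).symm hne
  · exact absurd (hk.eq_of_desc_of_edge (hk.forest_convex hT hK) h he.symm) hne
  · exact h

/-- An element of the refinement forest has at most one neighbor across each edge. -/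
lemma RedSystem.neighbor_unique (hk : RedSystem kids) (hT : IsTriangulation R M₀) {K' : Elem n}
    (hP : P ∈ forest kids M₀) (hK : K ∈ forest kids M₀) (hK' : K' ∈ forest kids M₀)
    (hne : P ≠ K) (hne' : P ≠ K') {i j j' : Fin n}
    (he : edge P i = edge K j) (he' : edge P i = edge K' j') : K = K' := by
  by_contra hKK
  have cP := hk.forest_convex hT hP
  have cK := hk.forest_convex hT hK
  have cK' := hk.forest_convex hT hK'
  obtain ⟨a1, a2⟩ := edge_orientation cP cK (hk.disjoint_of_edge hT hP hK hne he) he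
  obtain ⟨b1, b2⟩ := edge_orientation cP cK' (hk.disjoint_of_edge hT hP hK' hne' he') he'
  exact not_disjoint_of_same_edge cK cK' (a2.symm.trans b2) (a1.symm.trans b1)
    (hk.disjoint_of_edge hT hK hK' hKK (he.symm.trans he'))

/-- The parent of an element of the refinement forest lies between this element and each of its
proper ancestors. -/
lemma RedSystem.desc_parent (hk : RedSystem kids) (hT : IsTriangulation R M₀)
    (hP : P ∈ forest kids M₀) (hK : K ∈ kids P) (hX : X ∈ forest kids M₀) (h : Desc kids X K)
    (hne : K ≠ X) : Desc kids X P := by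
  have cP := hk.forest_convex hT hP
  have cX := hk.forest_convex hT hX
  have cK := hk.convex cP hK
  have hsub := hk.desc_subset cX h
  rcases hk.forest_comparable hT hP hX with h' | h' | h'
  · rcases hk.desc_cases cP h' with rfl | ⟨L, hL, h2, hs, cL⟩
    · exact Relation.ReflTransGen.refl
    · by_cases hLK : L = K
      · subst hLK
        exact absurd (hk.eq_of_desc cX h hs) hne
      · exact absurd (hk.disj cP hL hK hLK) (not_disjoint_of_subset cK (hsub.trans hs))
  · exact h'
  · obtain ⟨x, hx⟩ := interior_hull_nonempty cK
    exact absurd (interior_mono hsub hx)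
      (disjoint_left.mp h' (interior_mono (hk.kid_subset cP hK) hx))

lemma RedSystem.parent_unique (hk : RedSystem kids) (hT : IsTriangulation R M₀)
    (hP : P ∈ forest kids M₀) (hX : X ∈ forest kids M₀) (hKP : K ∈ kids P) (hKX : K ∈ kids X) :
    P = X := by
  have cP := hk.forest_convex hT hP
  have cX := hk.forest_convex hT hX
  have h1 := hk.desc_parent hT hP hKP hX (Relation.ReflTransGen.single hKX)
    (hk.kid_ne cX hKX Relation.ReflTransGen.refl)
  have h2 := hk.desc_parent hT hX hKX hP (Relation.ReflTransGen.single hKP)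
    (hk.kid_ne cP hKP Relation.ReflTransGen.refl)
  exact hk.eq_of_desc cX h1 (hk.desc_subset cP h2)

/-- An element of the forest that contains an inner point of another one is nested with it. -/
lemma RedSystem.comparable_of_mem (hk : RedSystem kids) (hT : IsTriangulation R M₀)
    (hP : P ∈ forest kids M₀) (hK : K ∈ forest kids M₀) {x : Plane} (hx : x ∈ interior (hull P))
    (hxK : x ∈ hull K) : Desc kids P K ∨ Desc kids K P := by
  rcases hk.forest_comparable hT hP hK with h | h | h
  · exact Or.inl h
  · exact Or.inr h
  · exact absurd hx (notMem_interior_of_disjoint (hk.forest_convex hT hK) h hxK)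

/-- An element of the forest that contains an inner point of the common edge of two others is
nested with one of them. -/
lemma RedSystem.comparable_of_mem_edge (hk : RedSystem kids) (hT : IsTriangulation R M₀)
    (hP : P ∈ forest kids M₀) (hK : K ∈ forest kids M₀) (hne : P ≠ K) {i j : Fin n}
    (he : edge P i = edge K j) {m : Plane} (hm : m ∈ openSegment ℝ (P i) (P (i + 1))) {L : Elem n}
    (hL : L ∈ forest kids M₀) (hmL : m ∈ hull L) :
    (Desc kids P L ∨ Desc kids L P) ∨ (Desc kids K L ∨ Desc kids L K) := by
  have cP := hk.forest_convex hT hP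
  have cK := hk.forest_convex hT hK
  have cL := hk.forest_convex hT hL
  have hn := hull_union_mem_nhds cP cK (hk.disjoint_of_edge hT hP hK hne he) he hm
  obtain ⟨x, hx, hxL⟩ := inter_interior_nonempty cL isOpen_interior
    (mem_interior_iff_mem_nhds.mpr hn) hmL
  rcases interior_subset hx with h | h
  · exact Or.inl (hk.comparable_of_mem hT hL hP hxL h).symm
  · exact Or.inr (hk.comparable_of_mem hT hL hK hxL h).symm

end Forest

/-! ### Meshes obtained by red refinement -/

section Reached

variable {n : ℕ} [NeZero n] [Polygon n] {kids : Elem n → Finset (Elem n)}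
  {R : Set Plane} {M₀ M M' : Mesh n} {X P K L T : Elem n}

/-- What is needed about a mesh `M` that has been obtained from `M₀` by red refinement: it is a
triangulation of the same region, its elements belong to the refinement forest, and the nodes of
`M₀` come first in its array of nodes. -/
structure IsReached (kids : Elem n → Finset (Elem n)) (R : Set Plane) (M₀ M : Mesh n) : Prop where
  tri : IsTriangulation R M
  mem_forest : ∀ T ∈ M.elements, T ∈ forest kids M₀
  nodes : ∃ l, M.nodes = M₀.nodes ++ l

omit [Polygon n] in
lemma RedSystem.redStep (hk : RedSystem kids) (hM : IsReached kids R M₀ M)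
    (h : RedStep kids M M') : IsReached kids R M₀ M' := by
  classical
  obtain ⟨S, hS, hE, l, hl, hmem, hn⟩ := h
  obtain ⟨l₀, hl₀⟩ := hM.nodes
  have hE' : ∀ T, T ∈ M'.elements ↔ (T ∈ M.elements ∧ T ∉ S) ∨ ∃ X ∈ S, T ∈ kids X := by
    intro T; rw [hE]; simp
  have hc := hM.tri.convexCCW
  have hd : ∀ T ∈ M.elements, T ∉ S → ∀ X ∈ S, ∀ K ∈ kids X,
      Disjoint (interior (hull T)) (interior (hull K)) := fun T hT hTS X hX K hK =>
    (hM.tri.disjoint T hT X (hS hX) (fun e => hTS (e ▸ hX))).mono_right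
      (interior_mono (hk.kid_subset (hc X (hS hX)) hK))
  refine ⟨⟨fun T hT => ?_, fun T hT K hK hne => ?_, ?_, ?_, fun v => ?_⟩, fun T hT => ?_, ?_⟩
  · rcases (hE' T).mp hT with ⟨h, -⟩ | ⟨X, hX, h⟩
    · exact hc T h
    · exact hk.convex (hc X (hS hX)) h
  · rcases (hE' T).mp hT with ⟨h, h'⟩ | ⟨X, hX, h⟩ <;>
      rcases (hE' K).mp hK with ⟨g, g'⟩ | ⟨Y, hY, g⟩
    · exact hM.tri.disjoint T h K g hne
    · exact hd T h h' Y hY K g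
    · exact (hd K g g' X hX T h).symm
    · by_cases hXY : X = Y
      · subst hXY
        exact hk.disj (hc X (hS hX)) h g hne
      · exact (hM.tri.disjoint X (hS hX) Y (hS hY) hXY).mono
          (interior_mono (hk.kid_subset (hc X (hS hX)) h))
          (interior_mono (hk.kid_subset (hc Y (hS hY)) g))
  · rw [← hM.tri.cover]
    apply Subset.antisymm
    · refine iUnion₂_subset fun T hT => ?_
      rcases (hE' T).mp hT with ⟨h, -⟩ | ⟨X, hX, h⟩
      · exact subset_biUnion_of_mem (u := fun T => hull T) (Finset.mem_coe.mpr h)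
      · exact (hk.kid_subset (hc X (hS hX)) h).trans
          (subset_biUnion_of_mem (u := fun T => hull T) (Finset.mem_coe.mpr (hS hX)))
    · refine iUnion₂_subset fun T hT => ?_
      by_cases hTS : T ∈ S
      · rw [hk.cover (hc T hT)]
        refine iUnion₂_subset fun K hK => ?_
        exact subset_biUnion_of_mem (u := fun T => hull T)
          (Finset.mem_coe.mpr ((hE' K).mpr (Or.inr ⟨T, hTS, hK⟩)))
      · exact subset_biUnion_of_mem (u := fun T => hull T)
          (Finset.mem_coe.mpr ((hE' T).mpr (Or.inl ⟨hT, hTS⟩)))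
  · rw [hn]
    refine List.Nodup.append hM.tri.nodup hl fun v hv hv' => ?_
    exact ((hmem v).mp hv').1 hv
  · rw [hn, List.mem_append, hmem]
    constructor
    · rintro (h | ⟨-, X, hX, K, hK, h⟩)
      · obtain ⟨T, hT, i, rfl⟩ := (hM.tri.mem_nodes v).mp h
        by_cases hTS : T ∈ S
        · obtain ⟨K, hK, hi⟩ := hk.exists_kid_vertex T i
          exact ⟨K, (hE' K).mpr (Or.inr ⟨T, hTS, hK⟩), hi⟩
        · exact ⟨T, (hE' T).mpr (Or.inl ⟨hT, hTS⟩), i, rfl⟩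
      · exact ⟨K, (hE' K).mpr (Or.inr ⟨X, hX, hK⟩), h⟩
    · rintro ⟨T, hT, h⟩
      rcases (hE' T).mp hT with ⟨g, -⟩ | ⟨X, hX, g⟩
      · exact Or.inl ((hM.tri.mem_nodes v).mpr ⟨T, g, h⟩)
      · by_cases hv : v ∈ M.nodes
        · exact Or.inl hv
        · exact Or.inr ⟨hv, X, hX, T, g, h⟩
  · rcases (hE' T).mp hT with ⟨h, -⟩ | ⟨X, hX, h⟩
    · exact hM.mem_forest T h
    · exact forest_desc (hM.mem_forest X (hS hX)) (Relation.ReflTransGen.single h)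
  · exact ⟨l₀ ++ l, by rw [hn, hl₀, List.append_assoc]⟩

omit [Polygon n] in
lemma RedSystem.isReached (hk : RedSystem kids) (hT : IsTriangulation R M₀)
    (h : IsRedRefinement kids M₀ M) : IsReached kids R M₀ M := by
  induction h with
  | refl => exact ⟨hT, fun T hT => ⟨T, hT, Relation.ReflTransGen.refl⟩, [], by simp⟩
  | tail _ h ih => exact hk.redStep ih h

omit [Polygon n] in
lemma IsTriangulation.vertex_mem_nodes (hM : IsTriangulation R M) (hT : T ∈ M.elements)
    (i : Fin n) : T i ∈ M.nodes :=
  (hM.mem_nodes _).mpr ⟨T, hT, mem_range_self i⟩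

lemma RedSystem.eq_of_leaf_desc (hk : RedSystem kids) (hM : IsTriangulation R M)
    (hT : T ∈ M.elements) (hL : L ∈ M.elements) (h : Desc kids T L) : T = L := by
  by_contra hne
  exact hk.desc_not_disjoint (hM.convexCCW T hT) h (hM.disjoint T hT L hL hne)

lemma RedSystem.desc_of_ssubset (hk : RedSystem kids) (hT : IsTriangulation R M₀)
    (hX : X ∈ forest kids M₀) (hP : P ∈ forest kids M₀) (h : hull P ⊂ hull X) :
    Desc kids X P ∧ P ≠ X := by
  have hne : P ≠ X := by rintro rfl; exact h.2 Subset.rfl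
  refine ⟨?_, hne⟩
  rcases hk.forest_comparable hT hX hP with h' | h' | h'
  · exact h'
  · exact absurd (hk.desc_subset (hk.forest_convex hT hP) h') h.2
  · exact absurd h' (not_disjoint_of_subset (hk.forest_convex hT hP) h.1)

omit [Polygon n] in
lemma RedSystem.ssubset_of_desc (hk : RedSystem kids) (hX : IsConvexCCW X) (h : Desc kids X P)
    (hne : P ≠ X) : hull P ⊂ hull X :=
  ⟨hk.desc_subset hX h, fun h' => hne (hk.eq_of_desc hX h h')⟩

omit [Polygon n] in
lemma RedSystem.refined_of_desc (hk : RedSystem kids) (hT : IsTriangulation R M₀)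
    (hX : X ∈ forest kids M₀) (hL : L ∈ M.elements) (h : Desc kids X L) (hne : L ≠ X) :
    HasBeenRefined kids M₀ M X :=
  ⟨hX, L, hL, hk.ssubset_of_desc (hk.forest_convex hT hX) h hne⟩

lemma RedSystem.not_desc_of_refined (hk : RedSystem kids) (hT : IsTriangulation R M₀)
    (hM : IsReached kids R M₀ M) (hX : HasBeenRefined kids M₀ M X) (hL : L ∈ M.elements) :
    ¬ Desc kids L X := by
  intro h
  obtain ⟨hX, S, hS, hSX⟩ := hX
  have cL := hM.tri.convexCCW L hL
  have h1 := (hk.desc_of_ssubset hT hX (hM.mem_forest S hS) hSX).1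
  have := hk.eq_of_leaf_desc hM.tri hL hS (h.trans h1)
  subst this
  exact hSX.2 (hk.desc_subset cL h)

/-- If the children of `P` belong to the mesh, then they are the only elements of the mesh that
are nested with `P`. -/
lemma RedSystem.mem_kids_of_comparable (hk : RedSystem kids) (hT : IsTriangulation R M₀)
    (hM : IsReached kids R M₀ M) (hP : P ∈ forest kids M₀) (hPM : kids P ⊆ M.elements)
    (hL : L ∈ M.elements) (h : Desc kids P L ∨ Desc kids L P) : L ∈ kids P := by
  have cP := hk.forest_convex hT hP
  obtain ⟨K, hK, -⟩ := hk.exists_kid_vertex P 0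
  have hr : HasBeenRefined kids M₀ M P := hk.refined_of_desc hT hP (hPM hK)
    (Relation.ReflTransGen.single hK) (hk.kid_ne cP hK Relation.ReflTransGen.refl)
  have hn := hk.not_desc_of_refined hT hM hr hL
  rcases h with h | h
  · rcases hk.desc_cases cP h with rfl | ⟨K', hK', h', -, -⟩
    · exact absurd Relation.ReflTransGen.refl hn
    · exact hk.eq_of_leaf_desc hM.tri (hPM hK') hL h' ▸ hK'
  · exact absurd h hn

/-- If the midpoint of an edge of the forest is a node, then some element with this edge has been
refined. -/
lemma RedSystem.exists_refined_of_midpoint (hk : RedSystem kids) (hT : IsTriangulation R M₀)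
    (hC : IsConforming M₀) (hM : IsReached kids R M₀ M) (hP : P ∈ forest kids M₀) {i : Fin n}
    (hm : midpoint ℝ (P i) (P (i + 1)) ∈ M.nodes) :
    ∃ X j, HasBeenRefined kids M₀ M X ∧ edge X j = edge P i := by
  have cP := hk.forest_convex hT hP
  have hmP := midpoint_mem_hull P i
  have hmR := midpoint_notMem_range cP i
  obtain ⟨K₁, hK₁, hmK₁⟩ := hk.exists_kid_midpoint P i
  generalize hmdef : midpoint ℝ (P i) (P (i + 1)) = m at *
  obtain ⟨L, hL, hmL⟩ := (hM.tri.mem_nodes m).mp hm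
  -- along the branch that ends in `L`, the node `m` appears with the refinement of some `X`
  obtain ⟨X, K, hX, hK, hmX, hmK, hKL⟩ : ∃ X K, X ∈ forest kids M₀ ∧ K ∈ kids X ∧ m ∉ range X ∧
      m ∈ range K ∧ Desc kids K L := by
    obtain ⟨L₀, hL₀, hd⟩ := hM.mem_forest L hL
    have hroot : m ∉ range L₀ := by
      intro hr
      obtain ⟨P₀, hP₀, hd'⟩ := hP
      have c₀ := hT.convexCCW P₀ hP₀
      exact hmR (hk.desc_vertex c₀ hd' (hC.vertex hT hL₀ hP₀ hr (hk.desc_subset c₀ hd' hmP)) hmP)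
    have hf : L₀ ∈ forest kids M₀ := ⟨L₀, hL₀, Relation.ReflTransGen.refl⟩
    clear hL₀
    induction hd using Relation.ReflTransGen.head_induction_on with
    | refl => exact absurd hmL hroot
    | @head A B h1 h2 ih =>
      by_cases hB : m ∈ range B
      · exact ⟨A, B, hf, h1, hroot, hB, h2⟩
      · exact ih hB (forest_desc hf (Relation.ReflTransGen.single h1))
  have cX := hk.forest_convex hT hX
  have hr : HasBeenRefined kids M₀ M X := hk.refined_of_desc hT hX hL
    (Relation.ReflTransGen.head hK hKL) (hk.kid_ne cX hK hKL)
  have hmXh : m ∈ hull X := by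
    obtain ⟨j, rfl⟩ := hmK
    exact hk.kid_subset cX hK (vertex_mem_hull K j)
  rcases hk.forest_comparable hT hX hP with h | h | h
  · by_cases hPX : P = X
    · exact ⟨X, i, hr, by rw [hPX]⟩
    · exact absurd (hk.desc_new_vertex cX h hPX hK hmK hmP) hmR
  · by_cases hPX : X = P
    · exact ⟨X, i, hr, by rw [hPX]⟩
    · exact absurd (hk.desc_new_vertex cP h hPX hK₁ hmK₁ hmXh) hmX
  · rcases hk.kid_vertex cX hK hmK with h' | ⟨j, hj⟩ | h'
    · exact absurd h' hmX
    · refine ⟨X, j, hr, ?_⟩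
      obtain ⟨p, q, hpq, h1, h2, h3, h4⟩ := overlap_of_midpoint_eq cX cP h (hj.symm.trans hmdef.symm)
      rcases hk.forest_laminar hT hC hX hP hpq h1 h2 h3 h4 with h' | h'
      · exact Bisects.eq_of_midpoint (edge_ne cP i) h' (hj.symm.trans hmdef.symm)
      · exact (Bisects.eq_of_midpoint (edge_ne cX j) h' (hmdef.trans hj)).symm
    · exact absurd h' (notMem_interior_of_disjoint cP h hmP)

/-! ### Ages of nodes -/

omit [Polygon n] [NeZero n] in
lemma age_lt_length_iff (M : Mesh n) (v : Plane) : age M v < M.nodes.length ↔ v ∈ M.nodes := by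
  classical
  unfold age; exact List.idxOf_lt_length_iff

omit [Polygon n] [NeZero n] in
lemma age_inj {v w : Plane} (hv : v ∈ M.nodes) (h : age M v = age M w) : v = w := by
  classical
  unfold age at h; exact (List.idxOf_inj hv).mp h

omit [Polygon n] [NeZero n] in
lemma age_append {l : List Plane} (hn : M'.nodes = M.nodes ++ l) {v : Plane} (hv : v ∈ M.nodes) :
    age M' v = age M v := by
  classical
  unfold age; rw [hn]; exact List.idxOf_append_of_mem hv

omit [Polygon n] [NeZero n] in
lemma age_lt_of_notMem {l : List Plane} (hn : M'.nodes = M.nodes ++ l) {v w : Plane}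
    (hv : v ∈ M.nodes) (hw : w ∉ M.nodes) : age M' v < age M' w := by
  rw [age_append hn hv]
  refine lt_of_lt_of_le ((age_lt_length_iff M v).mpr hv) ?_
  classical
  unfold age; rw [hn, List.idxOf_append_of_notMem hw]; exact Nat.le_add_right _ _

omit [Polygon n] in
lemma oldestPos_le (M : Mesh n) (T : Elem n) (i : Fin n) :
    age M (T (oldestPos M T)) ≤ age M (T i) :=
  Function.argmin_le (fun i => age M (T i)) i

omit [Polygon n] in
lemma oldestPos_eq (hT : ∀ i, T i ∈ M.nodes) (hinj : Function.Injective T) {i : Fin n}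
    (h : ∀ j, age M (T i) ≤ age M (T j)) : oldestPos M T = i :=
  hinj (age_inj (hT _) (le_antisymm (oldestPos_le M T i) (h _)))

omit [Polygon n] in
lemma vert_zero (M : Mesh n) (T : Elem n) : vert M T 0 = T (oldestPos M T) := by
  unfold vert; rw [add_zero]

/-- The endpoints of each edge of a refined element are older than its midpoint. -/
def EdgesRespectAges (kids : Elem n → Finset (Elem n)) (M₀ M : Mesh n) : Prop :=
  ∀ X, HasBeenRefined kids M₀ M X → ∀ i,
    age M (X i) < age M (midpoint ℝ (X i) (X (i + 1))) ∧
    age M (X (i + 1)) < age M (midpoint ℝ (X i) (X (i + 1)))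

/-- The vertices of a refined element are older than the new nodes in its interior. -/
def CentersRespectAges (kids : Elem n → Finset (Elem n)) (M₀ M : Mesh n) : Prop :=
  ∀ X, HasBeenRefined kids M₀ M X → ∀ K ∈ kids X, ∀ v ∈ range K, v ∈ interior (hull X) →
    ∀ i, age M (X i) < age M v

omit [Polygon n] [NeZero n] in
lemma age_le_length (M : Mesh n) (v : Plane) : age M v ≤ M.nodes.length := by
  classical
  unfold age; exact List.idxOf_le_length

omit [Polygon n] [NeZero n] in
lemma age_lt_append {l : List Plane} (hn : M'.nodes = M.nodes ++ l) {v w : Plane}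
    (h : age M v < age M w) : age M' v < age M' w := by
  have hv : v ∈ M.nodes := (age_lt_length_iff M v).mp (h.trans_le (age_le_length M w))
  by_cases hw : w ∈ M.nodes
  · rwa [age_append hn hv, age_append hn hw]
  · exact age_lt_of_notMem hn hv hw

lemma RedSystem.refined_of_redStep (hk : RedSystem kids) (hT : IsTriangulation R M₀)
    (hM : IsReached kids R M₀ M) {S : Finset (Elem n)} (hS : S ⊆ M.elements)
    (hE : ∀ T, T ∈ M'.elements → T ∈ M.elements ∨ ∃ X ∈ S, T ∈ kids X)
    (hX : HasBeenRefined kids M₀ M' X) : HasBeenRefined kids M₀ M X ∨ X ∈ S := by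
  obtain ⟨hX, L, hL, hs⟩ := hX
  rcases hE L hL with h | ⟨Y, hY, h⟩
  · exact Or.inl ⟨hX, L, h, hs⟩
  have hYf := hM.mem_forest Y (hS hY)
  have hLf := forest_desc hYf (Relation.ReflTransGen.single h)
  obtain ⟨h1, h2⟩ := hk.desc_of_ssubset hT hX hLf hs
  have h3 := hk.desc_parent hT hYf h hX h1 h2
  by_cases hYX : Y = X
  · exact Or.inr (hYX ▸ hY)
  · exact Or.inl (hk.refined_of_desc hT hX (hS hY) h3 hYX)

/-- Even without any assumption on the numbering, vertices are older than the midpoints of the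
adjacent edges and than the inner nodes of a refinement: an edge whose midpoint is already present
when an element is refined has been bisected before, by the refinement of a neighbor. -/
lemma RedSystem.respectAges (hk : RedSystem kids) (hT : IsTriangulation R M₀)
    (hC : IsConforming M₀) (h : IsRedRefinement kids M₀ M) :
    EdgesRespectAges kids M₀ M ∧ CentersRespectAges kids M₀ M := by
  classical
  induction h with
  | refl =>
    have hM := hk.isReached hT (M := M₀) Relation.ReflTransGen.refl
    have hno : ∀ X, ¬ HasBeenRefined kids M₀ M₀ X := by
      intro X hX
      obtain ⟨⟨T, hTM, h⟩, -⟩ := id hX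
      exact hk.not_desc_of_refined hT hM hX hTM h
    exact ⟨fun X hX => absurd hX (hno X), fun X hX => absurd hX (hno X)⟩
  | @tail M M' hr hs ih =>
    have hM := hk.isReached hT hr
    obtain ⟨S, hS, hE, l, -, -, hn⟩ := hs
    have hE' : ∀ T, T ∈ M'.elements → T ∈ M.elements ∨ ∃ X ∈ S, T ∈ kids X := by
      intro T hTM
      rw [hE] at hTM
      simp only [Finset.mem_union, Finset.mem_sdiff, Finset.mem_biUnion] at hTM
      exact hTM.imp_left And.left
    constructor
    · intro X hX i
      rcases hk.refined_of_redStep hT hM hS hE' hX with hX | hXS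
      · exact ⟨age_lt_append hn (ih.1 X hX i).1, age_lt_append hn (ih.1 X hX i).2⟩
      by_cases hm : midpoint ℝ (X i) (X (i + 1)) ∈ M.nodes
      · obtain ⟨Y, j, hY, hYX⟩ :=
          hk.exists_refined_of_midpoint hT hC hM (hM.mem_forest X (hS hXS)) hm
        have hj := ih.1 Y hY j
        rcases Sym2.eq_iff.mp hYX with ⟨e1, e2⟩ | ⟨e1, e2⟩
        · rw [e1, e2] at hj
          exact ⟨age_lt_append hn hj.1, age_lt_append hn hj.2⟩
        · rw [e1, e2, midpoint_comm] at hj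
          exact ⟨age_lt_append hn hj.2, age_lt_append hn hj.1⟩
      · exact ⟨age_lt_of_notMem hn (hM.tri.vertex_mem_nodes (hS hXS) _) hm,
          age_lt_of_notMem hn (hM.tri.vertex_mem_nodes (hS hXS) _) hm⟩
    · intro X hX K hK v hv hvX i
      rcases hk.refined_of_redStep hT hM hS hE' hX with hX | hXS
      · exact age_lt_append hn (ih.2 X hX K hK v hv hvX i)
      refine age_lt_of_notMem hn (hM.tri.vertex_mem_nodes (hS hXS) _) fun hvM => ?_
      obtain ⟨L, hL, j, rfl⟩ := (hM.tri.mem_nodes v).mp hvM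
      have hLX : L = X := by
        by_contra hne
        exact notMem_interior_of_disjoint (hM.tri.convexCCW L hL)
          (hM.tri.disjoint X (hS hXS) L hL (Ne.symm hne)) (vertex_mem_hull L j) hvX
      subst hLX
      exact vertex_notMem_interior (hM.tri.convexCCW L hL) j hvX

end Reached

/-! ### Replacing quartets by their parents -/

section Update

variable {n : ℕ} [NeZero n] [Polygon n] {kids : Elem n → Finset (Elem n)}
  {R : Set Plane} {M₀ M : Mesh n} {X P K L T : Elem n} {pv : Quartet n → Finset Plane}
  {A : Finset (Quartet n)}

lemma mem_joined_iff {V : Finset Plane} (hP : IsConvexCCW P) (hV : ∀ v, v ∈ V ↔ v ∈ range P) :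
    T ∈ joined M V ↔ IsConvexCCW T ∧ IsRotation T P ∧ ∀ i, age M (T 0) ≤ age M (T i) := by
  classical
  unfold joined
  simp only [Finset.mem_filter, Fintype.mem_piFinset]
  have hset : ∀ T : Elem n, Finset.univ.image T = V ↔ range T = range P := by
    intro T
    rw [Finset.ext_iff, Set.ext_iff]
    simp only [hV, Finset.mem_image, Finset.mem_univ, true_and, mem_range]
  constructor
  · rintro ⟨-, h1, h2, h3⟩
    exact ⟨h1, isRotation_of_range_eq hP h1 ((hset T).mp h2), h3⟩
  · rintro ⟨h1, h2, h3⟩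
    exact ⟨fun i => (hV _).mpr (h2.range_eq ▸ mem_range_self i), h1, (hset T).mpr h2.range_eq, h3⟩

omit [Polygon n] in
lemma IsRotation.isConvexCCW (h : IsRotation T P) (hP : IsConvexCCW P) : IsConvexCCW T := by
  obtain ⟨r, hr⟩ := h
  intro i
  have := hP (i + r)
  rw [hr, hr, hr, show i + 1 + r = i + r + 1 by ring, show i + 2 + r = i + r + 2 by ring]
  exact this

omit [Polygon n] in
/-- The rotation of `P` that puts the oldest vertex first. -/
lemma exists_oldest_rotation (M : Mesh n) (P : Elem n) :
    ∃ T, IsRotation T P ∧ ∀ i, age M (T 0) ≤ age M (T i) := by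
  refine ⟨fun i => P (i + oldestPos M P), ⟨_, fun i => rfl⟩, fun i => ?_⟩
  change age M (P (0 + _)) ≤ _
  rw [zero_add]
  exact oldestPos_le M P _

lemma oldest_rotation_unique (hP : IsConvexCCW P) (hn : ∀ i, P i ∈ M.nodes) {T T' : Elem n}
    (h : IsRotation T P) (h' : IsRotation T' P) (ho : ∀ i, age M (T 0) ≤ age M (T i))
    (ho' : ∀ i, age M (T' 0) ≤ age M (T' i)) : T = T' := by
  obtain ⟨r, hr⟩ := h
  obtain ⟨r', hr'⟩ := h'
  have h1 := ho (r' - r)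
  have h2 := ho' (r - r')
  rw [hr, hr, sub_add_cancel, zero_add] at h1
  rw [hr', hr', sub_add_cancel, zero_add] at h2
  have := vertex_injective hP (age_inj (hn _) (le_antisymm h1 h2))
  subst this
  funext i
  rw [hr, hr']

/-- All members of `A` consist of the children of an element of the refinement forest, and
`pv` yields the vertices of this element. -/
def AreQuartets (kids : Elem n → Finset (Elem n)) (M₀ M : Mesh n)
    (pv : Quartet n → Finset Plane) (A : Finset (Quartet n)) : Prop :=
  ∀ Q ∈ A, ∃ P ∈ forest kids M₀, Q = kids P ∧ kids P ⊆ M.elements ∧ ∀ v, v ∈ pv Q ↔ v ∈ range P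

lemma RedSystem.eq_of_kids_eq (hk : RedSystem kids) (hT : IsTriangulation R M₀)
    (hP : P ∈ forest kids M₀) (hX : X ∈ forest kids M₀) (h : kids P = kids X) : P = X := by
  obtain ⟨K, hK, -⟩ := hk.exists_kid_vertex P 0
  exact hk.parent_unique hT hP hX hK (h ▸ hK)

lemma AreQuartets.of_mem (hA : AreQuartets kids M₀ M pv A) (hk : RedSystem kids)
    (hT : IsTriangulation R M₀) (hP : P ∈ forest kids M₀) (hPA : kids P ∈ A) :
    kids P ⊆ M.elements ∧ ∀ v, v ∈ pv (kids P) ↔ v ∈ range P := by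
  obtain ⟨P', hP', h1, h2, h3⟩ := hA _ hPA
  have := hk.eq_of_kids_eq hT hP hP' h1
  subst this
  exact ⟨h2, h3⟩

lemma AreQuartets.mem_update_iff (hA : AreQuartets kids M₀ M pv A) (hk : RedSystem kids)
    (hT : IsTriangulation R M₀) : T ∈ (update M pv A).elements ↔
      (T ∈ M.elements ∧ ∀ Q ∈ A, T ∉ Q) ∨ ∃ P ∈ forest kids M₀, kids P ∈ A ∧ IsRotation T P ∧
        ∀ i, age M (T 0) ≤ age M (T i) := by
  classical
  unfold update
  simp only [Finset.mem_union, Finset.mem_sdiff, Finset.mem_biUnion, id_eq, not_exists, not_and]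
  refine or_congr Iff.rfl ⟨?_, ?_⟩
  · rintro ⟨Q, hQ, h⟩
    obtain ⟨P, hP, rfl, h2, h3⟩ := hA Q hQ
    have := (mem_joined_iff (hk.forest_convex hT hP) h3).mp h
    exact ⟨P, hP, hQ, this.2⟩
  · rintro ⟨P, hP, hPA, h1, h2⟩
    have cP := hk.forest_convex hT hP
    exact ⟨kids P, hPA, (mem_joined_iff cP (hA.of_mem hk hT hP hPA).2).mpr
      ⟨h1.isConvexCCW cP, h1, h2⟩⟩

omit [Polygon n] in
lemma mem_update_nodes_iff {v : Plane} : v ∈ (update M pv A).nodes ↔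
    v ∈ M.nodes ∧ ∃ T ∈ (update M pv A).elements, v ∈ range T := by
  classical
  unfold update
  simp

omit [Polygon n] in
lemma RedSystem.vertex_mem_nodes_of_kids (hk : RedSystem kids) (hM : IsReached kids R M₀ M)
    (hPM : kids P ⊆ M.elements) (i : Fin n) : P i ∈ M.nodes := by
  obtain ⟨K, hK, h⟩ := hk.exists_kid_vertex P i
  exact (hM.tri.mem_nodes _).mpr ⟨K, hPM hK, h⟩

lemma RedSystem.disjoint_of_kids (hk : RedSystem kids) (hT : IsTriangulation R M₀)
    (hM : IsReached kids R M₀ M) (hP : P ∈ forest kids M₀) (hPM : kids P ⊆ M.elements)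
    (hL : L ∈ M.elements) (h : L ∉ kids P) : Disjoint (interior (hull L)) (interior (hull P)) := by
  rcases hk.forest_comparable hT (hM.mem_forest L hL) hP with h' | h' | h'
  · exact absurd (hk.mem_kids_of_comparable hT hM hP hPM hL (Or.inr h')) h
  · exact absurd (hk.mem_kids_of_comparable hT hM hP hPM hL (Or.inl h')) h
  · exact h'

lemma RedSystem.disjoint_of_kids_kids (hk : RedSystem kids) (hT : IsTriangulation R M₀)
    (hM : IsReached kids R M₀ M) (hP : P ∈ forest kids M₀) (hPM : kids P ⊆ M.elements)
    (hX : X ∈ forest kids M₀) (hXM : kids X ⊆ M.elements) (hne : P ≠ X) :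
    Disjoint (interior (hull P)) (interior (hull X)) := by
  have key : ∀ P X : Elem n, P ∈ forest kids M₀ → X ∈ forest kids M₀ → kids X ⊆ M.elements →
      kids P ⊆ M.elements → P ≠ X → ¬ Desc kids X P := by
    intro P X hP hX hXM hPM hne h
    have cP := hk.forest_convex hT hP
    have cX := hk.forest_convex hT hX
    obtain ⟨K, hK, -⟩ := hk.exists_kid_vertex P 0
    have hdK := h.trans (Relation.ReflTransGen.single hK)
    have := hk.mem_kids_of_comparable hT hM hX hXM (hPM hK) (Or.inl hdK)
    exact hne (hk.parent_unique hT hP hX hK this)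
  rcases hk.forest_comparable hT hP hX with h | h | h
  · exact absurd h (key X P hX hP hPM hXM hne.symm)
  · exact absurd h (key P X hP hX hXM hPM hne)
  · exact h

/-- Replacing quartets by their parents yields a triangulation of the same region. -/
lemma AreQuartets.isTriangulation (hA : AreQuartets kids M₀ M pv A) (hk : RedSystem kids)
    (hT : IsTriangulation R M₀) (hM : IsReached kids R M₀ M) :
    IsTriangulation R (update M pv A) := by
  refine ⟨fun T h => ?_, fun T h K h' hne => ?_, ?_, ?_, fun v => ?_⟩
  · rcases (hA.mem_update_iff hk hT).mp h with ⟨h, -⟩ | ⟨P, hP, -, h, -⟩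
    · exact hM.tri.convexCCW T h
    · exact h.isConvexCCW (hk.forest_convex hT hP)
  · rcases (hA.mem_update_iff hk hT).mp h with ⟨g1, g2⟩ | ⟨P, hP, hPA, g1, g2⟩ <;>
      rcases (hA.mem_update_iff hk hT).mp h' with ⟨f1, f2⟩ | ⟨X, hX, hXA, f1, f2⟩
    · exact hM.tri.disjoint T g1 K f1 hne
    · rw [f1.hull_eq]
      exact hk.disjoint_of_kids hT hM hX (hA.of_mem hk hT hX hXA).1 g1 (g2 _ hXA)
    · rw [g1.hull_eq]
      exact (hk.disjoint_of_kids hT hM hP (hA.of_mem hk hT hP hPA).1 f1 (f2 _ hPA)).symm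
    · have hPM := (hA.of_mem hk hT hP hPA).1
      have hXM := (hA.of_mem hk hT hX hXA).1
      rw [g1.hull_eq, f1.hull_eq]
      refine hk.disjoint_of_kids_kids hT hM hP hPM hX hXM ?_
      rintro rfl
      exact hne (oldest_rotation_unique (hk.forest_convex hT hP)
        (hk.vertex_mem_nodes_of_kids hM hPM) g1 f1 g2 f2)
  · rw [← hM.tri.cover]
    apply Subset.antisymm
    · refine iUnion₂_subset fun T h => ?_
      rcases (hA.mem_update_iff hk hT).mp h with ⟨g1, -⟩ | ⟨P, hP, hPA, g1, g2⟩
      · exact subset_biUnion_of_mem (u := fun T => hull T) (Finset.mem_coe.mpr g1)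
      · rw [g1.hull_eq, hk.cover (hk.forest_convex hT hP)]
        refine iUnion₂_subset fun K hK => ?_
        exact subset_biUnion_of_mem (u := fun T => hull T)
          (Finset.mem_coe.mpr ((hA.of_mem hk hT hP hPA).1 hK))
    · refine iUnion₂_subset fun T h => ?_
      by_cases hQ : ∀ Q ∈ A, T ∉ Q
      · exact subset_biUnion_of_mem (u := fun T => hull T)
          (Finset.mem_coe.mpr ((hA.mem_update_iff hk hT).mpr (Or.inl ⟨h, hQ⟩)))
      · push Not at hQ
        obtain ⟨Q, hQA, hTQ⟩ := hQ
        obtain ⟨P, hP, rfl, h2, h3⟩ := hA Q hQA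
        obtain ⟨T', h4, h5⟩ := exists_oldest_rotation M P
        refine (hk.kid_subset (hk.forest_convex hT hP) hTQ).trans ?_
        rw [← h4.hull_eq]
        exact subset_biUnion_of_mem (u := fun T => hull T)
          (Finset.mem_coe.mpr ((hA.mem_update_iff hk hT).mpr (Or.inr ⟨P, hP, hQA, h4, h5⟩)))
  · classical
    unfold update
    exact hM.tri.nodup.filter _
  · rw [mem_update_nodes_iff]
    refine ⟨fun h => h.2, fun h => ⟨?_, h⟩⟩
    obtain ⟨T, h, hv⟩ := h
    rcases (hA.mem_update_iff hk hT).mp h with ⟨g1, -⟩ | ⟨P, hP, hPA, g1, g2⟩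
    · exact (hM.tri.mem_nodes v).mpr ⟨T, g1, hv⟩
    · rw [g1.range_eq] at hv
      obtain ⟨i, rfl⟩ := hv
      exact hk.vertex_mem_nodes_of_kids hM (hA.of_mem hk hT hP hPA).1 i

lemma mem_openSegment_cases {a b v : Plane} (hv : v ∈ openSegment ℝ a b) :
    v = midpoint ℝ a b ∨ v ∈ openSegment ℝ a (midpoint ℝ a b) ∨
      v ∈ openSegment ℝ (midpoint ℝ a b) b := by
  obtain ⟨t, h0, h1, rfl⟩ := mem_openSegment_iff.mp hv
  rcases lt_trichotomy t (1 / 2) with h | h | h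
  · refine Or.inr (Or.inl (mem_openSegment_iff.mpr ⟨2 * t, by linarith, by linarith, ?_⟩))
    apply plane_ext <;> simp only [lineMap_coord, midpoint_coord] <;> ring
  · left
    rw [h]
    apply plane_ext <;> simp only [lineMap_coord, midpoint_coord] <;> ring
  · refine Or.inr (Or.inr (mem_openSegment_iff.mpr ⟨2 * t - 1, by linarith, by linarith, ?_⟩))
    apply plane_ext <;> simp only [lineMap_coord, midpoint_coord] <;> ring

/-- If no element of the removed quartets has an irregular edge, then the midpoint of an edge of a
parent is the only node that can hang on this edge. -/
lemma AreQuartets.isOneIrregular (hA : AreQuartets kids M₀ M pv A) (hk : RedSystem kids)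
    (hT : IsTriangulation R M₀) (h1 : IsOneIrregular M)
    (hreg : ∀ Q ∈ A, ∀ T ∈ Q, ¬ HasIrregularEdge M T) : IsOneIrregular (update M pv A) := by
  intro T h i v hv w hw
  have hv' := (mem_update_nodes_iff.mp hv.1).1
  have hw' := (mem_update_nodes_iff.mp hw.1).1
  rcases (hA.mem_update_iff hk hT).mp h with ⟨g1, -⟩ | ⟨P, hP, hPA, g1, g2⟩
  · exact h1 T g1 i ⟨hv', hv.2⟩ ⟨hw', hw.2⟩
  obtain ⟨j, e1, e2⟩ := g1.edge_eq i
  have key : ∀ v ∈ M.nodes, v ∈ openSegment ℝ (T i) (T (i + 1)) →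
      v = midpoint ℝ (P j) (P (j + 1)) := by
    intro v hv hvs
    rw [e1, e2] at hvs
    obtain ⟨⟨K, hK, k, f1, f2⟩, K', hK', k', f1', f2'⟩ := hk.exists_half P j
    rcases mem_openSegment_cases hvs with h | h | h
    · exact h
    · exact absurd ⟨k, v, hv, by rwa [f1, f2]⟩ (hreg _ hPA K hK)
    · exact absurd ⟨k', v, hv, by rwa [f1', f2']⟩ (hreg _ hPA K' hK')
  rw [key v hv' hv.2, key w hw' hw.2]

lemma AreQuartets.refined_of_update (hA : AreQuartets kids M₀ M pv A) (hk : RedSystem kids)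
    (hT : IsTriangulation R M₀) (h : HasBeenRefined kids M₀ (update M pv A) K) :
    HasBeenRefined kids M₀ M K := by
  obtain ⟨hK, S, hS, hSK⟩ := h
  rcases (hA.mem_update_iff hk hT).mp hS with ⟨g1, -⟩ | ⟨P, hP, hPA, g1, g2⟩
  · exact ⟨hK, S, g1, hSK⟩
  · obtain ⟨L, hL, -⟩ := hk.exists_kid_vertex P 0
    rw [g1.hull_eq] at hSK
    exact ⟨hK, L, (hA.of_mem hk hT hP hPA).1 hL,
      (hk.kid_subset (hk.forest_convex hT hP) hL).trans_ssubset hSK⟩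

/-- The condition for the weight `2` of a node of a quartet. -/
def IsHeavy (M : Mesh n) (pv : Quartet n → Finset Plane) (A : Finset (Quartet n)) (Q : Quartet n)
    (v : Plane) : Prop :=
  IsHanging M v ∨ IsBoundary M v ∨ ∃ Q' ∈ A, Q' ≠ Q ∧ v ∈ quartetNodes Q' ∧ v ∉ pv Q'

omit [NeZero n] [Polygon n] in
lemma mem_quartetNodes {Q : Quartet n} {v : Plane} :
    v ∈ quartetNodes Q ↔ ∃ T ∈ Q, v ∈ range T := by
  classical
  unfold quartetNodes
  simp

/-- The geometric core of the Neighbor Rules: if the midpoint of an edge of the parent `P` of a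
removed quartet is hanging, on the boundary, or a new node of another removed quartet, then the
neighbor of `P` across this edge is not refined in the coarsened mesh. -/
lemma AreQuartets.not_refined_of_heavy (hA : AreQuartets kids M₀ M pv A) (hk : RedSystem kids)
    (hT : IsTriangulation R M₀) (hM : IsReached kids R M₀ M) (hP : P ∈ forest kids M₀)
    (hPA : kids P ∈ A) (hK : K ∈ forest kids M₀) (hne : P ≠ K) {i j : Fin n}
    (he : edge P i = edge K j)
    (hheavy : IsHeavy M pv A (kids P) (midpoint ℝ (P i) (P (i + 1)))) :
    ¬ HasBeenRefined kids M₀ (update M pv A) K := by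
  intro hr
  have hrM := hA.refined_of_update hk hT hr
  have cP := hk.forest_convex hT hP
  have cK := hk.forest_convex hT hK
  have hPM := (hA.of_mem hk hT hP hPA).1
  have hopen := midpoint_mem_openSegment (P i) (P (i + 1))
  obtain ⟨KP, hKP, hmKP⟩ := hk.exists_kid_midpoint P i
  obtain ⟨KK, hKK, hmKK⟩ : ∃ L ∈ kids K, midpoint ℝ (P i) (P (i + 1)) ∈ range L := by
    have := hk.exists_kid_midpoint K j
    rcases Sym2.eq_iff.mp he with ⟨e1, e2⟩ | ⟨e1, e2⟩
    · rwa [e1, e2]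
    · rwa [e1, e2, midpoint_comm]
  generalize hmdef : midpoint ℝ (P i) (P (i + 1)) = m at *
  -- an element of `M` that contains `m` is a child of `P` or a proper descendant of `K`
  have hloc : ∀ L ∈ M.elements, m ∈ hull L → L ∈ kids P ∨ (Desc kids K L ∧ L ≠ K) := by
    intro L hL hmL
    have hLf := hM.mem_forest L hL
    rcases hk.comparable_of_mem_edge hT hP hK hne he hopen hLf hmL with h | h | h
    · exact Or.inl (hk.mem_kids_of_comparable hT hM hP hPM hL h)
    · refine Or.inr ⟨h, ?_⟩
      rintro rfl
      exact hk.not_desc_of_refined hT hM hrM hL Relation.ReflTransGen.refl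
    · exact absurd h (hk.not_desc_of_refined hT hM hrM hL)
  rcases hheavy with ⟨-, L, hL, hmL, hmnL⟩ | ⟨-, hmb⟩ | ⟨Q', hQ', hQne, hmQ, hmpv⟩
  · have hmL' : m ∈ hull L := by
      rw [← (isClosed_hull L).closure_eq]; exact frontier_subset_closure hmL
    rcases hloc L hL hmL' with h | ⟨h, hLK⟩
    · exact hmnL (hk.vertex_of_sibling cP hKP h hmKP hmL')
    · exact hmnL (hk.desc_new_vertex cK h hLK hKK hmKK hmL')
  · rw [hM.tri.cover] at hmb
    have hsub : ∀ X ∈ forest kids M₀, hull X ⊆ R := by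
      rintro X ⟨T, hTM, h⟩
      refine (hk.desc_subset (hT.convexCCW T hTM) h).trans ?_
      rw [← hT.cover]
      exact subset_biUnion_of_mem (u := fun T => hull T) (Finset.mem_coe.mpr hTM)
    have hn := hull_union_mem_nhds cP cK (hk.disjoint_of_edge hT hP hK hne he) he hopen
    exact hmb.2 (mem_interior_iff_mem_nhds.mpr
      (mem_of_superset hn (union_subset (hsub P hP) (hsub K hK))))
  · obtain ⟨P', hP', rfl, hPM', hpv⟩ := hA Q' hQ'
    have cP' := hk.forest_convex hT hP'
    rw [hpv] at hmpv
    obtain ⟨L, hL, hmL⟩ := mem_quartetNodes.mp hmQ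
    have hmL' : m ∈ hull L := by obtain ⟨k, rfl⟩ := hmL; exact vertex_mem_hull L k
    rcases hloc L (hPM' hL) hmL' with h | ⟨h, hLK⟩
    · exact hQne (by rw [hk.parent_unique hT hP' hP hL h])
    · have hKP' := hk.desc_parent hT hP' hL hK h hLK
      by_cases hPK : P' = K
      · -- `K` itself is an element of the coarsened mesh
        subst hPK
        obtain ⟨K', g1, g2⟩ := exists_oldest_rotation M P'
        have hK'M := (hA.mem_update_iff hk hT (T := K')).mpr (Or.inr ⟨P', hP', hQ', g1, g2⟩)
        have htri := hA.isTriangulation hk hT hM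
        obtain ⟨-, S, hS, hSK⟩ := hr
        rw [← g1.hull_eq] at hSK
        refine not_disjoint_of_subset (htri.convexCCW S hS) hSK.1 (htri.disjoint K' hK'M S hS ?_)
        rintro rfl
        exact hSK.2 Subset.rfl
      · exact hmpv (hk.desc_new_vertex cK hKP' hPK hKK hmKK (hk.kid_subset cP' hL hmL'))

/-- The `d`-Neighbor Rule is preserved if every removed quartet has fewer than `d` edges of its
parent with a midpoint that is not heavy. -/
lemma AreQuartets.neighborRule (hA : AreQuartets kids M₀ M pv A) (hk : RedSystem kids)
    (hT : IsTriangulation R M₀) (hM : IsReached kids R M₀ M) {d : ℕ}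
    (hd : ∀ P ∈ forest kids M₀, kids P ∈ A →
      {i | ¬ IsHeavy M pv A (kids P) (midpoint ℝ (P i) (P (i + 1)))}.encard < d)
    (hr : NeighborRule kids M₀ d M) : NeighborRule kids M₀ d (update M pv A) := by
  intro T h
  rcases (hA.mem_update_iff hk hT).mp h with ⟨g1, -⟩ | ⟨P, hP, hPA, g1, g2⟩
  · refine lt_of_le_of_lt (encard_le_encard ?_) (hr T g1)
    exact fun K hK => ⟨hK.1, hA.refined_of_update hk hT hK.2⟩
  refine lt_of_le_of_lt ?_ (hd P hP hPA)
  have hex : ∀ K, (IsNeighbor T K ∧ HasBeenRefined kids M₀ (update M pv A) K) →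
      P ≠ K ∧ ∃ i j, edge P i = edge K j := by
    rintro K ⟨⟨h1, i, j, h2⟩, -⟩
    obtain ⟨k, e1, e2⟩ := g1.edge_eq i
    refine ⟨?_, k, j, ?_⟩
    · rintro rfl; exact h1 g1.hull_eq.symm
    · rw [← h2]; unfold edge; rw [e1, e2]
  classical
  let f : Elem n → Fin n := fun K => if hK : ∃ i j, edge P i = edge K j then hK.choose else 0
  have hf : ∀ K, (∃ i j, edge P i = edge K j) → ∃ j, edge P (f K) = edge K j := by
    intro K hK
    simp only [f, dif_pos hK]
    exact hK.choose_spec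
  refine encard_le_encard_of_injOn (f := f) ?_ ?_
  · intro K hK
    obtain ⟨h1, h2⟩ := hex K hK
    obtain ⟨j, hj⟩ := hf K h2
    exact fun hh => hA.not_refined_of_heavy hk hT hM hP hPA hK.2.1 h1 hj hh hK.2
  · intro K hK K' hK' hKK
    obtain ⟨h1, h2⟩ := hex K hK
    obtain ⟨h1', h2'⟩ := hex K' hK'
    obtain ⟨j, hj⟩ := hf K h2
    obtain ⟨j', hj'⟩ := hf K' h2'
    rw [← hKK] at hj'
    exact hk.neighbor_unique hT hP hK.2.1 hK'.2.1 h1 h1' hj hj'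

end Update

/-! ### Half-plane descriptions of triangles and quadrilaterals -/

lemma cross_combo (a b x y : Plane) {s t : ℝ} (h : s + t = 1) :
    cross a b (s • x + t • y) = s * cross a b x + t * cross a b y := by
  obtain rfl : t = 1 - s := by linarith
  unfold cross; simp; ring

lemma hull_subset_halfPlane {n : ℕ} {T : Elem n} {a b : Plane} (h : ∀ i, 0 ≤ cross a b (T i))
    {x : Plane} (hx : x ∈ hull T) : 0 ≤ cross a b x := by
  have hc : Convex ℝ {x : Plane | 0 ≤ cross a b x} := by
    intro x hx y hy s t hs ht hst
    change 0 ≤ cross a b (s • x + t • y)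
    rw [cross_combo _ _ _ _ hst]
    exact add_nonneg (mul_nonneg hs hx) (mul_nonneg ht hy)
  have hsub : hull T ⊆ {x : Plane | 0 ≤ cross a b x} :=
    convexHull_min (range_subset_iff.mpr h) hc
  exact hsub hx

/-- A convex set that contains the vertices of a triangle contains the triangle. -/
lemma mem_of_triangle {s : Set Plane} (hs : Convex ℝ s) {a b c x : Plane} (ha : a ∈ s)
    (hb : b ∈ s) (hc : c ∈ s) (hpos : 0 < cross a b c) (h1 : 0 ≤ cross a b x)
    (h2 : 0 ≤ cross b c x) (h3 : 0 ≤ cross c a x) : x ∈ s := by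
  have hsum : cross b c x + cross c a x + cross a b x = cross a b c := by unfold cross; ring
  have hx : x = ∑ i : Fin 3, (![cross b c x / cross a b c, cross c a x / cross a b c,
      cross a b x / cross a b c] i) • (![a, b, c] i) := by
    simp only [Fin.sum_univ_three, Matrix.cons_val_zero, Matrix.cons_val_one, Matrix.cons_val]
    have hne := hpos.ne'
    apply plane_ext
    · simp only [PiLp.add_apply, PiLp.smul_apply, smul_eq_mul]
      field_simp
      unfold cross; ring
    · simp only [PiLp.add_apply, PiLp.smul_apply, smul_eq_mul]
      field_simp
      unfold cross; ring
  rw [hx]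
  refine hs.sum_mem ?_ ?_ ?_
  · intro i _
    fin_cases i <;> simp <;> positivity
  · simp only [Fin.sum_univ_three, Matrix.cons_val_zero, Matrix.cons_val_one, Matrix.cons_val]
    rw [← add_div, ← add_div, hsum, div_self hpos.ne']
  · intro i _
    fin_cases i <;> simpa

instance : Polygon 3 := by
  have hpos : ∀ {T : Elem 3}, IsConvexCCW T → ∀ i j, j ≠ i → j ≠ i + 1 →
      0 < cross (T i) (T (i + 1)) (T j) := by
    intro T hT i j h1 h2
    have : j = i + 2 := by revert i j; decide
    rw [this]
    exact hT i
  refine ⟨fun {T} hT x => ⟨fun hx i => hull_subset_halfPlane (fun j => ?_) hx, fun h => ?_⟩, hpos⟩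
  · by_cases h1 : j = i
    · rw [h1, cross_left]
    by_cases h2 : j = i + 1
    · rw [h2, cross_right]
    exact (hpos hT i j h1 h2).le
  · exact mem_of_triangle (convex_hull T) (vertex_mem_hull T 0) (vertex_mem_hull T 1)
      (vertex_mem_hull T 2) (hT 0) (h 0) (h 1) (h 2)

instance : Polygon 4 := by
  have hpos : ∀ {T : Elem 4}, IsConvexCCW T → ∀ i j, j ≠ i → j ≠ i + 1 →
      0 < cross (T i) (T (i + 1)) (T j) := by
    intro T hT i j h1 h2
    have : j = i + 2 ∨ j = i + 3 := by revert i j; decide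
    rcases this with rfl | rfl
    · exact hT i
    · have := hT (i + 3)
      rw [show i + 3 + 1 = i by clear * -; revert i; decide,
        show i + 3 + 2 = i + 1 by clear * -; revert i; decide] at this
      rwa [cross_rotate]
  refine ⟨fun {T} hT x => ⟨fun hx i => hull_subset_halfPlane (fun j => ?_) hx, fun h => ?_⟩, hpos⟩
  · by_cases h1 : j = i
    · rw [h1, cross_left]
    by_cases h2 : j = i + 1
    · rw [h2, cross_right]
    exact (hpos hT i j h1 h2).le
  · -- the diagonal from `T 0` to `T 2` splits the quadrilateral into two triangles
    have c1 : 0 < cross (T 0) (T 1) (T 2) := hT 0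
    have c2 : 0 < cross (T 0) (T 2) (T 3) := by
      have : 0 < cross (T 2) (T 3) (T 0) := hT 2
      rw [← cross_rotate]; exact this
    rcases le_total 0 (cross (T 0) (T 2) x) with hx | hx
    · exact mem_of_triangle (convex_hull T) (vertex_mem_hull T 0) (vertex_mem_hull T 2)
        (vertex_mem_hull T 3) c2 hx (h 2) (h 3)
    · refine mem_of_triangle (convex_hull T) (vertex_mem_hull T 0) (vertex_mem_hull T 1)
        (vertex_mem_hull T 2) c1 (h 0) (h 1) ?_
      rw [cross_swap]; linarith

/-! ### Red refinement of triangles -/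

/-- The middle triangle of the red refinement. -/
noncomputable def triMid (X : Elem 3) : Elem 3 :=
  ![midpoint ℝ (X 0) (X 1), midpoint ℝ (X 1) (X 2), midpoint ℝ (X 2) (X 0)]

/-- The triangle of the red refinement at the `k`-th vertex. -/
noncomputable def triCorner (X : Elem 3) (k : Fin 3) : Elem 3 :=
  ![X k, midpoint ℝ (X k) (X (k + 1)), midpoint ℝ (X (k + 2)) (X k)]

lemma mem_triKids {X K : Elem 3} : K ∈ triKids X ↔ K = triMid X ∨ ∃ k, K = triCorner X k := by
  classical
  unfold triKids triMid triCorner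
  simp [eq_comm]

lemma triMid_apply (X : Elem 3) (i : Fin 3) : triMid X i = midpoint ℝ (X i) (X (i + 1)) := by
  fin_cases i <;> rfl

@[simp] lemma triCorner_zero (X : Elem 3) (k : Fin 3) : triCorner X k 0 = X k := rfl

@[simp] lemma triCorner_one (X : Elem 3) (k : Fin 3) :
    triCorner X k 1 = midpoint ℝ (X k) (X (k + 1)) := rfl

@[simp] lemma triCorner_two (X : Elem 3) (k : Fin 3) :
    triCorner X k 2 = midpoint ℝ (X (k + 2)) (X k) := rfl

lemma fin_three_cases (k i : Fin 3) : i = k ∨ i = k + 1 ∨ i = k + 2 := by revert k i; decide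

lemma fin_three_forall {p : Fin 3 → Prop} : (∀ i, p i) ↔ p 0 ∧ p 1 ∧ p 2 :=
  ⟨fun h => ⟨h 0, h 1, h 2⟩, fun ⟨h0, h1, h2⟩ i => by fin_cases i <;> assumption⟩

lemma fin_three_add (k : Fin 3) : k + 1 + 1 = k + 2 ∧ k + 1 + 2 = k ∧ k + 2 + 1 = k ∧
    k + 2 + 2 = k + 1 := by revert k; decide

/-- Twice the area of the triangle. -/
noncomputable def triArea (X : Elem 3) : ℝ := cross (X 0) (X 1) (X 2)

/-- The barycentric coordinate with respect to the `k`-th vertex, multiplied by `triArea X`. -/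
noncomputable def bary (X : Elem 3) (k : Fin 3) (x : Plane) : ℝ := cross (X (k + 1)) (X (k + 2)) x

lemma triArea_eq (X : Elem 3) (k : Fin 3) : cross (X k) (X (k + 1)) (X (k + 2)) = triArea X := by
  fin_cases k
  · rfl
  · exact cross_rotate (X 0) (X 1) (X 2)
  · change cross (X 2) (X 0) (X 1) = cross (X 0) (X 1) (X 2)
    rw [cross_rotate, cross_rotate]

lemma bary_sum (X : Elem 3) (k : Fin 3) (x : Plane) :
    bary X k x + bary X (k + 1) x + bary X (k + 2) x = triArea X := by
  rw [← triArea_eq X k]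
  unfold bary
  obtain ⟨e1, e2, e3, e4⟩ := fin_three_add k
  rw [e1, e2, e3, e4]
  unfold cross; ring

lemma bary_self (X : Elem 3) (k : Fin 3) : bary X k (X k) = triArea X := by
  rw [← triArea_eq X k]; unfold bary cross; ring

lemma bary_one (X : Elem 3) (k : Fin 3) : bary X k (X (k + 1)) = 0 := by
  unfold bary; simp

lemma bary_two (X : Elem 3) (k : Fin 3) : bary X k (X (k + 2)) = 0 := by
  unfold bary; simp

lemma bary_midpoint (X : Elem 3) (k : Fin 3) (x y : Plane) :
    bary X k (midpoint ℝ x y) = (bary X k x + bary X k y) / 2 := cross_midpoint _ _ _ _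

lemma bary_lineMap (X : Elem 3) (k : Fin 3) (x y : Plane) (t : ℝ) :
    bary X k (AffineMap.lineMap x y t) = (1 - t) * bary X k x + t * bary X k y :=
  cross_lineMap _ _ _ _ _

lemma IsConvexCCW.triArea_pos {X : Elem 3} (hX : IsConvexCCW X) : 0 < triArea X := hX 0

lemma triCorner_cross (X : Elem 3) (k : Fin 3) (x : Plane) :
    cross (triCorner X k 0) (triCorner X k 1) x = bary X (k + 2) x / 2 ∧
    cross (triCorner X k 1) (triCorner X k 2) x = (2 * bary X k x - triArea X) / 4 ∧
    cross (triCorner X k 2) (triCorner X k 0) x = bary X (k + 1) x / 2 := by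
  rw [← triArea_eq X k]
  unfold bary
  obtain ⟨e1, e2, e3, e4⟩ := fin_three_add k
  rw [e1, e2, e3, e4]
  simp only [triCorner_zero, triCorner_one, triCorner_two]
  refine ⟨?_, ?_, ?_⟩ <;> unfold cross <;> simp only [midpoint_coord] <;> ring

lemma triMid_cross (X : Elem 3) (k : Fin 3) (x : Plane) :
    cross (triMid X k) (triMid X (k + 1)) x = (triArea X - 2 * bary X (k + 1) x) / 4 := by
  rw [← triArea_eq X k]
  unfold bary
  obtain ⟨e1, e2, e3, e4⟩ := fin_three_add k
  rw [triMid_apply, triMid_apply, e1, e2]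
  unfold cross; simp only [midpoint_coord]; ring

lemma triCorner_area (X : Elem 3) (k : Fin 3) : triArea (triCorner X k) = triArea X / 4 := by
  have := (triCorner_cross X k (triCorner X k 2)).1
  unfold triArea at this ⊢
  rw [this, triCorner_two, bary_midpoint, bary_self]
  have h := bary_one X (k + 2)
  rw [(fin_three_add k).2.2.1] at h
  rw [h]
  unfold triArea; ring

lemma triMid_area (X : Elem 3) : triArea (triMid X) = triArea X / 4 := by
  unfold triArea triMid cross
  simp only [Matrix.cons_val_zero, Matrix.cons_val_one, Matrix.cons_val, midpoint_coord]
  ring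

lemma isConvexCCW_three {X : Elem 3} : IsConvexCCW X ↔ 0 < triArea X := by
  constructor
  · exact fun h => h.triArea_pos
  · intro h k
    rwa [triArea_eq]

lemma triKids_area {X K : Elem 3} (hK : K ∈ triKids X) : triArea K = triArea X / 4 := by
  rcases mem_triKids.mp hK with rfl | ⟨k, rfl⟩
  · exact triMid_area X
  · exact triCorner_area X k

lemma triKids_convex {X K : Elem 3} (hX : IsConvexCCW X) (hK : K ∈ triKids X) : IsConvexCCW K := by
  rw [isConvexCCW_three] at hX ⊢
  rw [triKids_area hK]
  positivity

lemma triMid_mem (X : Elem 3) : triMid X ∈ triKids X := mem_triKids.mpr (Or.inl rfl)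

lemma triCorner_mem (X : Elem 3) (k : Fin 3) : triCorner X k ∈ triKids X :=
  mem_triKids.mpr (Or.inr ⟨k, rfl⟩)

lemma mem_triCorner_iff {X : Elem 3} (hX : IsConvexCCW X) (k : Fin 3) (x : Plane) :
    x ∈ hull (triCorner X k) ↔
      0 ≤ bary X (k + 2) x ∧ triArea X ≤ 2 * bary X k x ∧ 0 ≤ bary X (k + 1) x := by
  rw [Polygon.mem_hull_iff (triKids_convex hX (triCorner_mem X k)), fin_three_forall]
  obtain ⟨h0, h1, h2⟩ := triCorner_cross X k x
  change 0 ≤ cross (triCorner X k 0) (triCorner X k 1) x ∧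
    0 ≤ cross (triCorner X k 1) (triCorner X k 2) x ∧
    0 ≤ cross (triCorner X k 2) (triCorner X k 0) x ↔ _
  rw [h0, h1, h2]
  constructor <;> rintro ⟨a, b, c⟩ <;> refine ⟨?_, ?_, ?_⟩ <;> linarith

lemma mem_interior_triCorner {X : Elem 3} (hX : IsConvexCCW X) (k : Fin 3) {x : Plane}
    (hx : x ∈ interior (hull (triCorner X k))) :
    0 < bary X (k + 2) x ∧ triArea X < 2 * bary X k x ∧ 0 < bary X (k + 1) x := by
  rw [mem_interior_hull_iff (triKids_convex hX (triCorner_mem X k)), fin_three_forall] at hx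
  obtain ⟨h0, h1, h2⟩ := triCorner_cross X k x
  change 0 < cross (triCorner X k 0) (triCorner X k 1) x ∧
    0 < cross (triCorner X k 1) (triCorner X k 2) x ∧
    0 < cross (triCorner X k 2) (triCorner X k 0) x at hx
  rw [h0, h1, h2] at hx
  obtain ⟨a, b, c⟩ := hx
  refine ⟨?_, ?_, ?_⟩ <;> linarith

lemma mem_triMid_iff {X : Elem 3} (hX : IsConvexCCW X) (x : Plane) :
    x ∈ hull (triMid X) ↔ ∀ k, 2 * bary X k x ≤ triArea X := by
  rw [Polygon.mem_hull_iff (triKids_convex hX (triMid_mem X))]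
  constructor
  · intro h k
    have := h (k + 2)
    rw [triMid_cross, (fin_three_add k).2.2.1] at this
    linarith
  · intro h k
    rw [triMid_cross]
    linarith [h (k + 1)]

lemma mem_interior_triMid {X : Elem 3} (hX : IsConvexCCW X) {x : Plane}
    (hx : x ∈ interior (hull (triMid X))) (k : Fin 3) : 2 * bary X k x < triArea X := by
  rw [mem_interior_hull_iff (triKids_convex hX (triMid_mem X))] at hx
  have := hx (k + 2)
  rw [triMid_cross, (fin_three_add k).2.2.1] at this
  linarith

lemma mem_tri_iff {X : Elem 3} (hX : IsConvexCCW X) (x : Plane) :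
    x ∈ hull X ↔ ∀ k, 0 ≤ bary X k x := by
  rw [Polygon.mem_hull_iff hX]
  constructor
  · intro h k
    have := h (k + 1)
    rwa [(fin_three_add k).1] at this
  · intro h k
    have := h (k + 2)
    unfold bary at this
    rwa [(fin_three_add k).2.2.1, (fin_three_add k).2.2.2] at this

lemma vertex_mem_triCorner {X : Elem 3} (hX : IsConvexCCW X) {k i : Fin 3}
    (h : X i ∈ hull (triCorner X k)) : i = k := by
  have h1 := ((mem_triCorner_iff hX k _).mp h).2.1
  have h2 := hX.triArea_pos
  rcases fin_three_cases k i with rfl | rfl | rfl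
  · rfl
  · rw [bary_one] at h1; linarith
  · rw [bary_two] at h1; linarith

lemma vertex_notMem_triMid {X : Elem 3} (hX : IsConvexCCW X) (i : Fin 3) :
    X i ∉ hull (triMid X) := by
  intro h
  have h1 := (mem_triMid_iff hX _).mp h i
  have h2 := hX.triArea_pos
  rw [bary_self] at h1
  linarith

lemma midpoint_mem_triCorner {X : Elem 3} (hX : IsConvexCCW X) {k i : Fin 3}
    (h : midpoint ℝ (X i) (X (i + 1)) ∈ hull (triCorner X k)) :
    midpoint ℝ (X i) (X (i + 1)) ∈ range (triCorner X k) := by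
  have h1 := ((mem_triCorner_iff hX k _).mp h).2.1
  have h2 := hX.triArea_pos
  rcases fin_three_cases k i with rfl | rfl | rfl
  · exact ⟨1, rfl⟩
  · rw [bary_midpoint, bary_one, (fin_three_add k).1, bary_two] at h1; linarith
  · rw [(fin_three_add k).2.2.1]; exact ⟨2, rfl⟩

lemma triCorner_vertex {X : Elem 3} {k : Fin 3} {v : Plane} (hv : v ∈ range (triCorner X k)) :
    v = X k ∨ ∃ i, v = midpoint ℝ (X i) (X (i + 1)) := by
  obtain ⟨j, rfl⟩ := hv
  fin_cases j
  · exact Or.inl rfl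
  · exact Or.inr ⟨k, rfl⟩
  · exact Or.inr ⟨k + 2, by rw [(fin_three_add k).2.2.1]; rfl⟩

lemma triKids_vertex {X K : Elem 3} {v : Plane} (hK : K ∈ triKids X) (hv : v ∈ range K) :
    v ∈ range X ∨ ∃ i, v = midpoint ℝ (X i) (X (i + 1)) := by
  rcases mem_triKids.mp hK with rfl | ⟨k, rfl⟩
  · obtain ⟨i, rfl⟩ := hv
    exact Or.inr ⟨i, triMid_apply X i⟩
  · rcases triCorner_vertex hv with h | h
    · exact Or.inl ⟨k, h.symm⟩
    · exact Or.inr h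

lemma redSystem_triKids : RedSystem triKids := by
  refine ⟨fun hX hK => triKids_convex hX hK, fun {X} hX => ?_, fun {X K K'} hX hK hK' hne => ?_,
    fun {X K v} hX hK hv h => ?_, fun {X K K' v} hX hK hK' hv h => ?_,
    fun {X K i p q} hX hK hpq hp hq hpK hqK => ?_,
    fun {X K v} hX hK hv => (triKids_vertex hK hv).imp_right Or.inl, fun {X K} hX hK j => ?_,
    fun {X K i j} hX hK hi hj => ?_, fun X i => ⟨?_, ?_⟩⟩
  · apply Subset.antisymm
    · intro x hx
      rw [mem_tri_iff hX] at hx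
      simp only [mem_iUnion]
      by_cases h : ∃ k, triArea X ≤ 2 * bary X k x
      · obtain ⟨k, hk⟩ := h
        exact ⟨_, triCorner_mem X k, (mem_triCorner_iff hX k x).mpr ⟨hx _, hk, hx _⟩⟩
      · push Not at h
        exact ⟨_, triMid_mem X, (mem_triMid_iff hX x).mpr fun k => (h k).le⟩
    · refine iUnion₂_subset fun K hK => hull_subset_hull fun i => ?_
      rcases triKids_vertex hK (mem_range_self i) with ⟨j, h⟩ | ⟨j, h⟩
      · rw [← h]; exact vertex_mem_hull X j
      · rw [h]; exact midpoint_mem_hull X j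
  · rw [disjoint_left]
    intro x hx hx'
    rcases mem_triKids.mp hK with rfl | ⟨k, rfl⟩ <;> rcases mem_triKids.mp hK' with rfl | ⟨k', rfl⟩
    · exact hne rfl
    · have h1 := mem_interior_triMid hX hx k'
      have h2 := (mem_interior_triCorner hX k' hx').2.1
      linarith
    · have h1 := mem_interior_triMid hX hx' k
      have h2 := (mem_interior_triCorner hX k hx).2.1
      linarith
    · obtain ⟨a1, a2, a3⟩ := mem_interior_triCorner hX k hx
      obtain ⟨b1, b2, b3⟩ := mem_interior_triCorner hX k' hx'
      have h2 := bary_sum X k x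
      rcases fin_three_cases k k' with rfl | rfl | rfl
      · exact hne rfl
      · linarith
      · linarith
  · obtain ⟨i, rfl⟩ := hv
    rcases mem_triKids.mp hK with rfl | ⟨k, rfl⟩
    · exact absurd h (vertex_notMem_triMid hX i)
    · rw [vertex_mem_triCorner hX h]; exact ⟨0, rfl⟩
  · have hmid : ∀ i, midpoint ℝ (X i) (X (i + 1)) ∈ hull K' →
        midpoint ℝ (X i) (X (i + 1)) ∈ range K' := by
      intro i hi
      rcases mem_triKids.mp hK' with rfl | ⟨k, rfl⟩
      · exact ⟨i, triMid_apply X i⟩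
      · exact midpoint_mem_triCorner hX hi
    rcases triKids_vertex hK hv with ⟨i, rfl⟩ | ⟨i, rfl⟩
    · rcases mem_triKids.mp hK' with rfl | ⟨k, rfl⟩
      · exact absurd h (vertex_notMem_triMid hX i)
      · rw [vertex_mem_triCorner hX h]; exact ⟨0, rfl⟩
    · exact hmid i h
  · obtain ⟨s, s0, s1, rfl⟩ := mem_segment_iff.mp hp
    obtain ⟨t, t0, t1, rfl⟩ := mem_segment_iff.mp hq
    have hpos := hX.triArea_pos
    rcases mem_triKids.mp hK with rfl | ⟨k, rfl⟩
    · exfalso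
      apply hpq
      have key : ∀ r : ℝ, (AffineMap.lineMap (X i) (X (i + 1)) r : Plane) ∈ hull (triMid X) →
          r = 1 / 2 := by
        intro r hr
        rw [mem_triMid_iff hX] at hr
        have h1 := hr i
        have h2 := hr (i + 1)
        have h3 := bary_two X (i + 1)
        rw [(fin_three_add i).2.1] at h3
        rw [bary_lineMap, bary_self, bary_one] at h1
        rw [bary_lineMap, bary_self, h3] at h2
        apply le_antisymm
        · by_contra hlt; nlinarith
        · by_contra hlt; nlinarith
      rw [key s hpK, key t hqK]
    · rcases fin_three_cases k i with rfl | rfl | rfl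
      · have key : ∀ r : ℝ, (AffineMap.lineMap (X i) (X (i + 1)) r : Plane) ∈
            hull (triCorner X i) → r ≤ 1 / 2 := by
          intro r hr
          have h1 := ((mem_triCorner_iff hX i _).mp hr).2.1
          rw [bary_lineMap, bary_self, bary_one] at h1
          by_contra hlt; nlinarith
        exact ⟨0, halfOf_left _ _, lineMap_mem_segment_midpoint s0 (key s hpK),
          lineMap_mem_segment_midpoint t0 (key t hqK)⟩
      · exfalso
        have h1 := ((mem_triCorner_iff hX k _).mp hpK).2.1
        rw [bary_lineMap, bary_one, (fin_three_add k).1, bary_two] at h1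
        linarith
      · rw [(fin_three_add k).2.2.1] at *
        have key : ∀ r : ℝ, (AffineMap.lineMap (X (k + 2)) (X k) r : Plane) ∈
            hull (triCorner X k) → 1 / 2 ≤ r := by
          intro r hr
          have h1 := ((mem_triCorner_iff hX k _).mp hr).2.1
          rw [bary_lineMap, bary_self, bary_two] at h1
          by_contra hlt; nlinarith
        refine ⟨2, ?_, lineMap_mem_segment_midpoint' (key s hpK) s1,
          lineMap_mem_segment_midpoint' (key t hqK) t1⟩
        have := halfOf_right (X (k + 2)) (X k)
        unfold edge
        rw [(fin_three_add k).2.2.1]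
        exact this
  · rcases mem_triKids.mp hK with rfl | ⟨k, rfl⟩
    · refine Or.inr ⟨triCorner X (j + 1), triCorner_mem X _, 1, ?_, ?_⟩
      · rw [triMid_apply]; rfl
      · change triCorner X (j + 1) 2 = _
        rw [triMid_apply, triCorner_two, (fin_three_add j).2.1]
    · obtain ⟨e1, e2, e3, e4⟩ := fin_three_add k
      fin_cases j
      · exact Or.inl ⟨k, halfOf_left _ _⟩
      · refine Or.inr ⟨triMid X, triMid_mem X, k + 2, ?_, ?_⟩
        · rw [triMid_apply, e3]; rfl
        · rw [triMid_apply, e3]; rfl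
      · refine Or.inl ⟨k + 2, ?_⟩
        have := halfOf_right (X (k + 2)) (X k)
        unfold edge
        rw [e3]
        exact this
  · rcases mem_triKids.mp hK with rfl | ⟨k, rfl⟩
    · exact absurd hi (vertex_notMem_triMid hX i)
    · rw [vertex_mem_triCorner hX hi, vertex_mem_triCorner hX hj]
  · exact ⟨_, triCorner_mem X i, 0, rfl, rfl⟩
  · refine ⟨_, triCorner_mem X (i + 1), 2, ?_, rfl⟩
    rw [triCorner_two, (fin_three_add i).2.1]

/-! ### Red refinement of quadrilaterals -/

/-- The quadrilateral of the red refinement at the `k`-th vertex. -/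
noncomputable def quadKid (X : Elem 4) (k : Fin 4) : Elem 4 :=
  ![X k, midpoint ℝ (X k) (X (k + 1)), quadCenter X, midpoint ℝ (X (k + 3)) (X k)]

lemma mem_quadKids {X K : Elem 4} : K ∈ quadKids X ↔ ∃ k, K = quadKid X k := by
  classical
  unfold quadKids quadKid
  simp [eq_comm]

lemma quadKid_mem (X : Elem 4) (k : Fin 4) : quadKid X k ∈ quadKids X := mem_quadKids.mpr ⟨k, rfl⟩

@[simp] lemma quadKid_zero (X : Elem 4) (k : Fin 4) : quadKid X k 0 = X k := rfl

@[simp] lemma quadKid_one (X : Elem 4) (k : Fin 4) :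
    quadKid X k 1 = midpoint ℝ (X k) (X (k + 1)) := rfl

@[simp] lemma quadKid_two (X : Elem 4) (k : Fin 4) : quadKid X k 2 = quadCenter X := rfl

@[simp] lemma quadKid_three (X : Elem 4) (k : Fin 4) :
    quadKid X k 3 = midpoint ℝ (X (k + 3)) (X k) := rfl

lemma fin_four_cases (k i : Fin 4) : i = k ∨ i = k + 1 ∨ i = k + 2 ∨ i = k + 3 := by
  revert k i; decide

lemma fin_four_forall {p : Fin 4 → Prop} : (∀ i, p i) ↔ p 0 ∧ p 1 ∧ p 2 ∧ p 3 :=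
  ⟨fun h => ⟨h 0, h 1, h 2, h 3⟩, fun ⟨h0, h1, h2, h3⟩ i => by fin_cases i <;> assumption⟩

lemma fin_four_add (k : Fin 4) : k + 1 + 1 = k + 2 ∧ k + 1 + 2 = k + 3 ∧ k + 1 + 3 = k ∧
    k + 2 + 1 = k + 3 ∧ k + 2 + 2 = k ∧ k + 2 + 3 = k + 1 ∧ k + 3 + 1 = k ∧ k + 3 + 2 = k + 1 ∧
    k + 3 + 3 = k + 2 := by revert k; decide

lemma quadCenter_coord (X : Elem 4) (k : Fin 4) (j : Fin 2) :
    quadCenter X j = (X k j + X (k + 1) j + X (k + 2) j + X (k + 3) j) / 4 := by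
  have : quadCenter X j = (X 0 j + X 1 j + X 2 j + X 3 j) / 4 := by
    unfold quadCenter; simp only [midpoint_coord]; ring
  rw [this]
  fin_cases k
  · rfl
  · change _ = (X 1 j + X 2 j + X 3 j + X 0 j) / 4; ring
  · change _ = (X 2 j + X 3 j + X 0 j + X 1 j) / 4; ring
  · change _ = (X 3 j + X 0 j + X 1 j + X 2 j) / 4; ring

/-- The side of `x` with respect to the line that joins the midpoint of the `k`-th edge to the
midpoint of the opposite edge. -/
noncomputable def midline (X : Elem 4) (k : Fin 4) (x : Plane) : ℝ :=
  cross (midpoint ℝ (X k) (X (k + 1))) (midpoint ℝ (X (k + 2)) (X (k + 3))) x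

lemma midline_two (X : Elem 4) (k : Fin 4) (x : Plane) : midline X (k + 2) x = -midline X k x := by
  obtain ⟨e1, e2, e3, e4, e5, e6, e7, e8, e9⟩ := fin_four_add k
  unfold midline
  rw [e4, e5, e6, cross_swap]

lemma midline_three (X : Elem 4) (k : Fin 4) (x : Plane) :
    midline X (k + 3) x = -midline X (k + 1) x := by
  rw [← midline_two, (fin_four_add k).2.1]

lemma midline_midpoint (X : Elem 4) (k : Fin 4) (x y : Plane) :
    midline X k (midpoint ℝ x y) = (midline X k x + midline X k y) / 2 := cross_midpoint _ _ _ _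

lemma midline_lineMap (X : Elem 4) (k : Fin 4) (x y : Plane) (t : ℝ) :
    midline X k (AffineMap.lineMap x y t) = (1 - t) * midline X k x + t * midline X k y :=
  cross_lineMap _ _ _ _ _

lemma midline_vertex_zero (X : Elem 4) (k : Fin 4) : midline X k (X k) =
    (cross (X k) (X (k + 1)) (X (k + 2)) + cross (X (k + 3)) (X k) (X (k + 1))) / 4 := by
  unfold midline cross; simp only [midpoint_coord]; ring

lemma midline_vertex_one (X : Elem 4) (k : Fin 4) : midline X k (X (k + 1)) = -midline X k (X k) := by
  unfold midline cross; simp only [midpoint_coord]; ring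

lemma midline_vertex_three (X : Elem 4) (k : Fin 4) : midline X k (X (k + 3)) =
    (cross (X (k + 2)) (X (k + 3)) (X k) + cross (X (k + 1)) (X (k + 2)) (X (k + 3))) / 4 := by
  unfold midline cross; simp only [midpoint_coord]; ring

lemma midline_vertex_two (X : Elem 4) (k : Fin 4) :
    midline X k (X (k + 2)) = -midline X k (X (k + 3)) := by
  unfold midline cross; simp only [midpoint_coord]; ring

lemma quadKid_cross (X : Elem 4) (k : Fin 4) (x : Plane) :
    cross (quadKid X k 0) (quadKid X k 1) x = cross (X k) (X (k + 1)) x / 2 ∧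
    cross (quadKid X k 1) (quadKid X k 2) x = midline X k x / 2 ∧
    cross (quadKid X k 2) (quadKid X k 3) x = midline X (k + 1) x / 2 ∧
    cross (quadKid X k 3) (quadKid X k 0) x = cross (X (k + 3)) (X k) x / 2 := by
  obtain ⟨e1, e2, e3, e4, e5, e6, e7, e8, e9⟩ := fin_four_add k
  unfold midline
  rw [e1, e2, e3]
  simp only [quadKid_zero, quadKid_one, quadKid_two, quadKid_three]
  refine ⟨?_, ?_, ?_, ?_⟩ <;> unfold cross <;> simp only [midpoint_coord, quadCenter_coord X k] <;>
    ring

/-- The areas spanned at the vertices of a child are averages of those of the parent, divided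
by `4`. -/
lemma quadKid_corner (X : Elem 4) {δ : ℝ}
    (h : ∀ i, δ ≤ cross (X i) (X (i + 1)) (X (i + 2))) (k j : Fin 4) :
    δ / 4 ≤ cross (quadKid X k j) (quadKid X k (j + 1)) (quadKid X k (j + 2)) := by
  obtain ⟨e1, e2, e3, e4, e5, e6, e7, e8, e9⟩ := fin_four_add k
  have h0 := h k
  have h1 := h (k + 1)
  have h2 := h (k + 2)
  have h3 := h (k + 3)
  rw [e1, e2] at h1
  rw [e4, e5] at h2
  rw [e7, e8] at h3
  have c0 : cross (quadKid X k 0) (quadKid X k 1) (quadKid X k 2) =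
      (cross (X k) (X (k + 1)) (X (k + 2)) + cross (X (k + 3)) (X k) (X (k + 1))) / 8 := by
    simp only [quadKid_zero, quadKid_one, quadKid_two]
    unfold cross; simp only [midpoint_coord, quadCenter_coord X k]; ring
  have c1 : cross (quadKid X k 1) (quadKid X k 2) (quadKid X k 3) =
      (cross (X k) (X (k + 1)) (X (k + 2)) + cross (X (k + 1)) (X (k + 2)) (X (k + 3)) +
      cross (X (k + 2)) (X (k + 3)) (X k) + cross (X (k + 3)) (X k) (X (k + 1))) / 16 := by
    simp only [quadKid_three, quadKid_one, quadKid_two]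
    unfold cross; simp only [midpoint_coord, quadCenter_coord X k]; ring
  have c2 : cross (quadKid X k 2) (quadKid X k 3) (quadKid X k 0) =
      (cross (X (k + 2)) (X (k + 3)) (X k) + cross (X (k + 3)) (X k) (X (k + 1))) / 8 := by
    simp only [quadKid_zero, quadKid_three, quadKid_two]
    unfold cross; simp only [midpoint_coord, quadCenter_coord X k]; ring
  have c3 : cross (quadKid X k 3) (quadKid X k 0) (quadKid X k 1) =
      cross (X (k + 3)) (X k) (X (k + 1)) / 4 := by
    simp only [quadKid_zero, quadKid_three, quadKid_one]
    unfold cross; simp only [midpoint_coord]; ring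
  fin_cases j
  · exact le_of_le_of_eq (by linarith) c0.symm
  · exact le_of_le_of_eq (by linarith) c1.symm
  · exact le_of_le_of_eq (by linarith) c2.symm
  · exact le_of_le_of_eq (by linarith) c3.symm

lemma exists_corner_bound {n : ℕ} [NeZero n] {X : Elem n} (hX : IsConvexCCW X) :
    ∃ δ : ℝ, 0 < δ ∧ ∀ i, δ ≤ cross (X i) (X (i + 1)) (X (i + 2)) := by
  obtain ⟨i, hi⟩ := Finite.exists_min fun i => cross (X i) (X (i + 1)) (X (i + 2))
  exact ⟨_, hX i, hi⟩

section

variable {X K : Elem 4}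

lemma quadKid_convex (hX : IsConvexCCW X) (k : Fin 4) : IsConvexCCW (quadKid X k) := by
  obtain ⟨δ, h0, h⟩ := exists_corner_bound hX
  exact fun j => lt_of_lt_of_le (by positivity) (quadKid_corner X h k j)

lemma midline_zero_pos (hX : IsConvexCCW X) (k : Fin 4) : 0 < midline X k (X k) := by
  have h1 := hX k
  have h2 := hX (k + 3)
  rw [(fin_four_add k).2.2.2.2.2.2.1, (fin_four_add k).2.2.2.2.2.2.2.1] at h2
  rw [midline_vertex_zero]
  positivity

lemma midline_three_pos (hX : IsConvexCCW X) (k : Fin 4) : 0 < midline X k (X (k + 3)) := by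
  have h1 := hX (k + 1)
  have h2 := hX (k + 2)
  rw [(fin_four_add k).1, (fin_four_add k).2.1] at h1
  rw [(fin_four_add k).2.2.2.1, (fin_four_add k).2.2.2.2.1] at h2
  rw [midline_vertex_three]
  positivity

lemma midline_one_neg (hX : IsConvexCCW X) (k : Fin 4) : midline X k (X (k + 1)) < 0 := by
  rw [midline_vertex_one]; linarith [midline_zero_pos hX k]

lemma midline_two_neg (hX : IsConvexCCW X) (k : Fin 4) : midline X k (X (k + 2)) < 0 := by
  rw [midline_vertex_two]; linarith [midline_three_pos hX k]

lemma mem_quadKid_iff (hX : IsConvexCCW X) (k : Fin 4) (x : Plane) :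
    x ∈ hull (quadKid X k) ↔ 0 ≤ cross (X k) (X (k + 1)) x ∧ 0 ≤ midline X k x ∧
      0 ≤ midline X (k + 1) x ∧ 0 ≤ cross (X (k + 3)) (X k) x := by
  rw [Polygon.mem_hull_iff (quadKid_convex hX k), fin_four_forall]
  obtain ⟨h0, h1, h2, h3⟩ := quadKid_cross X k x
  change 0 ≤ cross (quadKid X k 0) (quadKid X k 1) x ∧
    0 ≤ cross (quadKid X k 1) (quadKid X k 2) x ∧
    0 ≤ cross (quadKid X k 2) (quadKid X k 3) x ∧
    0 ≤ cross (quadKid X k 3) (quadKid X k 0) x ↔ _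
  rw [h0, h1, h2, h3]
  constructor <;> rintro ⟨a, b, c, d⟩ <;> refine ⟨?_, ?_, ?_, ?_⟩ <;> linarith

lemma mem_interior_quadKid (hX : IsConvexCCW X) (k : Fin 4) {x : Plane}
    (hx : x ∈ interior (hull (quadKid X k))) : 0 < midline X k x ∧ 0 < midline X (k + 1) x := by
  rw [mem_interior_hull_iff (quadKid_convex hX k)] at hx
  obtain ⟨h0, h1, h2, h3⟩ := quadKid_cross X k x
  have a1 : 0 < cross (quadKid X k 1) (quadKid X k 2) x := hx 1
  have a2 : 0 < cross (quadKid X k 2) (quadKid X k 3) x := hx 2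
  rw [h1] at a1
  rw [h2] at a2
  constructor <;> linarith

lemma quadCenter_mem_interior (hX : IsConvexCCW X) : quadCenter X ∈ interior (hull X) := by
  rw [mem_interior_hull_iff hX]
  intro i
  have h2 := hX i
  have h3 := cross_vertex_nonneg hX i (i + 3)
  have : cross (X i) (X (i + 1)) (quadCenter X) =
      (cross (X i) (X (i + 1)) (X (i + 2)) + cross (X i) (X (i + 1)) (X (i + 3))) / 4 := by
    unfold cross; simp only [quadCenter_coord X i]; ring
  rw [this]
  positivity

lemma quadKid_vertex {k : Fin 4} {v : Plane} (hv : v ∈ range (quadKid X k)) :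
    v = X k ∨ (∃ i, v = midpoint ℝ (X i) (X (i + 1))) ∨ v = quadCenter X := by
  obtain ⟨j, rfl⟩ := hv
  fin_cases j
  · exact Or.inl rfl
  · exact Or.inr (Or.inl ⟨k, rfl⟩)
  · exact Or.inr (Or.inr rfl)
  · exact Or.inr (Or.inl ⟨k + 3, by rw [(fin_four_add k).2.2.2.2.2.2.1]; rfl⟩)

lemma vertex_mem_quadKid (hX : IsConvexCCW X) {k i : Fin 4} (h : X i ∈ hull (quadKid X k)) :
    i = k := by
  obtain ⟨-, h1, h2, -⟩ := (mem_quadKid_iff hX k _).mp h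
  rcases fin_four_cases k i with rfl | rfl | rfl | rfl
  · rfl
  · exact absurd h1 (midline_one_neg hX k).not_ge
  · exact absurd h1 (midline_two_neg hX k).not_ge
  · have := midline_two_neg hX (k + 1)
    rw [(fin_four_add k).2.1] at this
    exact absurd h2 this.not_ge

lemma midpoint_mem_quadKid (hX : IsConvexCCW X) {k i : Fin 4}
    (h : midpoint ℝ (X i) (X (i + 1)) ∈ hull (quadKid X k)) :
    midpoint ℝ (X i) (X (i + 1)) ∈ range (quadKid X k) := by
  obtain ⟨-, h1, h2, -⟩ := (mem_quadKid_iff hX k _).mp h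
  obtain ⟨e1, e2, e3, e4, e5, e6, e7, e8, e9⟩ := fin_four_add k
  rcases fin_four_cases k i with rfl | rfl | rfl | rfl
  · exact ⟨1, rfl⟩
  · rw [midline_midpoint, e1] at h1
    linarith [midline_one_neg hX k, midline_two_neg hX k]
  · rw [midline_midpoint, e4] at h2
    have a1 := midline_one_neg hX (k + 1)
    have a2 := midline_two_neg hX (k + 1)
    rw [e1] at a1
    rw [e2] at a2
    linarith
  · rw [e7]; exact ⟨3, rfl⟩

lemma combo_neg {u v s : ℝ} (hu : u < 0) (hv : v < 0) (h0 : 0 ≤ s) (h1 : s ≤ 1) :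
    (1 - s) * u + s * v < 0 := by
  rcases h0.eq_or_lt with rfl | h
  · simpa using hu
  · have := mul_neg_of_pos_of_neg h hv
    have := mul_nonpos_of_nonneg_of_nonpos (sub_nonneg.mpr h1) hu.le
    linarith

lemma quadKid_edge (X : Elem 4) (k : Fin 4) : ∀ j,
    (∃ i, HalfOf (edge X i) (edge (quadKid X k) j)) ∨
      ∃ K' ∈ quadKids X, ∃ j', K' j' = quadKid X k (j + 1) ∧ K' (j' + 1) = quadKid X k j := by
  obtain ⟨e1, e2, e3, e4, e5, e6, e7, e8, e9⟩ := fin_four_add k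
  have a1 : (1 : Fin 4) + 1 = 2 := rfl
  have a2 : (2 : Fin 4) + 1 = 3 := rfl
  rw [fin_four_forall]
  refine ⟨Or.inl ⟨k, halfOf_left _ _⟩,
    Or.inr ⟨quadKid X (k + 1), quadKid_mem X _, 2, ?_, ?_⟩,
    Or.inr ⟨quadKid X (k + 3), quadKid_mem X _, 1, ?_, ?_⟩, Or.inl ⟨k + 3, ?_⟩⟩
  · rw [a1, quadKid_two, quadKid_two]
  · rw [a2, quadKid_three, quadKid_one, e3]
  · rw [a2, quadKid_one, quadKid_three, e7]
  · rw [a1, quadKid_two, quadKid_two]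
  · unfold edge
    rw [e7, quadKid_three]
    exact halfOf_right (X (k + 3)) (X k)

lemma redSystem_quadKids : RedSystem quadKids := by
  refine ⟨fun {X K} hX hK => ?_, fun {X} hX => ?_, fun {X K K'} hX hK hK' hne => ?_,
    fun {X K v} hX hK hv h => ?_, fun {X K K' v} hX hK hK' hv h => ?_,
    fun {X K i p q} hX hK hpq hp hq hpK hqK => ?_,
    fun {X K v} hX hK hv => ?_, fun {X K} hX hK j => ?_,
    fun {X K i j} hX hK hi hj => ?_, fun X i => ⟨?_, ?_⟩⟩
  · obtain ⟨k, rfl⟩ := mem_quadKids.mp hK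
    exact quadKid_convex hX k
  · apply Subset.antisymm
    · intro x hx
      rw [Polygon.mem_hull_iff hX] at hx
      simp only [mem_iUnion]
      have key : ∀ k, 0 ≤ midline X k x → 0 ≤ midline X (k + 1) x →
          ∃ K, ∃ (_ : K ∈ quadKids X), x ∈ hull K := by
        intro k h1 h2
        have h3 := hx (k + 3)
        rw [(fin_four_add k).2.2.2.2.2.2.1] at h3
        exact ⟨_, quadKid_mem X k, (mem_quadKid_iff hX k x).mpr ⟨hx k, h1, h2, h3⟩⟩
      have m2 : midline X 2 x = -midline X 0 x := midline_two X 0 x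
      have m3 : midline X 3 x = -midline X 1 x := midline_two X 1 x
      rcases le_total 0 (midline X 0 x) with h0 | h0 <;>
        rcases le_total 0 (midline X 1 x) with h1 | h1
      · exact key 0 h0 h1
      · exact key 3 (by linarith) h0
      · refine key 1 h1 ?_
        change 0 ≤ midline X 2 x
        linarith
      · refine key 2 (by linarith) ?_
        change 0 ≤ midline X 3 x
        linarith
    · refine iUnion₂_subset fun K hK => hull_subset_hull fun i => ?_
      obtain ⟨k, rfl⟩ := mem_quadKids.mp hK
      rcases quadKid_vertex (mem_range_self (f := quadKid X k) i) with h | ⟨j, h⟩ | h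
      · rw [h]; exact vertex_mem_hull X _
      · rw [h]; exact midpoint_mem_hull X j
      · rw [h]; exact interior_subset (quadCenter_mem_interior hX)
  · rw [disjoint_left]
    intro x hx hx'
    obtain ⟨k, rfl⟩ := mem_quadKids.mp hK
    obtain ⟨l, rfl⟩ := mem_quadKids.mp hK'
    obtain ⟨a1, a2⟩ := mem_interior_quadKid hX k hx
    obtain ⟨b1, b2⟩ := mem_interior_quadKid hX l hx'
    obtain ⟨e1, e2, e3, e4, e5, e6, e7, e8, e9⟩ := fin_four_add k
    rcases fin_four_cases k l with rfl | rfl | rfl | rfl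
    · exact hne rfl
    · rw [e1, midline_two] at b2; linarith
    · rw [midline_two] at b1; linarith
    · rw [midline_three] at b1; linarith
  · obtain ⟨i, rfl⟩ := hv
    obtain ⟨k, rfl⟩ := mem_quadKids.mp hK
    rw [vertex_mem_quadKid hX h]; exact ⟨0, rfl⟩
  · obtain ⟨k, rfl⟩ := mem_quadKids.mp hK
    obtain ⟨l, rfl⟩ := mem_quadKids.mp hK'
    rcases quadKid_vertex hv with rfl | ⟨i, rfl⟩ | rfl
    · rw [vertex_mem_quadKid hX h]; exact ⟨0, rfl⟩
    · exact midpoint_mem_quadKid hX h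
    · exact ⟨2, rfl⟩
  · obtain ⟨s, s0, s1, rfl⟩ := mem_segment_iff.mp hp
    obtain ⟨t, t0, t1, rfl⟩ := mem_segment_iff.mp hq
    obtain ⟨k, rfl⟩ := mem_quadKids.mp hK
    obtain ⟨e1, e2, e3, e4, e5, e6, e7, e8, e9⟩ := fin_four_add k
    rcases fin_four_cases k i with rfl | rfl | rfl | rfl
    · have key : ∀ r : ℝ, (AffineMap.lineMap (X i) (X (i + 1)) r : Plane) ∈
          hull (quadKid X i) → r ≤ 1 / 2 := by
        intro r hr
        have h1 := ((mem_quadKid_iff hX i _).mp hr).2.1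
        have h2 := midline_zero_pos hX i
        rw [midline_lineMap, midline_vertex_one] at h1
        by_contra hlt; nlinarith
      exact ⟨0, halfOf_left _ _, lineMap_mem_segment_midpoint s0 (key s hpK),
        lineMap_mem_segment_midpoint t0 (key t hqK)⟩
    · exfalso
      have h1 := ((mem_quadKid_iff hX k _).mp hpK).2.1
      have h2 := midline_one_neg hX k
      have h3 := midline_two_neg hX k
      rw [midline_lineMap, e1] at h1
      exact absurd h1 (combo_neg h2 h3 s0 s1).not_ge
    · exfalso
      have h1 := ((mem_quadKid_iff hX k _).mp hpK).2.2.1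
      have h2 := midline_one_neg hX (k + 1)
      have h3 := midline_two_neg hX (k + 1)
      rw [e1] at h2
      rw [e2] at h3
      rw [midline_lineMap, e4] at h1
      exact absurd h1 (combo_neg h2 h3 s0 s1).not_ge
    · rw [e7] at hp hq hpK hqK hpq ⊢
      have key : ∀ r : ℝ, (AffineMap.lineMap (X (k + 3)) (X k) r : Plane) ∈
          hull (quadKid X k) → 1 / 2 ≤ r := by
        intro r hr
        have h1 := ((mem_quadKid_iff hX k _).mp hr).2.2.1
        have h2 := midline_three_pos hX (k + 1)
        have h3 := midline_vertex_two X (k + 1)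
        rw [e3] at h2 h3
        rw [e2] at h3
        rw [midline_lineMap, h3] at h1
        by_contra hlt; nlinarith
      refine ⟨3, ?_, lineMap_mem_segment_midpoint' (key s hpK) s1,
        lineMap_mem_segment_midpoint' (key t hqK) t1⟩
      have := halfOf_right (X (k + 3)) (X k)
      unfold edge
      rw [e7]
      exact this
  · obtain ⟨k, rfl⟩ := mem_quadKids.mp hK
    rcases quadKid_vertex hv with rfl | h | rfl
    · exact Or.inl ⟨k, rfl⟩
    · exact Or.inr (Or.inl h)
    · exact Or.inr (Or.inr (quadCenter_mem_interior hX))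
  · obtain ⟨k, rfl⟩ := mem_quadKids.mp hK
    exact quadKid_edge X k j
  · obtain ⟨k, rfl⟩ := mem_quadKids.mp hK
    rw [vertex_mem_quadKid hX hi, vertex_mem_quadKid hX hj]
  · exact ⟨_, quadKid_mem X i, 0, rfl, rfl⟩
  · refine ⟨_, quadKid_mem X (i + 1), 3, ?_, rfl⟩
    rw [quadKid_three, (fin_four_add i).2.2.1]

end

/-! ### The steps Mark and Closure -/

section Steps

variable {n : ℕ} [NeZero n]

omit [NeZero n] in
lemma mark_subset (A : Finset (Quartet n)) (Tm : Finset (Elem n)) : mark A Tm ⊆ A := by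
  classical
  unfold mark; exact Finset.filter_subset _ _

lemma mem_blockIrregular {M : Mesh n} {A : Finset (Quartet n)} {Q : Quartet n}
    (h : Q ∈ blockIrregular M A) : Q ∈ A ∧ ∀ T ∈ Q, ¬ HasIrregularEdge M T := by
  classical
  unfold blockIrregular at h; exact Finset.mem_filter.mp h

omit [NeZero n] in
/-- The loop ends with a subset all of whose members are kept. -/
lemma pruneLoop_spec (keep : Finset (Quartet n) → Quartet n → Prop) (A : Finset (Quartet n)) :
    pruneLoop keep A ⊆ A ∧ ∀ Q ∈ pruneLoop keep A, keep (pruneLoop keep A) Q := by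
  classical
  induction A using pruneLoop.induct (keep := keep) with
  | case1 A h =>
    rw [pruneLoop, if_pos h]
    refine ⟨Finset.Subset.refl _, fun Q hQ => ?_⟩
    rw [← h] at hQ
    exact (Finset.mem_filter.mp hQ).2
  | case2 A h ih =>
    rw [pruneLoop, if_neg h]
    exact ⟨ih.1.trans (Finset.filter_subset _ _), ih.2⟩

/-- Weights `2` on the heavy and at most `1` on the other indices bound the number of the latter. -/
lemma encard_lt_of_sum {m : ℕ} {w : Fin m → ℕ} {p : Fin m → Prop} {d : ℕ} (h2 : ∀ i, w i ≤ 2)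
    (h1 : ∀ i, ¬ p i → w i ≤ 1) (hs : 2 * m < ∑ i, w i + d) : {i | ¬ p i}.encard < d := by
  classical
  have hle : ∑ i, w i + (Finset.univ.filter fun i => ¬ p i).card ≤ 2 * m := by
    rw [Finset.card_filter, ← Finset.sum_add_distrib]
    calc ∑ i, (w i + if ¬ p i then 1 else 0) ≤ ∑ _i : Fin m, 2 := by
          refine Finset.sum_le_sum fun i _ => ?_
          by_cases h : p i
          · simpa [h] using h2 i
          · simpa [h] using h1 i h
      _ = 2 * m := by simp [mul_comm]
  have : {i | ¬ p i} = ((Finset.univ.filter fun i => ¬ p i : Finset (Fin m)) : Set (Fin m)) := by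
    ext; simp
  rw [this, Set.encard_coe_eq_coe_finsetCard]
  have hlt : (Finset.univ.filter fun i => ¬ p i).card < d := by omega
  exact_mod_cast hlt

omit [NeZero n] in
lemma forest_cases {kids : Elem n → Finset (Elem n)} {M₀ : Mesh n} {T : Elem n}
    (h : T ∈ forest kids M₀) : T ∈ M₀.elements ∨ ∃ X ∈ forest kids M₀, T ∈ kids X := by
  obtain ⟨L, hL, h⟩ := h
  rcases Relation.ReflTransGen.cases_tail h with rfl | ⟨X, h1, h2⟩
  · exact Or.inl hL
  · exact Or.inr ⟨X, ⟨L, hL, h1⟩, h2⟩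

lemma RedSystem.refined_of_kid [Polygon n] {kids : Elem n → Finset (Elem n)} (hk : RedSystem kids)
    {R : Set Plane} {M₀ M : Mesh n} (hT : IsTriangulation R M₀) {X K : Elem n}
    (hX : X ∈ forest kids M₀) (hKX : K ∈ kids X) (hK : K ∈ M.elements) :
    HasBeenRefined kids M₀ M X :=
  hk.refined_of_desc hT hX hK (Relation.ReflTransGen.single hKX)
    (hk.kid_ne (hk.forest_convex hT hX) hKX Relation.ReflTransGen.refl)

end Steps

/-! ### Quartets of quadrilaterals -/

section Quad

variable {R : Set Plane} {M₀ M : Mesh 4} {X T : Elem 4}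

/-- The list of vertices of a child starts with its oldest vertex. -/
lemma quadKid_vert (hT : IsTriangulation R M₀) (hC : IsConforming M₀)
    (hr : IsRedRefinement quadKids M₀ M) (hX : X ∈ forest quadKids M₀) {k : Fin 4}
    (hk : quadKid X k ∈ M.elements) (j : Fin 4) : vert M (quadKid X k) j = quadKid X k j := by
  have hM := redSystem_quadKids.isReached hT hr
  obtain ⟨hE, hI⟩ := redSystem_quadKids.respectAges hT hC hr
  have hXr := redSystem_quadKids.refined_of_kid hT hX (quadKid_mem X k) hk
  have cX := redSystem_quadKids.forest_convex hT hX
  have : oldestPos M (quadKid X k) = 0 := by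
    refine oldestPos_eq (hM.tri.vertex_mem_nodes hk) (vertex_injective (quadKid_convex cX k)) ?_
    rw [fin_four_forall]
    refine ⟨le_rfl, (hE X hXr k).1.le, ?_, ?_⟩
    · exact (hI X hXr _ (quadKid_mem X k) (quadCenter X) ⟨2, rfl⟩
        (quadCenter_mem_interior cX) k).le
    · have := (hE X hXr (k + 3)).2
      rw [(fin_four_add k).2.2.2.2.2.2.1] at this
      exact this.le
  unfold vert
  rw [this, zero_add]

/-- If the third vertex of an element is not an initial node, then it is the center of the parent
of this element. -/
lemma exists_parent_of_vert (hT : IsTriangulation R M₀) (hC : IsConforming M₀)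
    (hr : IsRedRefinement quadKids M₀ M) (hTM : T ∈ M.elements) (hv : vert M T 2 ∉ M₀.nodes) :
    ∃ X ∈ forest quadKids M₀, T ∈ quadKids X ∧ vert M T 2 = quadCenter X := by
  have hM := redSystem_quadKids.isReached hT hr
  rcases forest_cases (hM.mem_forest T hTM) with h | ⟨X, hX, h⟩
  · exact absurd (hT.vertex_mem_nodes h _) hv
  · refine ⟨X, hX, h, ?_⟩
    obtain ⟨k, rfl⟩ := mem_quadKids.mp h
    exact quadKid_vert hT hC hr hX hTM 2

/-- Elements with the same center would be nested; the center of the larger one would then be a vertex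
of the smaller one, and not its center. -/
lemma quadCenter_injOn (hT : IsTriangulation R M₀) {Y : Elem 4} (hX : X ∈ forest quadKids M₀)
    (hY : Y ∈ forest quadKids M₀) (h : quadCenter X = quadCenter Y) : X = Y := by
  have hk := redSystem_quadKids
  have cX := hk.forest_convex hT hX
  have cY := hk.forest_convex hT hY
  have iX := quadCenter_mem_interior cX
  have iY := quadCenter_mem_interior cY
  by_contra hne
  rcases hk.comparable_of_mem hT hX hY iX (h ▸ interior_subset iY) with h' | h'
  · obtain ⟨j, hj⟩ := hk.desc_new_vertex cX h' (Ne.symm hne) (quadKid_mem X 0)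
      (v := quadCenter X) ⟨2, rfl⟩ (h ▸ interior_subset iY)
    exact vertex_notMem_interior cY j (by rw [hj, h]; exact iY)
  · obtain ⟨j, hj⟩ := hk.desc_new_vertex cY h' hne (quadKid_mem Y 0)
      (v := quadCenter Y) ⟨2, rfl⟩ (h ▸ interior_subset iX)
    exact vertex_notMem_interior cX j (by rw [hj, ← h]; exact iX)

/-- Admissible quartets consist of the four children of some element. -/
lemma quadAdmissible_sound (hT : IsTriangulation R M₀) (hC : IsConforming M₀)
    (hr : IsRedRefinement quadKids M₀ M) {Q : Quartet 4} (hQ : Q ∈ quadAdmissible M₀.nodes M) :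
    ∃ P ∈ forest quadKids M₀, Q = quadKids P ∧ quadKids P ⊆ M.elements := by
  classical
  have hk := redSystem_quadKids
  have hM := hk.isReached hT hr
  unfold quadAdmissible at hQ
  simp only [Finset.mem_image, Finset.mem_filter] at hQ
  obtain ⟨T, ⟨hTM, hcard, hv⟩, rfl⟩ := hQ
  obtain ⟨X, hX, hTX, hvX⟩ := exists_parent_of_vert hT hC hr hTM hv
  have cX := hk.forest_convex hT hX
  rw [hvX] at hcard hv ⊢
  have hsub : (M.elements.filter fun K => vert M K 2 = quadCenter X) ⊆ quadKids X := by
    intro K hK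
    obtain ⟨hKM, hKv⟩ := Finset.mem_filter.mp hK
    obtain ⟨Y, hY, hKY, hvY⟩ := exists_parent_of_vert hT hC hr hKM (by rw [hKv]; exact hv)
    rw [quadCenter_injOn hT hX hY (hKv.symm.trans hvY)]
    exact hKY
  have hle : (quadKids X).card ≤ 4 := by
    have : quadKids X ⊆ Finset.univ.image (quadKid X) := by
      intro K hK
      obtain ⟨k, rfl⟩ := mem_quadKids.mp hK
      exact Finset.mem_image_of_mem _ (Finset.mem_univ k)
    exact (Finset.card_le_card this).trans Finset.card_image_le
  have heq := Finset.eq_of_subset_of_card_le hsub (by omega)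
  have hsubM : quadKids X ⊆ M.elements := by
    rw [← heq]; exact Finset.filter_subset _ _
  refine ⟨X, hX, ?_, hsubM⟩
  ext K
  rw [Finset.mem_filter]
  constructor
  · rintro ⟨hKM, hKc⟩
    exact hk.mem_kids_of_comparable hT hM hX hsubM hKM
      (hk.comparable_of_mem hT hX (hM.mem_forest K hKM) (quadCenter_mem_interior cX) hKc)
  · intro hK
    refine ⟨hsubM hK, ?_⟩
    obtain ⟨k, rfl⟩ := mem_quadKids.mp hK
    exact vertex_mem_hull (quadKid X k) 2

lemma mem_quadParentVerts (hT : IsTriangulation R M₀) (hC : IsConforming M₀)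
    (hr : IsRedRefinement quadKids M₀ M) (hX : X ∈ forest quadKids M₀)
    (hXM : quadKids X ⊆ M.elements) (v : Plane) :
    v ∈ quadParentVerts M (quadKids X) ↔ v ∈ range X := by
  classical
  unfold quadParentVerts
  rw [Finset.mem_image]
  constructor
  · rintro ⟨K, hK, rfl⟩
    obtain ⟨k, rfl⟩ := mem_quadKids.mp hK
    rw [quadKid_vert hT hC hr hX (hXM hK)]
    exact ⟨k, rfl⟩
  · rintro ⟨k, rfl⟩
    exact ⟨_, quadKid_mem X k, quadKid_vert hT hC hr hX (hXM (quadKid_mem X k)) 0⟩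

/-- If the weights of a quartet of quadrilaterals sum to at least `6`, then at most two edges of
its parent have a midpoint of weight less than `2`. -/
lemma quad_encard_lt (hT : IsTriangulation R M₀) (hC : IsConforming M₀)
    (hr : IsRedRefinement quadKids M₀ M) (hX : X ∈ forest quadKids M₀)
    (hXM : quadKids X ⊆ M.elements) {A : Finset (Quartet 4)}
    (hs : ¬ ∑ v ∈ stencil M (quadKids X), quadWeight M A (quadKids X) v ≤ 5) :
    {i | ¬ IsHeavy M (quadParentVerts M) A (quadKids X)
      (midpoint ℝ (X i) (X (i + 1)))}.encard < (3 : ℕ) := by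
  classical
  have hW2 : ∀ v, quadWeight M A (quadKids X) v ≤ 2 := by
    intro v; unfold quadWeight; split_ifs <;> norm_num
  have hc : quadWeight M A (quadKids X) (quadCenter X) = 0 := by
    unfold quadWeight
    rw [if_pos]
    exact ⟨_, quadKid_mem X 0, (quadKid_vert hT hC hr hX (hXM (quadKid_mem X 0)) 2).symm⟩
  refine encard_lt_of_sum
    (w := fun i => quadWeight M A (quadKids X) (midpoint ℝ (X i) (X (i + 1))))
    (fun i => hW2 _) (fun i hi => ?_) ?_
  · unfold quadWeight
    split_ifs with h1 h2
    · norm_num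
    · refine absurd ?_ hi
      rcases h2 with h | h | ⟨Q', hQ', hne, h⟩
      · exact Or.inl h
      · exact Or.inr (Or.inl h)
      · refine Or.inr (Or.inr ⟨Q', hQ', hne, ?_⟩)
        unfold stencil at h
        exact Finset.mem_sdiff.mp h
    · exact le_rfl
  · have hsub : stencil M (quadKids X) ⊆ insert (quadCenter X)
        (Finset.univ.image fun i => midpoint ℝ (X i) (X (i + 1))) := by
      intro v hv
      unfold stencil at hv
      obtain ⟨h1, h2⟩ := Finset.mem_sdiff.mp hv
      rw [mem_quadParentVerts hT hC hr hX hXM] at h2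
      obtain ⟨K, hK, hvK⟩ := mem_quartetNodes.mp h1
      obtain ⟨k, rfl⟩ := mem_quadKids.mp hK
      rcases quadKid_vertex hvK with rfl | ⟨i, rfl⟩ | rfl
      · exact absurd ⟨k, rfl⟩ h2
      · exact Finset.mem_insert_of_mem (Finset.mem_image_of_mem _ (Finset.mem_univ i))
      · exact Finset.mem_insert_self _ _
    have h1 := Finset.sum_le_sum_of_subset (f := quadWeight M A (quadKids X)) hsub
    have h2 : ∑ v ∈ insert (quadCenter X)
        (Finset.univ.image fun i => midpoint ℝ (X i) (X (i + 1))),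
        quadWeight M A (quadKids X) v ≤ ∑ v ∈ (Finset.univ.image fun i : Fin 4 =>
          midpoint ℝ (X i) (X (i + 1))), quadWeight M A (quadKids X) v := by
      by_cases hin : quadCenter X ∈ (Finset.univ.image fun i : Fin 4 =>
          midpoint ℝ (X i) (X (i + 1)))
      · rw [Finset.insert_eq_of_mem hin]
      · rw [Finset.sum_insert hin, hc, zero_add]
    have h3 := Finset.sum_image_le_of_nonneg (s := (Finset.univ : Finset (Fin 4)))
      (g := fun i => midpoint ℝ (X i) (X (i + 1))) (f := quadWeight M A (quadKids X))
      (fun _ _ => Nat.zero_le _)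
    omega

end Quad

/-! ### Quartets of triangles -/

section Tri

variable {R : Set Plane} {M₀ M : Mesh 3} {X T : Elem 3}

/-- In a child of a refined triangle, a vertex of the parent is the oldest vertex. -/
lemma RespectsGenerations.le_of_mem_kid (hT : IsTriangulation R M₀)
    (hg : RespectsGenerations triKids M₀ M) (hX : HasBeenRefined triKids M₀ M X) {K : Elem 3}
    (hK : K ∈ triKids X) {v : Plane} (hvX : v ∈ range X) (hvK : v ∈ range K) (l : Fin 3) :
    age M v ≤ age M (K l) := by
  have cX := redSystem_triKids.forest_convex hT hX.1
  obtain ⟨i, rfl⟩ := hvX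
  by_cases hl : K l ∈ range X
  · obtain ⟨j, hj⟩ := hl
    obtain ⟨m, hm⟩ := hvK
    have h1 : X i ∈ hull K := hm ▸ vertex_mem_hull K m
    have h2 : X j ∈ hull K := hj ▸ vertex_mem_hull K l
    rw [← hj, redSystem_triKids.vertex_unique cX hK h1 h2]
  · exact (hg X hX i K hK l hl).le

lemma triCorner_vert (hT : IsTriangulation R M₀) (hr : IsRedRefinement triKids M₀ M)
    (hg : RespectsGenerations triKids M₀ M) (hX : X ∈ forest triKids M₀) {k : Fin 3}
    (hk : triCorner X k ∈ M.elements) : vert M (triCorner X k) 0 = X k := by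
  have hM := redSystem_triKids.isReached hT hr
  have hXr := redSystem_triKids.refined_of_kid hT hX (triCorner_mem X k) hk
  have cX := redSystem_triKids.forest_convex hT hX
  have : oldestPos M (triCorner X k) = 0 :=
    oldestPos_eq (hM.tri.vertex_mem_nodes hk)
      (vertex_injective (triKids_convex cX (triCorner_mem X k)))
      (hg.le_of_mem_kid hT hXr (triCorner_mem X k) ⟨k, rfl⟩ ⟨0, rfl⟩)
  rw [vert_zero, this, triCorner_zero]

/-- An element that shares half of an edge of `X` with the child of `X` at the vertex `X k` has no
vertex older than `X k`: by the laminarity of the edges, it is itself a child of an element with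
the vertex `X k`. -/
lemma age_le_of_half_edge (hT : IsTriangulation R M₀) (hC : IsConforming M₀)
    (hr : IsRedRefinement triKids M₀ M) (hg : RespectsGenerations triKids M₀ M)
    (hX : X ∈ forest triKids M₀) {k : Fin 3} (hkM : triCorner X k ∈ M.elements)
    (hk0 : X k ∉ M₀.nodes) {K : Elem 3} (hK : K ∈ M.elements) {i j l : Fin 3}
    (he : edge K j = edge (triCorner X k) i)
    (hhalf : HalfOf (edge X l) (edge (triCorner X k) i)) (hkl : X k ∈ edge X l)
    (hki : X k ∈ edge (triCorner X k) i)
    (m : Fin 3) : age M (X k) ≤ age M (K m) := by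
  have hk := redSystem_triKids
  have hM := hk.isReached hT hr
  have cX := hk.forest_convex hT hX
  have cC := triKids_convex cX (triCorner_mem X k)
  have hkK : X k ∈ range K := by
    rw [← he] at hki
    rcases Sym2.mem_iff.mp hki with h | h
    · exact ⟨j, h.symm⟩
    · exact ⟨j + 1, h.symm⟩
  rcases forest_cases (hM.mem_forest K hK) with h | ⟨Y, hY, hKY⟩
  · exact absurd ((hT.mem_nodes _).mpr ⟨K, h, hkK⟩) hk0
  have cY := hk.forest_convex hT hY
  have hYr := hk.refined_of_kid hT hY hKY hK
  suffices hkY : X k ∈ range Y from hg.le_of_mem_kid hT hYr hKY hkY hkK m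
  rcases hk.kid_edge cY hKY j with ⟨i', hi'⟩ | ⟨K', hK', j', e1, e2⟩
  · rw [he] at hi'
    have hsX := hhalf.seg_subset
    have hsY := hi'.seg_subset
    have hp : triCorner X k i ∈ seg (edge (triCorner X k) i) := left_mem_segment ℝ _ _
    have hq : triCorner X k (i + 1) ∈ seg (edge (triCorner X k) i) := right_mem_segment ℝ _ _
    have hlen : 0 < len (edge (triCorner X k) i) := dist_pos.mpr (edge_ne cC i)
    have hXY : edge X l = edge Y i' := by
      rcases hk.forest_laminar hT hC hX hY (edge_ne cC i) (hsX hp) (hsX hq) (hsY hp) (hsY hq)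
        with h | h
      · exact Bisects.eq_of_half h hhalf hi' hlen
      · exact (Bisects.eq_of_half h hi' hhalf hlen).symm
    rw [hXY] at hkl
    rcases Sym2.mem_iff.mp hkl with h | h
    · exact ⟨i', h.symm⟩
    · exact ⟨i' + 1, h.symm⟩
  · -- both `K'` and the child of `X` are the neighbor of `K` across the common edge
    by_cases hKC : K = triCorner X k
    · subst hKC
      rw [hk.parent_unique hT hY hX hKY (triCorner_mem X k)]
      exact mem_range_self k
    have cK := hM.tri.convexCCW K hK
    have hKK : K ≠ K' := by
      rintro rfl
      have h1 := vertex_injective cK e1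
      rw [h1] at e2
      have h2 := vertex_injective cK e2
      rw [(fin_three_add j).1] at h2
      exact add_two_ne cK j h2
    have heK' : edge K j = edge K' j' := by
      unfold edge; rw [e1, e2]; exact Sym2.eq_swap
    have := hk.neighbor_unique hT (hM.mem_forest K hK) (hM.mem_forest _ hkM)
      (forest_desc hY (Relation.ReflTransGen.single hK')) hKC hKK he heK'
    rw [← this] at hK'
    rw [hk.parent_unique hT hY hX hK' (triCorner_mem X k)]
    exact mem_range_self k

/-- No element that shares an edge with the child of `X` at the vertex `X k` has a vertex older than
`X k`. -/
lemma age_le_of_common_edge (hT : IsTriangulation R M₀) (hC : IsConforming M₀)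
    (hr : IsRedRefinement triKids M₀ M) (hg : RespectsGenerations triKids M₀ M)
    (hX : X ∈ forest triKids M₀) {k : Fin 3} (hkM : triCorner X k ∈ M.elements)
    (hk0 : X k ∉ M₀.nodes) {K : Elem 3} (hK : K ∈ M.elements) {i j : Fin 3}
    (he : edge K j = edge (triCorner X k) i) (m : Fin 3) : age M (X k) ≤ age M (K m) := by
  have hk := redSystem_triKids
  have hM := hk.isReached hT hr
  have cX := hk.forest_convex hT hX
  have hXr := hk.refined_of_kid hT hX (triCorner_mem X k) hkM
  obtain ⟨f1, f2, f3, f4⟩ := fin_three_add k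
  fin_cases i
  · exact age_le_of_half_edge hT hC hr hg hX hkM hk0 hK he (l := k) (halfOf_left _ _)
      (Sym2.mem_iff.mpr (Or.inl rfl)) (Sym2.mem_iff.mpr (Or.inl rfl)) m
  · -- the edge inside of `X` belongs to the middle triangle only
    by_cases hKC : K = triCorner X k
    · subst hKC
      exact hg.le_of_mem_kid hT hXr (triCorner_mem X k) ⟨k, rfl⟩ ⟨0, rfl⟩ m
    have hmid : edge (triCorner X k) 1 = edge (triMid X) (k + 2) := by
      unfold edge
      rw [f3, triMid_apply, triMid_apply, f3, Sym2.eq_swap]; rfl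
    have hne : triCorner X k ≠ triMid X := by
      intro h
      have := vertex_notMem_triMid cX k
      rw [← h] at this
      exact this (vertex_mem_hull (triCorner X k) 0)
    have hKm := hk.neighbor_unique hT (hM.mem_forest _ hkM) (hM.mem_forest K hK)
      (forest_desc hX (Relation.ReflTransGen.single (triMid_mem X))) (Ne.symm hKC) hne
      he.symm hmid
    subst hKm
    refine (hg X hXr k _ (triMid_mem X) m ?_).le
    rw [triMid_apply]
    exact midpoint_notMem_range cX m
  · refine age_le_of_half_edge hT hC hr hg hX hkM hk0 hK he (l := k + 2) ?_ ?_
      (Sym2.mem_iff.mpr (Or.inr rfl)) m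
    · have := halfOf_right (X (k + 2)) (X k)
      unfold edge
      rw [f3]
      exact this
    · unfold edge
      rw [f3]
      exact Sym2.mem_iff.mpr (Or.inr rfl)

/-- Every middle element is the middle triangle of the refinement of its parent. -/
lemma IsMiddle.exists_parent (hT : IsTriangulation R M₀) (hC : IsConforming M₀)
    (hr : IsRedRefinement triKids M₀ M) (hg : RespectsGenerations triKids M₀ M)
    (h : IsMiddle M₀.nodes M T) : ∃ X ∈ forest triKids M₀, T = triMid X := by
  have hk := redSystem_triKids
  have hM := hk.isReached hT hr
  obtain ⟨hTM, hv, hmid⟩ := h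
  rcases forest_cases (hM.mem_forest T hTM) with h | ⟨X, hX, h⟩
  · exact absurd (hT.vertex_mem_nodes h _) hv
  rcases mem_triKids.mp h with rfl | ⟨k, rfl⟩
  · exact ⟨X, hX, rfl⟩
  exfalso
  have hvk := triCorner_vert hT hr hg hX hTM
  rw [hvk] at hv
  apply hmid
  have hage : ∀ i, edgeAge M (edge (triCorner X k) i) = age M (X k) := by
    intro i
    have hmem : age M (X k) ∈ {a | ∃ K ∈ M.elements,
        (∃ j, edge K j = edge (triCorner X k) i) ∧ a = age M (vert M K 0)} :=
      ⟨_, hTM, ⟨i, rfl⟩, by rw [hvk]⟩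
    refine le_antisymm (Nat.sInf_le hmem) (le_csInf ⟨_, hmem⟩ ?_)
    rintro a ⟨K, hK, ⟨j, hj⟩, rfl⟩
    rw [vert_zero]
    exact age_le_of_common_edge hT hC hr hg hX hTM hv hK hj _
  intro i j
  rw [hage, hage]

/-- Admissible quartets consist of the four children of some element, and the algorithm recognizes
the middle one among them. -/
lemma triAdmissible_sound (hT : IsTriangulation R M₀) (hC : IsConforming M₀)
    (hr : IsRedRefinement triKids M₀ M) (hg : RespectsGenerations triKids M₀ M) {Q : Quartet 3}
    (hQ : Q ∈ triAdmissible M₀.nodes M) : ∃ P ∈ forest triKids M₀, Q = triKids P ∧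
      triKids P ⊆ M.elements ∧ IsMiddle M₀.nodes M (triMid P) := by
  classical
  have hk := redSystem_triKids
  have hM := hk.isReached hT hr
  unfold triAdmissible at hQ
  simp only [Finset.mem_image, Finset.mem_filter] at hQ
  obtain ⟨T, ⟨hTM, hmid, hcard⟩, rfl⟩ := hQ
  obtain ⟨X, hX, rfl⟩ := hmid.exists_parent hT hC hr hg
  have cX := hk.forest_convex hT hX
  have hXm := hM.mem_forest _ hTM
  have hsub : directNeighbors M (triMid X) ⊆ Finset.univ.image (triCorner X) := by
    intro K hK
    unfold directNeighbors at hK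
    obtain ⟨hKM, hne, i, j, he⟩ := Finset.mem_filter.mp hK
    have hedge : edge (triMid X) i = edge (triCorner X (i + 1)) 1 := by
      unfold edge
      rw [triMid_apply, triMid_apply, Sym2.eq_swap]
      change _ = s(_, triCorner X (i + 1) 2)
      rw [triCorner_one, triCorner_two, (fin_three_add i).2.1]
    have hne' : triMid X ≠ triCorner X (i + 1) := by
      intro h
      have := vertex_notMem_triMid cX (i + 1)
      rw [h] at this
      exact this (vertex_mem_hull (triCorner X (i + 1)) 0)
    have := hk.neighbor_unique hT hXm (hM.mem_forest K hKM)
      (forest_desc hX (Relation.ReflTransGen.single (triCorner_mem X (i + 1))))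
      (fun h => hne (by rw [h])) hne' he hedge
    rw [this]
    exact Finset.mem_image_of_mem _ (Finset.mem_univ _)
  have hle : (Finset.univ.image (triCorner X)).card ≤ 3 := Finset.card_image_le
  have heq := Finset.eq_of_subset_of_card_le hsub (by omega)
  have hQ : {triMid X} ∪ directNeighbors M (triMid X) = triKids X := by
    ext K
    rw [heq, mem_triKids]
    simp [eq_comm]
  refine ⟨X, hX, hQ, ?_, hmid⟩
  rw [← hQ]
  refine Finset.union_subset (Finset.singleton_subset_iff.mpr hTM) ?_
  unfold directNeighbors
  exact Finset.filter_subset _ _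

/-- The algorithm does not mistake a child that contains a vertex of its parent for a middle one. -/
lemma triCorner_not_isMiddle (hT : IsTriangulation R M₀) (hC : IsConforming M₀)
    (hr : IsRedRefinement triKids M₀ M) (hg : RespectsGenerations triKids M₀ M)
    (hX : X ∈ forest triKids M₀) (k : Fin 3) : ¬ IsMiddle M₀.nodes M (triCorner X k) := by
  intro h
  obtain ⟨Y, hY, hXY⟩ := h.exists_parent hT hC hr hg
  have := redSystem_triKids.parent_unique hT hX hY (triCorner_mem X k) (hXY ▸ triMid_mem Y)
  subst this
  have := vertex_notMem_triMid (redSystem_triKids.forest_convex hT hX) k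
  rw [← hXY] at this
  exact this (vertex_mem_hull (triCorner X k) 0)

lemma mem_triParentVerts (hT : IsTriangulation R M₀) (hC : IsConforming M₀)
    (hr : IsRedRefinement triKids M₀ M) (hg : RespectsGenerations triKids M₀ M)
    (hX : X ∈ forest triKids M₀) (hXM : triKids X ⊆ M.elements)
    (hmid : IsMiddle M₀.nodes M (triMid X)) (v : Plane) :
    v ∈ triParentVerts M₀.nodes M (triKids X) ↔ v ∈ range X := by
  classical
  unfold triParentVerts
  simp only [Finset.mem_image, Finset.mem_filter]
  constructor
  · rintro ⟨K, ⟨hK, hn⟩, rfl⟩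
    rcases mem_triKids.mp hK with rfl | ⟨k, rfl⟩
    · exact absurd hmid hn
    · rw [triCorner_vert hT hr hg hX (hXM hK)]
      exact ⟨k, rfl⟩
  · rintro ⟨k, rfl⟩
    exact ⟨_, ⟨triCorner_mem X k, triCorner_not_isMiddle hT hC hr hg hX k⟩,
      triCorner_vert hT hr hg hX (hXM (triCorner_mem X k))⟩

lemma mem_middleNodes (hT : IsTriangulation R M₀) (hC : IsConforming M₀)
    (hr : IsRedRefinement triKids M₀ M) (hg : RespectsGenerations triKids M₀ M)
    (hX : X ∈ forest triKids M₀) {v : Plane} (hv : v ∈ middleNodes M₀.nodes M (triKids X)) :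
    ∃ i, v = midpoint ℝ (X i) (X (i + 1)) := by
  classical
  unfold middleNodes at hv
  obtain ⟨K, hK, i, rfl⟩ := mem_quartetNodes.mp hv
  obtain ⟨hK, hm⟩ := Finset.mem_filter.mp hK
  rcases mem_triKids.mp hK with rfl | ⟨k, rfl⟩
  · exact ⟨i, triMid_apply X i⟩
  · exact absurd hm (triCorner_not_isMiddle hT hC hr hg hX k)

/-- If the weights of a quartet of triangles sum to at least `5`, then at most one edge of its
parent has a midpoint of weight less than `2`. -/
lemma tri_encard_lt (hT : IsTriangulation R M₀) (hC : IsConforming M₀)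
    (hr : IsRedRefinement triKids M₀ M) (hg : RespectsGenerations triKids M₀ M)
    (hX : X ∈ forest triKids M₀) {A : Finset (Quartet 3)}
    (hA : A ⊆ triAdmissible M₀.nodes M)
    (hs : ¬ ∑ v ∈ middleNodes M₀.nodes M (triKids X),
      triWeight M₀.nodes M A (triKids X) v ≤ 4) :
    {i | ¬ IsHeavy M (triParentVerts M₀.nodes M) A (triKids X)
      (midpoint ℝ (X i) (X (i + 1)))}.encard < (2 : ℕ) := by
  classical
  refine encard_lt_of_sum
    (w := fun i => triWeight M₀.nodes M A (triKids X) (midpoint ℝ (X i) (X (i + 1))))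
    (fun i => ?_) (fun i hi => ?_) ?_
  · unfold triWeight; split_ifs <;> norm_num
  · unfold triWeight
    split_ifs with h2
    · refine absurd ?_ hi
      rcases h2 with h | h | ⟨Q', hQ', hne, h⟩
      · exact Or.inl h
      · exact Or.inr (Or.inl h)
      · obtain ⟨P, hP, rfl, hPM, hmid⟩ := triAdmissible_sound hT hC hr hg (hA hQ')
        refine Or.inr (Or.inr ⟨_, hQ', hne, ?_, ?_⟩)
        · obtain ⟨j, hj⟩ := mem_middleNodes hT hC hr hg hP h
          exact mem_quartetNodes.mpr ⟨_, triMid_mem P, j, by rw [triMid_apply, hj]⟩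
        · obtain ⟨j, hj⟩ := mem_middleNodes hT hC hr hg hP h
          rw [mem_triParentVerts hT hC hr hg hP hPM hmid, hj]
          exact midpoint_notMem_range (redSystem_triKids.forest_convex hT hP) j
    · exact le_rfl
  · have hsub : middleNodes M₀.nodes M (triKids X) ⊆
        Finset.univ.image fun i => midpoint ℝ (X i) (X (i + 1)) := by
      intro v hv
      obtain ⟨i, rfl⟩ := mem_middleNodes hT hC hr hg hX hv
      exact Finset.mem_image_of_mem _ (Finset.mem_univ i)
    have h1 := Finset.sum_le_sum_of_subset (f := triWeight M₀.nodes M A (triKids X)) hsub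
    have h3 := Finset.sum_image_le_of_nonneg (s := (Finset.univ : Finset (Fin 3)))
      (g := fun i => midpoint ℝ (X i) (X (i + 1))) (f := triWeight M₀.nodes M A (triKids X))
      (fun _ _ => Nat.zero_le _)
    omega

end Tri

/-! ### Shape regularity -/

lemma dist_sq_eq (a b : Plane) : dist a b ^ 2 = (a 0 - b 0) ^ 2 + (a 1 - b 1) ^ 2 := by
  rw [dist_eq_norm, EuclideanSpace.norm_sq_eq, Fin.sum_univ_two]
  simp

lemma abs_det_le (a b x y : Plane) :
    |(b 0 - a 0) * (y 1 - x 1) - (b 1 - a 1) * (y 0 - x 0)| ≤ dist a b * dist x y := by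
  refine abs_le_of_sq_le_sq ?_ (by positivity)
  rw [mul_pow, dist_sq_eq, dist_sq_eq]
  nlinarith [sq_nonneg ((b 0 - a 0) * (y 0 - x 0) + (b 1 - a 1) * (y 1 - x 1))]

lemma cross_le_dist_mul (a b c : Plane) : cross a b c ≤ dist a b * dist b c := by
  refine le_trans (le_of_eq ?_) ((le_abs_self _).trans (abs_det_le a b b c))
  unfold cross; ring

section Shape

variable {n : ℕ} [NeZero n]

/-- Up to the scale `s`, the edges of `X` have at most the length `B`, and the triangles spanned by
successive vertices have at least the area `δ / 2`. -/
def IsShaped (B δ : ℝ) (X : Elem n) : Prop :=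
  ∃ s : ℝ, 0 < s ∧ (∀ i, dist (X i) (X (i + 1)) ≤ s * B) ∧
    ∀ i, s ^ 2 * δ ≤ cross (X i) (X (i + 1)) (X (i + 2))

lemma IsRotation.isShaped {B δ : ℝ} {T P : Elem n} (h : IsRotation T P) (hP : IsShaped B δ P) :
    IsShaped B δ T := by
  obtain ⟨r, hr⟩ := h
  obtain ⟨s, h0, h1, h2⟩ := hP
  refine ⟨s, h0, fun i => ?_, fun i => ?_⟩
  · rw [hr, hr, show i + 1 + r = i + r + 1 by ring]
    exact h1 _
  · rw [hr, hr, hr, show i + 1 + r = i + r + 1 by ring, show i + 2 + r = i + r + 2 by ring]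
    exact h2 _

lemma exists_isShaped (E : Finset (Elem n)) (hE : ∀ T ∈ E, IsConvexCCW T) :
    ∃ B δ : ℝ, 0 < B ∧ 0 < δ ∧ ∀ T ∈ E, IsShaped B δ T := by
  classical
  suffices h : ∃ B δ : ℝ, 0 < B ∧ 0 < δ ∧ ∀ T ∈ E, (∀ i, dist (T i) (T (i + 1)) ≤ B) ∧
      ∀ i, δ ≤ cross (T i) (T (i + 1)) (T (i + 2)) by
    obtain ⟨B, δ, h1, h2, h3⟩ := h
    exact ⟨B, δ, h1, h2, fun T hT => ⟨1, one_pos, by simpa using (h3 T hT).1,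
      by simpa using (h3 T hT).2⟩⟩
  induction E using Finset.induction_on with
  | empty => exact ⟨1, 1, one_pos, one_pos, by simp⟩
  | insert X E _ ih =>
    obtain ⟨B, δ, hB, hδ, h⟩ := ih fun T hT => hE T (Finset.mem_insert_of_mem hT)
    obtain ⟨δ', hδ', h'⟩ := exists_corner_bound (hE X (Finset.mem_insert_self _ _))
    obtain ⟨j, hj⟩ := Finite.exists_max fun i => dist (X i) (X (i + 1))
    refine ⟨max B (dist (X j) (X (j + 1))), min δ δ', lt_max_of_lt_left hB, lt_min hδ hδ',
      fun T hT => ?_⟩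
    rcases Finset.mem_insert.mp hT with rfl | hT
    · exact ⟨fun i => (hj i).trans (le_max_right _ _), fun i => (min_le_right _ _).trans (h' i)⟩
    · exact ⟨fun i => ((h T hT).1 i).trans (le_max_left _ _),
        fun i => (min_le_left _ _).trans ((h T hT).2 i)⟩

lemma forest_isShaped {kids : Elem n → Finset (Elem n)} {M₀ : Mesh n} {B δ : ℝ}
    (h0 : ∀ T ∈ M₀.elements, IsShaped B δ T)
    (hkids : ∀ X K : Elem n, K ∈ kids X → IsShaped B δ X → IsShaped B δ K) {P : Elem n}
    (hP : P ∈ forest kids M₀) : IsShaped B δ P := by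
  obtain ⟨T, hT, h⟩ := hP
  induction h with
  | refl => exact h0 T hT
  | tail _ h ih => exact hkids _ _ h ih

lemma AreQuartets.isShaped [Polygon n] {kids : Elem n → Finset (Elem n)} {R : Set Plane}
    {M₀ M : Mesh n} {pv : Quartet n → Finset Plane} {A : Finset (Quartet n)}
    (hA : AreQuartets kids M₀ M pv A) (hk : RedSystem kids) (hT : IsTriangulation R M₀)
    (hM : IsReached kids R M₀ M) {B δ : ℝ} (hs : ∀ P ∈ forest kids M₀, IsShaped B δ P)
    {T : Elem n} (h : T ∈ (update M pv A).elements) : IsShaped B δ T := by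
  rcases (hA.mem_update_iff hk hT).mp h with ⟨g1, -⟩ | ⟨P, hP, -, g1, -⟩
  · exact hs T (hM.mem_forest T g1)
  · exact g1.isShaped (hs P hP)

end Shape

lemma dist_midpoint_midpoint (a b c : Plane) :
    dist (midpoint ℝ a b) (midpoint ℝ b c) = dist a c / 2 := by
  rw [midpoint_comm a b, dist_eq_norm, dist_eq_norm]
  have : midpoint ℝ b a - midpoint ℝ b c = (2⁻¹ : ℝ) • (a - c) := by
    apply plane_ext <;> simp [midpoint_coord] <;> ring
  rw [this, norm_smul]; norm_num; ring

lemma dist_left_mid (a b : Plane) : dist a (midpoint ℝ a b) = dist a b / 2 := by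
  rw [dist_left_midpoint]; norm_num; ring

lemma dist_mid_right (a b : Plane) : dist (midpoint ℝ a b) b = dist a b / 2 := by
  rw [dist_midpoint_right]; norm_num; ring

lemma triKids_isShaped {B δ : ℝ} {X K : Elem 3} (hK : K ∈ triKids X) (hX : IsShaped B δ X) :
    IsShaped B δ K := by
  obtain ⟨s, h0, h1, h2⟩ := hX
  refine ⟨s / 2, by positivity, fun i => ?_, fun i => ?_⟩
  · suffices h : ∃ j, dist (K i) (K (i + 1)) = dist (X j) (X (j + 1)) / 2 by
      obtain ⟨j, hj⟩ := h
      rw [hj]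
      linarith [h1 j]
    rcases mem_triKids.mp hK with rfl | ⟨k, rfl⟩
    · refine ⟨i + 2, ?_⟩
      rw [triMid_apply, triMid_apply, dist_midpoint_midpoint, (fin_three_add i).1,
        (fin_three_add i).2.2.1, dist_comm]
    · obtain ⟨f1, f2, f3, f4⟩ := fin_three_add k
      have a1 : (1 : Fin 3) + 1 = 2 := rfl
      have a2 : (2 : Fin 3) + 1 = 0 := rfl
      revert i
      rw [fin_three_forall]
      refine ⟨⟨k, dist_left_mid _ _⟩, ⟨k + 1, ?_⟩, ⟨k + 2, ?_⟩⟩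
      · rw [a1, triCorner_one, triCorner_two, midpoint_comm (X k), midpoint_comm (X (k + 2)),
          dist_midpoint_midpoint, f1]
      · rw [a2, f3]
        exact dist_mid_right _ _
  · have h3 := h2 0
    change s ^ 2 * δ ≤ triArea X at h3
    rw [triArea_eq, triKids_area hK]
    linarith

lemma tri_diam_le {s B : ℝ} {T : Elem 3} (hB : 0 ≤ s * B)
    (h : ∀ i, dist (T i) (T (i + 1)) ≤ s * B) : Metric.diam (hull T) ≤ s * B := by
  unfold hull
  rw [convexHull_diam]
  refine Metric.diam_le_of_forall_dist_le hB ?_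
  rintro _ ⟨i, rfl⟩ _ ⟨j, rfl⟩
  rcases fin_three_cases i j with rfl | rfl | rfl
  · rwa [dist_self]
  · exact h i
  · rw [dist_comm]
    have := h (i + 2)
    rwa [(fin_three_add i).2.2.1] at this

lemma le_inDiam {n : ℕ} {T : Elem n} {x : Plane} {r : ℝ} (hr : 0 ≤ r)
    (h : Metric.closedBall x r ⊆ hull T) : 2 * r ≤ inDiam (hull T) := by
  unfold inDiam
  refine le_csSup ⟨Metric.diam (hull T), ?_⟩ ⟨x, r, hr, h, rfl⟩
  rintro _ ⟨y, t, ht, hy, rfl⟩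
  have hv : ‖(EuclideanSpace.single 0 1 : Plane)‖ = 1 := by simp
  have hp : ∀ u : ℝ, |u| ≤ t → y + u • (EuclideanSpace.single 0 1 : Plane) ∈ hull T := by
    intro u hu
    apply hy
    rw [Metric.mem_closedBall, dist_eq_norm, add_sub_cancel_left, norm_smul, hv, mul_one]
    exact hu
  have := Metric.dist_le_diam_of_mem ((finite_range T).isCompact_convexHull (𝕜 := ℝ)).isBounded
    (hp t (abs_of_nonneg ht).le) (hp (-t) (by rw [abs_neg, abs_of_nonneg ht]))
  refine le_trans (le_of_eq ?_) this
  rw [dist_eq_norm, add_sub_add_left_eq_sub, ← sub_smul, norm_smul, hv, mul_one, Real.norm_eq_abs,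
    abs_of_nonneg (by linarith)]
  ring

/-- A triangle with long enough altitudes contains a ball around its centroid. -/
lemma tri_closedBall_subset {s B δ : ℝ} {T : Elem 3} (hs : 0 < s) (hB : 0 < B)
    (hδ : 0 < δ) (h1 : ∀ i, dist (T i) (T (i + 1)) ≤ s * B)
    (h2 : ∀ i, s ^ 2 * δ ≤ cross (T i) (T (i + 1)) (T (i + 2))) :
    ∃ x, Metric.closedBall x (s * δ / (3 * B)) ⊆ hull T := by
  have hT : IsConvexCCW T := fun i => lt_of_lt_of_le (by positivity) (h2 i)
  refine ⟨AffineMap.lineMap (T 0) (midpoint ℝ (T 1) (T 2)) (2 / 3 : ℝ), fun x hx => ?_⟩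
  set c : Plane := AffineMap.lineMap (T 0) (midpoint ℝ (T 1) (T 2)) (2 / 3 : ℝ) with hc
  have hcc : ∀ j : Fin 2, c j = (T 0 j + T 1 j + T 2 j) / 3 := by
    intro j; rw [hc, lineMap_coord, midpoint_coord]; ring
  have hcc' : ∀ (i : Fin 3) (j : Fin 2), c j = (T i j + T (i + 1) j + T (i + 2) j) / 3 := by
    intro i j
    rw [hcc]
    fin_cases i
    · rfl
    · change _ = (T 1 j + T 2 j + T 0 j) / 3; ring
    · change _ = (T 2 j + T 0 j + T 1 j) / 3; ring
  rw [Polygon.mem_hull_iff hT]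
  intro i
  have e1 : cross (T i) (T (i + 1)) x = cross (T i) (T (i + 1)) (T (i + 2)) / 3 +
      ((T (i + 1) 0 - T i 0) * (x 1 - c 1) - (T (i + 1) 1 - T i 1) * (x 0 - c 0)) := by
    unfold cross; rw [hcc' i, hcc' i]; ring
  have e2 := (abs_le.mp (abs_det_le (T i) (T (i + 1)) c x)).1
  have e3 : dist (T i) (T (i + 1)) * dist c x ≤ s * B * (s * δ / (3 * B)) := by
    refine mul_le_mul (h1 i) ?_ dist_nonneg (by positivity)
    rw [dist_comm]; exact hx
  have e4 : s * B * (s * δ / (3 * B)) = s ^ 2 * δ / 3 := by field_simp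
  have e5 := h2 i
  linarith

lemma tri_diam_le_inDiam {B δ : ℝ} (hB : 0 < B) (hδ : 0 < δ) {T : Elem 3} (hT : IsShaped B δ T) :
    Metric.diam (hull T) ≤ max 1 (3 * B ^ 2 / (2 * δ)) * inDiam (hull T) := by
  obtain ⟨s, hs, h1, h2⟩ := hT
  obtain ⟨x, hx⟩ := tri_closedBall_subset hs hB hδ h1 h2
  have h3 := le_inDiam (by positivity) hx
  calc Metric.diam (hull T) ≤ s * B := tri_diam_le (by positivity) h1
    _ = 3 * B ^ 2 / (2 * δ) * (2 * (s * δ / (3 * B))) := by field_simp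
    _ ≤ _ := mul_le_mul (le_max_right _ _) h3 (by positivity)
      (le_max_of_le_left zero_le_one)

lemma quadKids_isShaped {B δ : ℝ} {X K : Elem 4} (hK : K ∈ quadKids X) (hX : IsShaped B δ X) :
    IsShaped B δ K := by
  obtain ⟨s, h0, h1, h2⟩ := hX
  obtain ⟨k, rfl⟩ := mem_quadKids.mp hK
  refine ⟨s / 2, by positivity, ?_, fun i => ?_⟩
  · obtain ⟨e1, e2, e3, e4, e5, e6, e7, e8, e9⟩ := fin_four_add k
    have a1 : (1 : Fin 4) + 1 = 2 := rfl
    have a2 : (2 : Fin 4) + 1 = 3 := rfl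
    have a3 : (3 : Fin 4) + 1 = 0 := rfl
    have b0 := h1 k
    have b1 := h1 (k + 1)
    have b2 := h1 (k + 2)
    have b3 := h1 (k + 3)
    rw [e1] at b1
    rw [e4] at b2
    rw [e7] at b3
    have hc1 : quadCenter X = midpoint ℝ (midpoint ℝ (X k) (X (k + 1)))
        (midpoint ℝ (X (k + 3)) (X (k + 2))) := by
      apply plane_ext <;> rw [quadCenter_coord X k] <;> simp only [midpoint_coord] <;> ring
    have hc2 : quadCenter X = midpoint ℝ (midpoint ℝ (X (k + 2)) (X (k + 1)))
        (midpoint ℝ (X (k + 3)) (X k)) := by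
      apply plane_ext <;> rw [quadCenter_coord X k] <;> simp only [midpoint_coord] <;> ring
    rw [fin_four_forall]
    refine ⟨?_, ?_, ?_, ?_⟩
    · have := dist_left_mid (X k) (X (k + 1))
      change dist (X k) (midpoint ℝ (X k) (X (k + 1))) ≤ _
      linarith
    · rw [a1, quadKid_one, quadKid_two, hc1, dist_left_mid]
      have := dist_midpoint_midpoint_le (X k) (X (k + 1)) (X (k + 3)) (X (k + 2))
      rw [dist_comm (X k) (X (k + 3))] at this
      linarith
    · rw [a2, quadKid_two, quadKid_three, hc2, dist_mid_right]
      have := dist_midpoint_midpoint_le (X (k + 2)) (X (k + 1)) (X (k + 3)) (X k)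
      rw [dist_comm (X (k + 1)) (X k)] at this
      linarith
    · rw [a3, quadKid_three, quadKid_zero, dist_mid_right]
      linarith
  · have := quadKid_corner X h2 k i
    linarith

lemma quad_edge_ratio {B δ : ℝ} (hB : 0 < B) (hδ : 0 < δ) {T : Elem 4} (hT : IsShaped B δ T)
    (i j : Fin 4) :
    dist (T i) (T (i + 1)) ≤ max 1 (B ^ 2 / δ) * dist (T j) (T (j + 1)) := by
  obtain ⟨s, hs, h1, h2⟩ := hT
  have h3 : s * δ / B ≤ dist (T j) (T (j + 1)) := by
    rw [div_le_iff₀ hB]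
    have a1 := (h2 j).trans (cross_le_dist_mul _ _ _)
    have a2 := h1 (j + 1)
    rw [(fin_four_add j).1] at a2
    have a3 := mul_le_mul_of_nonneg_left a2 (dist_nonneg (x := T j) (y := T (j + 1)))
    have a4 : s * (s * δ) ≤ s * (dist (T j) (T (j + 1)) * B) := by nlinarith
    exact le_of_mul_le_mul_left a4 hs
  calc dist (T i) (T (i + 1)) ≤ s * B := h1 i
    _ = B ^ 2 / δ * (s * δ / B) := by field_simp
    _ ≤ _ := mul_le_mul (le_max_right _ _) h3 (by positivity)
      (le_max_of_le_left zero_le_one)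

/-- The squares of the inner product and of the determinant add up to the squared product of the
norms, so the angles stay away from `0` and `π` if the determinant is not too small. The number
`1 / 2` only ensures that the bound is positive. -/
lemma quad_cos_le {B δ : ℝ} (hB : 0 < B) (hδ : 0 < δ) {T : Elem 4} (hT : IsShaped B δ T)
    (i : Fin 4) : |Real.cos (EuclideanGeometry.angle (T (i + 3)) (T i) (T (i + 1)))| ≤
      √(max (1 / 2) (1 - δ ^ 2 / B ^ 4)) := by
  obtain ⟨s, hs, h1, h2⟩ := hT
  apply Real.abs_le_sqrt
  refine le_trans ?_ (le_max_right _ _)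
  have hD := h2 (i + 3)
  have hp := h1 (i + 3)
  have hq := h1 i
  rw [(fin_four_add i).2.2.2.2.2.2.1] at hD hp
  rw [(fin_four_add i).2.2.2.2.2.2.2.1] at hD
  rw [EuclideanGeometry.angle, InnerProductGeometry.cos_angle, vsub_eq_sub, vsub_eq_sub,
    ← dist_eq_norm, ← dist_eq_norm, dist_comm (T (i + 1))]
  generalize T (i + 3) = p at *
  generalize T i = q at *
  generalize T (i + 1) = r at *
  have hin : inner ℝ (p - q) (r - q) = (p 0 - q 0) * (r 0 - q 0) + (p 1 - q 1) * (r 1 - q 1) := by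
    simp [PiLp.inner_apply, Fin.sum_univ_two]; ring
  have hN : (dist p q * dist q r) ^ 2 = inner ℝ (p - q) (r - q) ^ 2 + cross p q r ^ 2 := by
    rw [mul_pow, dist_sq_eq, dist_sq_eq, hin]; unfold cross; ring
  have hDpos : 0 < cross p q r := lt_of_lt_of_le (by positivity) hD
  have hNle : dist p q * dist q r ≤ s ^ 2 * B ^ 2 := by
    calc dist p q * dist q r ≤ (s * B) * (s * B) :=
          mul_le_mul hp hq dist_nonneg (by positivity)
      _ = _ := by ring
  have hNpos : 0 < (dist p q * dist q r) ^ 2 := by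
    rw [hN]; positivity
  have hNle2 : (dist p q * dist q r) ^ 2 ≤ (s ^ 2 * B ^ 2) ^ 2 :=
    pow_le_pow_left₀ (by positivity) hNle 2
  have hD2 : (s ^ 2 * δ) ^ 2 ≤ cross p q r ^ 2 := pow_le_pow_left₀ (by positivity) hD 2
  rw [div_pow, div_le_iff₀ hNpos]
  have hkey : δ ^ 2 / B ^ 4 * (dist p q * dist q r) ^ 2 ≤ cross p q r ^ 2 := by
    calc δ ^ 2 / B ^ 4 * (dist p q * dist q r) ^ 2 ≤ δ ^ 2 / B ^ 4 * (s ^ 2 * B ^ 2) ^ 2 :=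
          mul_le_mul_of_nonneg_left hNle2 (by positivity)
      _ = (s ^ 2 * δ) ^ 2 := by field_simp
      _ ≤ _ := hD2
  linarith

/-! ### Properties of the coarsened meshes -/

section TriCoarsen

variable {R : Set Plane} {M₀ M : Mesh 3}

lemma triClosure_spec (use2 : Bool) (N₀ : List Plane) (M : Mesh 3) (A : Finset (Quartet 3)) :
    (∀ Q ∈ triClosure use2 N₀ M A, Q ∈ A ∧ ∀ T ∈ Q, ¬ HasIrregularEdge M T) ∧
    (use2 = true → ∀ Q ∈ triClosure use2 N₀ M A,
      ¬ ∑ v ∈ middleNodes N₀ M Q, triWeight N₀ M (triClosure use2 N₀ M A) Q v ≤ 4) := by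
  unfold triClosure
  cases use2 with
  | false => exact ⟨fun Q hQ => mem_blockIrregular (by simpa using hQ), by simp⟩
  | true =>
    simp only [if_true]
    have := pruneLoop_spec (fun A Q => ¬ ∑ v ∈ middleNodes N₀ M Q, triWeight N₀ M A Q v ≤ 4)
      (blockIrregular M A)
    exact ⟨fun Q hQ => mem_blockIrregular (this.1 hQ), fun _ => this.2⟩

lemma tri_areQuartets (hT : IsTriangulation R M₀) (hC : IsConforming M₀)
    (hr : IsRedRefinement triKids M₀ M) (hg : RespectsGenerations triKids M₀ M)
    {A : Finset (Quartet 3)} (hA : A ⊆ triAdmissible M₀.nodes M) :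
    AreQuartets triKids M₀ M (triParentVerts M₀.nodes M) A := by
  intro Q hQ
  obtain ⟨P, hP, rfl, hPM, hmid⟩ := triAdmissible_sound hT hC hr hg (hA hQ)
  exact ⟨P, hP, rfl, hPM, mem_triParentVerts hT hC hr hg hP hPM hmid⟩

lemma triClosure_subset (use2 : Bool) (N₀ : List Plane) (M : Mesh 3) (Tm : Finset (Elem 3)) :
    triClosure use2 N₀ M (mark (triAdmissible N₀ M) Tm) ⊆ triAdmissible N₀ M :=
  fun Q hQ => mark_subset _ _ ((triClosure_spec use2 N₀ M _).1 Q hQ).1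

lemma triCoarsenR_spec (hT : IsTriangulation R M₀) (hC : IsConforming M₀)
    (hr : IsRedRefinement triKids M₀ M) (hg : RespectsGenerations triKids M₀ M)
    (h1 : IsOneIrregular M) (use2 : Bool) (Tm : Finset (Elem 3)) :
    IsTriangulation R (triCoarsenR use2 M₀.nodes M Tm) ∧
    IsOneIrregular (triCoarsenR use2 M₀.nodes M Tm) ∧
    (use2 = true → NeighborRule triKids M₀ 2 M →
      NeighborRule triKids M₀ 2 (triCoarsenR use2 M₀.nodes M Tm)) := by
  have hk := redSystem_triKids
  have hM := hk.isReached hT hr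
  have hsub := triClosure_subset use2 M₀.nodes M Tm
  have hA := tri_areQuartets hT hC hr hg hsub
  obtain ⟨hreg, hw⟩ := triClosure_spec use2 M₀.nodes M (mark (triAdmissible M₀.nodes M) Tm)
  exact ⟨hA.isTriangulation hk hT hM,
    hA.isOneIrregular hk hT h1 fun Q hQ => (hreg Q hQ).2,
    fun hu hN => hA.neighborRule hk hT hM
      (fun P hP hPA => tri_encard_lt hT hC hr hg hP hsub (hw hu _ hPA)) hN⟩

lemma triCoarsenR_shapeRegular (hT : IsTriangulation R M₀) (hC : IsConforming M₀) :
    TriShapeRegular {M' | ∃ (use2 : Bool) (M : Mesh 3) (Tmark : Finset (Elem 3)),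
      IsRedRefinement triKids M₀ M ∧ RespectsGenerations triKids M₀ M ∧ IsOneIrregular M ∧
        Tmark ⊆ M.elements ∧ M' = triCoarsenR use2 M₀.nodes M Tmark} := by
  obtain ⟨B, δ, hB, hδ, h0⟩ := exists_isShaped M₀.elements hT.convexCCW
  refine ⟨_, le_max_left 1 (3 * B ^ 2 / (2 * δ)), ?_⟩
  rintro _ ⟨use2, M, Tm, hr, hg, -, -, rfl⟩ T hTM
  have hk := redSystem_triKids
  exact tri_diam_le_inDiam hB hδ ((tri_areQuartets hT hC hr hg
    (triClosure_subset use2 M₀.nodes M Tm)).isShaped hk hT (hk.isReached hT hr)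
    (fun P hP => forest_isShaped h0 (fun _ _ => triKids_isShaped) hP) hTM)

end TriCoarsen

section QuadCoarsen

variable {R : Set Plane} {M₀ M : Mesh 4}

lemma quad_areQuartets (hT : IsTriangulation R M₀) (hC : IsConforming M₀)
    (hr : IsRedRefinement quadKids M₀ M) {A : Finset (Quartet 4)}
    (hA : A ⊆ quadAdmissible M₀.nodes M) :
    AreQuartets quadKids M₀ M (quadParentVerts M) A := by
  intro Q hQ
  obtain ⟨P, hP, rfl, hPM⟩ := quadAdmissible_sound hT hC hr (hA hQ)
  exact ⟨P, hP, rfl, hPM, mem_quadParentVerts hT hC hr hP hPM⟩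

lemma quadClosure_spec (M : Mesh 4) (A : Finset (Quartet 4)) :
    (∀ Q ∈ quadClosure M A, Q ∈ A ∧ ∀ T ∈ Q, ¬ HasIrregularEdge M T) ∧
    ∀ Q ∈ quadClosure M A, ¬ ∑ v ∈ stencil M Q, quadWeight M (quadClosure M A) Q v ≤ 5 := by
  have := pruneLoop_spec (fun A Q => ¬ ∑ v ∈ stencil M Q, quadWeight M A Q v ≤ 5)
    (blockIrregular M A)
  exact ⟨fun Q hQ => mem_blockIrregular (this.1 hQ), this.2⟩

lemma quadClosure_subset (N₀ : List Plane) (M : Mesh 4) (Tm : Finset (Elem 4)) :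
    quadClosure M (mark (quadAdmissible N₀ M) Tm) ⊆ quadAdmissible N₀ M :=
  fun Q hQ => mark_subset _ _ ((quadClosure_spec M _).1 Q hQ).1

lemma quadCoarsenR_spec (hT : IsTriangulation R M₀) (hC : IsConforming M₀)
    (hr : IsRedRefinement quadKids M₀ M) (h1 : IsOneIrregular M) (Tm : Finset (Elem 4)) :
    IsTriangulation R (quadCoarsenR M₀.nodes M Tm) ∧
    IsOneIrregular (quadCoarsenR M₀.nodes M Tm) ∧
    (NeighborRule quadKids M₀ 3 M →
      NeighborRule quadKids M₀ 3 (quadCoarsenR M₀.nodes M Tm)) := by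
  have hk := redSystem_quadKids
  have hM := hk.isReached hT hr
  have hA := quad_areQuartets hT hC hr (quadClosure_subset M₀.nodes M Tm)
  obtain ⟨hreg, hw⟩ := quadClosure_spec M (mark (quadAdmissible M₀.nodes M) Tm)
  exact ⟨hA.isTriangulation hk hT hM,
    hA.isOneIrregular hk hT h1 fun Q hQ => (hreg Q hQ).2,
    fun hN => hA.neighborRule hk hT hM (fun P hP hPA =>
      quad_encard_lt hT hC hr hP (hA.of_mem hk hT hP hPA).1 (hw _ hPA)) hN⟩

lemma quadCoarsenR_shapeRegular (hT : IsTriangulation R M₀) (hC : IsConforming M₀) :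
    QuadShapeRegular {M' | ∃ (M : Mesh 4) (Tmark : Finset (Elem 4)),
      IsRedRefinement quadKids M₀ M ∧ IsOneIrregular M ∧ Tmark ⊆ M.elements ∧
        M' = quadCoarsenR M₀.nodes M Tmark} := by
  obtain ⟨B, δ, hB, hδ, h0⟩ := exists_isShaped M₀.elements hT.convexCCW
  have hk := redSystem_quadKids
  have key : ∀ M' ∈ {M' | ∃ (M : Mesh 4) (Tmark : Finset (Elem 4)),
      IsRedRefinement quadKids M₀ M ∧ IsOneIrregular M ∧ Tmark ⊆ M.elements ∧
        M' = quadCoarsenR M₀.nodes M Tmark}, ∀ T ∈ M'.elements, IsShaped B δ T := by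
    rintro _ ⟨M, Tm, hr, -, -, rfl⟩ T hTM
    exact (quad_areQuartets hT hC hr (quadClosure_subset M₀.nodes M Tm)).isShaped hk hT
      (hk.isReached hT hr) (fun P hP => forest_isShaped h0 (fun _ _ => quadKids_isShaped) hP) hTM
  refine ⟨⟨_, le_max_left 1 (B ^ 2 / δ), fun M' hM' T hTM i j =>
    quad_edge_ratio hB hδ (key M' hM' T hTM) i j⟩,
    ⟨√(max (1 / 2) (1 - δ ^ 2 / B ^ 4)), Real.sqrt_pos.mpr (lt_max_of_lt_left (by norm_num)), ?_,
      fun M' hM' T hTM i => quad_cos_le hB hδ (key M' hM' T hTM) i⟩⟩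
  rw [Real.sqrt_lt' one_pos, one_pow]
  have : 0 < δ ^ 2 / B ^ 4 := by positivity
  exact max_lt (by norm_num) (by linarith)

end QuadCoarsen

end RedMesh

open RedMesh in
theorem theorem1 :
    (∀ (R : Set Plane) (M₀ : Mesh 3), IsTriangulation R M₀ → IsConforming M₀ →
      (∀ (use2 : Bool) (M : Mesh 3) (Tmark : Finset (Elem 3)),
        IsRedRefinement triKids M₀ M → RespectsGenerations triKids M₀ M → IsOneIrregular M →
        Tmark ⊆ M.elements →
          IsTriangulation R (triCoarsenR use2 M₀.nodes M Tmark) ∧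
          IsOneIrregular (triCoarsenR use2 M₀.nodes M Tmark) ∧
          (use2 = true → NeighborRule triKids M₀ 2 M →
            NeighborRule triKids M₀ 2 (triCoarsenR use2 M₀.nodes M Tmark))) ∧
      TriShapeRegular {M' | ∃ (use2 : Bool) (M : Mesh 3) (Tmark : Finset (Elem 3)),
        IsRedRefinement triKids M₀ M ∧ RespectsGenerations triKids M₀ M ∧ IsOneIrregular M ∧
          Tmark ⊆ M.elements ∧ M' = triCoarsenR use2 M₀.nodes M Tmark}) ∧
    (∀ (R : Set Plane) (M₀ : Mesh 4), IsTriangulation R M₀ → IsConforming M₀ →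
      (∀ (M : Mesh 4) (Tmark : Finset (Elem 4)),
        IsRedRefinement quadKids M₀ M → IsOneIrregular M → Tmark ⊆ M.elements →
          IsTriangulation R (quadCoarsenR M₀.nodes M Tmark) ∧
          IsOneIrregular (quadCoarsenR M₀.nodes M Tmark) ∧
          (NeighborRule quadKids M₀ 3 M →
            NeighborRule quadKids M₀ 3 (quadCoarsenR M₀.nodes M Tmark))) ∧
      QuadShapeRegular {M' | ∃ (M : Mesh 4) (Tmark : Finset (Elem 4)),
        IsRedRefinement quadKids M₀ M ∧ IsOneIrregular M ∧ Tmark ⊆ M.elements ∧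
          M' = quadCoarsenR M₀.nodes M Tmark}) := by
  exact ⟨fun R M₀ hT hC => ⟨fun use2 M Tm hr hg h1 _ => triCoarsenR_spec hT hC hr hg h1 use2 Tm,
      triCoarsenR_shapeRegular hT hC⟩,
    fun R M₀ hT hC => ⟨fun M Tm hr h1 _ => quadCoarsenR_spec hT hC hr h1 Tm,
      quadCoarsenR_shapeRegular hT hC⟩⟩
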